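/- Let $\mathcal{G}\rightrightarrows M$ be a Lie groupoid over $\mathbb R$ (the manifolds $\mathcal G$ and $M$ are finite-dimensional, smooth and Hausdorff) with source $s$, target $t$ (submersions), unit map $\epsilon$ and multiplication $m$, where $m(g,h)$ is defined if $s(g)=t(h)$. Let $\mathcal G^{(0)}=M$ and, for $p\ge 1$, let $\mathcal G^{(p)}\subset \mathcal G^p$ be the manifold of strings $(g_1,\dots,g_p)$ with $s(g_i)=t(g_{i+1})$; in particular $\mathcal G^{(1)}=\mathcal G$. Let $\partial_i:\mathcal G^{(p+1)}\to\mathcal G^{(p)}$, $0\le i\le p+1$, be the face maps (for $p=0$: $\partial_0=s$, $\partial_1=t$; for $p\geq 1$: $\partial_0$ drops the first arrow, $\partial_{p+1}$ drops the last one, and $\partial_i$ replaces $g_i,g_{i+1}$ by $m(g_i,g_{i+1})$ for $1\le i\le p$), and let $s_i:\mathcal G^{(p)}\to\mathcal G^{(p+1)}$, $0\le i\le p$, be the degeneracy maps (insertion of a unit; for $p=0$, $s_0=\epsilon$). Put $\delta=\sum_{i=0}^{p+1}(-1)^i\partial_i^*:\Omega^\bullet(\mathcal G^{(p)})\to\Omega^\bullet(\mathcal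 G^{(p+1)})$. The Bott–Shulman–Stasheff double complex is $\Omega^\bullet(\mathcal G^{(\bullet)})=\bigoplus_{p}\Omega^\bullet(\mathcal G^{(p)})$, with total differential equal to $d+(-1)^q\delta$ on $\Omega^q(\mathcal G^{(p)})$. A derivation of degree $l\in\mathbb Z$ of $\Omega^\bullet(\mathcal G^{(\bullet)})$ is a sequence $(D_0,D_1,\dots)$ in which $D_p$ is a derivation of degree $l$ of the graded algebra $\Omega^\bullet(\mathcal G^{(p)})$ and $s_i^*\circ D_{p+1}=D_p\circ s_i^*$ for all $p$ and $0\le i\le p$. It commutes with the total differential if its graded commutator with it (the total differential having degree one) vanishes. A vector-valued form $K\in\Omega^k(\mathcal G,T\mathcal G)$ is multiplicative if, viewed as a map $\oplus^k T\mathcal G\to T\mathcal G$, it is a groupoid morphism covering some $K_M\in\Omega^k(M,TM)$, viewed as a map $\oplus^kTM\to TM$; here $T\mathcal G\rightrightarrows TM$ is the tangent groupoid and $\oplus^kT\mathcal G\rightrightarrows\oplus^kTM$ is its $k$-fold sum, with componentwise structure maps. For a vector-valued $k$-form $K$ on a manifold let $$(i_K\omega)(X_1,\dots,X_{k+p-1})=\tfrac{1}{k!(p-1)!}\sum_{\sigma\in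 S_{k+p-1}}\mathrm{sgn}(\sigma)\,\omega(K(X_{\sigma(1)},\dots,X_{\sigma(k)}),X_{\sigma(k+1)},\dots,X_{\sigma(k+p-1)})$$ for $\omega$ of degree $p\ge1$, let $i_K=0$ on functions, and let $\mathcal L_K=d\,i_K-(-1)^{k-1}i_K\,d$. The Frölicher–Nijenhuis bracket of $K$ and $L$, of degrees $k$ and $l$, is the vector-valued $(k+l)$-form $[K,L]$ determined by $\mathcal L_{[K,L]}=\mathcal L_K\mathcal L_L-(-1)^{kl}\mathcal L_L\mathcal L_K$. **Statement.** For each multiplicative $K\in\Omega^k(\mathcal G,T\mathcal G)$ the form $K_M$ is unique, and for each $p\ge1$ the form $K\times\cdots\times K$ on $\mathcal G^p$ restricts to a vector-valued $k$-form $K^{(p)}$ on $\mathcal G^{(p)}$ (with $K^{(1)}=K$). The assignment $$K\longmapsto(\mathcal L_{K_M},\mathcal L_K,\mathcal L_{K^{(2)}},\dots,\mathcal L_{K^{(p)}},\dots)$$ is a graded linear isomorphism from the multiplicative vector-valued forms on $\mathcal G$ onto the derivations of $\Omega^\bullet(\mathcal G^{(\bullet)})$ which commute with the total differential: it is a linear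 isomorphism in each degree $k\ge0$, and there are no non-zero such derivations of negative degree. As a consequence, the Frölicher–Nijenhuis bracket restricts to multiplicative forms: if $K$ and $L$ are multiplicative, so is $[K,L]$, and the isomorphism sends $[K,L]$ to the sequence of graded commutators of the images of $K$ and $L$. -/

import Mathlib

open scoped ContDiff Manifold Topology DirectSum

universe u

noncomputable section

namespace MultForms

/-! ### Exterior algebra on a vector space -/

section Algebra

variable {V : Type*}

theorem upd_left_left {p q : ℕ} (v : Fin (p + q) → V) (i : Fin p) (z : V) :
    (fun j => Function.update v (Fin.castAdd q i) z (Fin.castAdd q j)) =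
      Function.update (fun j => v (Fin.castAdd q j)) i z :=
  Function.update_comp_eq_of_injective v (Fin.castAdd_injective p q) i z

theorem upd_left_right {p q : ℕ} (v : Fin (p + q) → V) (i : Fin p) (z : V) :
    (fun j => Function.update v (Fin.castAdd q i) z (Fin.natAdd p j)) =
      fun j => v (Fin.natAdd p j) := by
  funext j
  rw [Function.update_of_ne]
  simp [Fin.ext_iff]
  omega

theorem upd_right_right {p q : ℕ} (v : Fin (p + q) → V) (i : Fin q) (z : V) :
    (fun j => Function.update v (Fin.natAdd p i) z (Fin.natAdd p j)) =
      Function.update (fun j => v (Fin.natAdd p j)) i z :=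
  Function.update_comp_eq_of_injective v (Fin.natAdd_injective q p) i z

theorem upd_right_left {p q : ℕ} (v : Fin (p + q) → V) (i : Fin q) (z : V) :
    (fun j => Function.update v (Fin.natAdd p i) z (Fin.castAdd q j)) =
      fun j => v (Fin.castAdd q j) := by
  funext j
  rw [Function.update_of_ne]
  simp [Fin.ext_iff]
  omega

variable [AddCommGroup V] [Module ℝ V] [TopologicalSpace V]

/-- The multilinear map `v ↦ α (v₁, …, v_p) * β (v_{p+1}, …, v_{p+q})`. -/
def tensorAt {p q : ℕ} (α : V [⋀^Fin p]→L[ℝ] ℝ) (β : V [⋀^Fin q]→L[ℝ] ℝ) :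
    ContinuousMultilinearMap ℝ (fun _ : Fin (p + q) => V) ℝ where
  toFun v := α (fun i => v (Fin.castAdd q i)) * β (fun j => v (Fin.natAdd p j))
  map_update_add' v i x y := by
    obtain rfl : ‹DecidableEq (Fin (p + q))› = instDecidableEqFin (p + q) := Subsingleton.elim _ _
    induction i using Fin.addCases with
    | left i => simp only [upd_left_left, upd_left_right, α.map_update_add, add_mul]
    | right i => simp only [upd_right_right, upd_right_left, β.map_update_add, mul_add]
  map_update_smul' v i c x := by
    obtain rfl : ‹DecidableEq (Fin (p + q))› = instDecidableEqFin (p + q) := Subsingleton.elim _ _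
    induction i using Fin.addCases with
    | left i =>
      simp only [upd_left_left, upd_left_right, α.map_update_smul, smul_eq_mul, mul_assoc]
    | right i =>
      simp only [upd_right_right, upd_right_left, β.map_update_smul, smul_eq_mul, mul_left_comm]
  cont := by
    have h1 := α.coe_continuous
    have h2 := β.coe_continuous
    fun_prop

/-- The multilinear map `v ↦ θ (K (v₁, …, v_k), v_{k+1}, …, v_{k+p})`. -/
def insertAt {k p : ℕ} (K : V [⋀^Fin k]→L[ℝ] V) (θ : V [⋀^Fin (p + 1)]→L[ℝ] ℝ) :
    ContinuousMultilinearMap ℝ (fun _ : Fin (k + p) => V) ℝ where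
  toFun v := θ (Fin.cons (K fun i => v (Fin.castAdd p i)) fun j => v (Fin.natAdd k j))
  map_update_add' v i x y := by
    obtain rfl : ‹DecidableEq (Fin (k + p))› = instDecidableEqFin (k + p) := Subsingleton.elim _ _
    induction i using Fin.addCases with
    | left i =>
      simp only [upd_left_left, upd_left_right, K.map_update_add]
      exact θ.cons_add _ _ _
    | right i =>
      simp only [upd_right_right, upd_right_left, Fin.cons_update, θ.map_update_add]
  map_update_smul' v i c x := by
    obtain rfl : ‹DecidableEq (Fin (k + p))› = instDecidableEqFin (k + p) := Subsingleton.elim _ _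
    induction i using Fin.addCases with
    | left i =>
      simp only [upd_left_left, upd_left_right, K.map_update_smul]
      exact θ.cons_smul _ _ _
    | right i =>
      simp only [upd_right_right, upd_right_left, Fin.cons_update, θ.map_update_smul]
  cont := by
    have h1 := K.coe_continuous
    have h2 := θ.coe_continuous
    exact h2.comp (Continuous.finCons (h1.comp (by fun_prop)) (by fun_prop))

/-- The wedge product
`(α ∧ β)(v₁, …, v_{p+q}) = 1/(p! q!) ∑_σ sgn σ α(v_{σ 1}, …, v_{σ p}) β(v_{σ (p+1)}, …)`. -/
def wedgeAt {p q : ℕ} (α : V [⋀^Fin p]→L[ℝ] ℝ) (β : V [⋀^Fin q]→L[ℝ] ℝ) :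
    V [⋀^Fin (p + q)]→L[ℝ] ℝ :=
  ((p.factorial * q.factorial : ℕ) : ℝ)⁻¹ • (tensorAt α β).alternatization

/-- The insertion `i_K θ`, for `θ` of degree `p + 1`:
`(i_K θ)(v₁, …, v_{k+p}) = 1/(k! p!) ∑_σ sgn σ θ(K(v_{σ 1}, …, v_{σ k}), v_{σ (k+1)}, …)`. -/
def insAt {k p : ℕ} (K : V [⋀^Fin k]→L[ℝ] V) (θ : V [⋀^Fin (p + 1)]→L[ℝ] ℝ) :
    V [⋀^Fin (k + p)]→L[ℝ] ℝ :=
  ((k.factorial * p.factorial : ℕ) : ℝ)⁻¹ • (insertAt K θ).alternatization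

theorem wedgeAt_apply {p q : ℕ} (α : V [⋀^Fin p]→L[ℝ] ℝ) (β : V [⋀^Fin q]→L[ℝ] ℝ)
    (v : Fin (p + q) → V) :
    wedgeAt α β v = ((p.factorial * q.factorial : ℕ) : ℝ)⁻¹ *
      ∑ σ : Equiv.Perm (Fin (p + q)), ((Equiv.Perm.sign σ : ℤ) : ℝ) *
        (α (fun i => v (σ (Fin.castAdd q i))) * β (fun j => v (σ (Fin.natAdd p j)))) := by
  simp only [wedgeAt, ContinuousAlternatingMap.smul_apply,
    ContinuousMultilinearMap.alternatization_apply_apply, smul_eq_mul]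
  congr 1
  refine Finset.sum_congr rfl fun σ _ => ?_
  rw [Units.smul_def, zsmul_eq_mul]
  rfl

theorem insAt_apply {k p : ℕ} (K : V [⋀^Fin k]→L[ℝ] V) (θ : V [⋀^Fin (p + 1)]→L[ℝ] ℝ)
    (v : Fin (k + p) → V) :
    insAt K θ v = ((k.factorial * p.factorial : ℕ) : ℝ)⁻¹ *
      ∑ σ : Equiv.Perm (Fin (k + p)), ((Equiv.Perm.sign σ : ℤ) : ℝ) *
        θ (Fin.cons (K fun i => v (σ (Fin.castAdd p i))) fun j => v (σ (Fin.natAdd k j))) := by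
  simp only [insAt, ContinuousAlternatingMap.smul_apply,
    ContinuousMultilinearMap.alternatization_apply_apply, smul_eq_mul]
  congr 1
  refine Finset.sum_congr rfl fun σ _ => ?_
  rw [Units.smul_def, zsmul_eq_mul]
  rfl

end Algebra

/-! ### Smooth families of alternating maps -/

section Smooth

variable {X V W F : Type*} [NormedAddCommGroup X] [NormedSpace ℝ X]
  [NormedAddCommGroup V] [NormedSpace ℝ V] [FiniteDimensional ℝ V]
  [NormedAddCommGroup W] [NormedSpace ℝ W] [FiniteDimensional ℝ W]
  [NormedAddCommGroup F] [NormedSpace ℝ F] [FiniteDimensional ℝ F]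

theorem contDiffAt_alt_of_apply {q : ℕ} {f : X → V [⋀^Fin q]→L[ℝ] F} {x : X}
    (h : ∀ v : Fin q → V, ContDiffAt ℝ ∞ (fun y => f y v) x) : ContDiffAt ℝ ∞ f x := by
  let b := Module.finBasis ℝ V
  let ev : (V [⋀^Fin q]→L[ℝ] F) →ₗ[ℝ]
      ((Fin q → Fin (Module.finrank ℝ V)) → F) :=
    { toFun := fun θ r => θ (fun i => b (r i))
      map_add' := fun _ _ => rfl
      map_smul' := fun _ _ => rfl }
  have hinj : Function.Injective ev := by
    intro θ η hh
    apply ContinuousAlternatingMap.toAlternatingMap_injective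
    apply AlternatingMap.coe_multilinearMap_injective
    exact Module.Basis.ext_multilinear (fun _ => b) fun r => congrFun hh r
  haveI : FiniteDimensional ℝ (V [⋀^Fin q]→L[ℝ] F) := FiniteDimensional.of_injective ev hinj
  obtain ⟨g, hg⟩ := LinearMap.exists_leftInverse_of_injective ev (LinearMap.ker_eq_bot.2 hinj)
  have h1 : ContDiffAt ℝ ∞ (fun y => ev (f y)) x := contDiffAt_pi.2 fun r => h _
  have h2 : f = fun y => g.toContinuousLinearMap (ev (f y)) := by
    funext y
    exact (LinearMap.congr_fun hg (f y)).symm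
  rw [h2]
  exact g.toContinuousLinearMap.contDiff.contDiffAt.comp x h1

theorem contDiffAt_alt_apply {q : ℕ} {f : X → V [⋀^Fin q]→L[ℝ] F} {v : X → Fin q → V} {x : X}
    (hf : ContDiffAt ℝ ∞ f x) (hv : ∀ i, ContDiffAt ℝ ∞ (fun y => v y i) x) :
    ContDiffAt ℝ ∞ (fun y => f y (v y)) x := by
  let b := Module.finBasis ℝ V
  have h1 : (fun y => f y (v y)) = fun y => ∑ r : Fin q → Fin (Module.finrank ℝ V),
      (∏ i, b.equivFunL (v y i) (r i)) • f y (fun i => b (r i)) := by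
    funext y
    have : v y = fun i => ∑ j, b.equivFunL (v y i) j • b j := by
      funext i
      exact (b.sum_equivFun (v y i)).symm
    conv_lhs => rw [this]
    rw [ContinuousAlternatingMap.map_sum]
    refine Finset.sum_congr rfl fun r _ => ?_
    exact (f y).map_smul_univ (fun i => b.equivFunL (v y i) (r i)) (fun i => b (r i))
  rw [h1]
  refine ContDiffAt.sum fun r _ => ContDiffAt.smul (contDiffAt_prod fun i _ => ?_) ?_
  · exact contDiffAt_pi.1 (b.equivFunL.contDiff.contDiffAt.comp x (hv i)) (r i)
  · exact (ContinuousAlternatingMap.apply ℝ V F (fun i => b (r i))).contDiff.contDiffAt.comp x hf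

theorem contDiffAt_alt_comp {q : ℕ} {f : X → W [⋀^Fin q]→L[ℝ] F} {A : X → V →L[ℝ] W} {x : X}
    (hf : ContDiffAt ℝ ∞ f x) (hA : ContDiffAt ℝ ∞ A x) :
    ContDiffAt ℝ ∞ (fun y => (f y).compContinuousLinearMap (A y)) x :=
  contDiffAt_alt_of_apply fun v =>
    contDiffAt_alt_apply (v := fun y i => A y (v i)) hf fun _ => hA.clm_apply contDiffAt_const

theorem contDiffAt_wedgeAt {p q : ℕ} {α : X → V [⋀^Fin p]→L[ℝ] ℝ} {β : X → V [⋀^Fin q]→L[ℝ] ℝ}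
    {x : X} (hα : ContDiffAt ℝ ∞ α x) (hβ : ContDiffAt ℝ ∞ β x) :
    ContDiffAt ℝ ∞ (fun y => wedgeAt (α y) (β y)) x := by
  refine contDiffAt_alt_of_apply fun v => ?_
  simp only [wedgeAt_apply]
  refine contDiffAt_const.mul (ContDiffAt.sum fun σ _ => contDiffAt_const.mul (ContDiffAt.mul ?_ ?_))
  · exact contDiffAt_alt_apply hα fun _ => contDiffAt_const
  · exact contDiffAt_alt_apply hβ fun _ => contDiffAt_const

theorem contDiffAt_insAt {k p : ℕ} {K : X → V [⋀^Fin k]→L[ℝ] V}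
    {θ : X → V [⋀^Fin (p + 1)]→L[ℝ] ℝ}
    {x : X} (hK : ContDiffAt ℝ ∞ K x) (hθ : ContDiffAt ℝ ∞ θ x) :
    ContDiffAt ℝ ∞ (fun y => insAt (K y) (θ y)) x := by
  refine contDiffAt_alt_of_apply fun v => ?_
  simp only [insAt_apply]
  refine contDiffAt_const.mul (ContDiffAt.sum fun σ _ => contDiffAt_const.mul ?_)
  refine contDiffAt_alt_apply hθ fun i => ?_
  induction i using Fin.cases with
  | zero => exact contDiffAt_alt_apply hK fun _ => contDiffAt_const
  | succ i => exact contDiffAt_const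

end Smooth

/-! ### Manifolds, differential forms and vector-valued forms -/


/-- A smooth (real, finite-dimensional, Hausdorff, boundaryless) manifold. -/
structure Mfd : Type (u + 1) where
  Model : Type u
  [normed : NormedAddCommGroup Model]
  [normedSpace : NormedSpace ℝ Model]
  [finiteDim : FiniteDimensional ℝ Model]
  Pt : Type u
  [top : TopologicalSpace Pt]
  [charted : ChartedSpace Model Pt]
  [smooth : IsManifold 𝓘(ℝ, Model) ∞ Pt]
  [hausdorff : T2Space Pt]

attribute [instance] Mfd.normed Mfd.normedSpace Mfd.finiteDim Mfd.top Mfd.charted Mfd.smooth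
  Mfd.hausdorff

instance : CoeSort Mfd.{u} (Type u) := ⟨Mfd.Pt⟩

/-- The tangent space of `X` at `x`. -/
abbrev Mfd.T (X : Mfd.{u}) (x : X) : Type u := TangentSpace 𝓘(ℝ, X.Model) x

/-- The tangent map of `f` at `x`. -/
abbrev tmap {X Y : Mfd.{u}} (f : X → Y) (x : X) : X.T x →L[ℝ] Y.T (f x) :=
  mfderiv 𝓘(ℝ, X.Model) 𝓘(ℝ, Y.Model) f x

/-- Smooth maps `X → Y`. -/
abbrev SMap (X Y : Mfd.{u}) : Type u :=
  ContMDiffMap 𝓘(ℝ, X.Model) 𝓘(ℝ, Y.Model) X Y ∞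

/-- Smoothness of a map. -/
abbrev IsSmooth {X Y : Mfd.{u}} (f : X → Y) : Prop :=
  ContMDiff 𝓘(ℝ, X.Model) 𝓘(ℝ, Y.Model) ∞ f

/-- The preferred chart of `X` at `x`. -/
abbrev Mfd.chart (X : Mfd.{u}) (x : X) : OpenPartialHomeomorph X X.Model := chartAt X.Model x

/-- The tangent map of the chart at `x`, at the point `z`. -/
abbrev Mfd.dchart (X : Mfd.{u}) (x z : X) : X.T z →L[ℝ] X.Model :=
  mfderiv 𝓘(ℝ, X.Model) 𝓘(ℝ, X.Model) (X.chart x) z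

/-- The tangent map of the inverse of the chart at `x`, at the point `y` of the model space. -/
abbrev Mfd.dchartSymm (X : Mfd.{u}) (x : X) (y : X.Model) :
    X.Model →L[ℝ] X.T ((X.chart x).symm y) :=
  mfderiv 𝓘(ℝ, X.Model) 𝓘(ℝ, X.Model) (X.chart x).symm y

/-- Not necessarily smooth `q`-forms. -/
abbrev RawForm (X : Mfd.{u}) (q : ℕ) : Type u := ∀ x : X, X.T x [⋀^Fin q]→L[ℝ] ℝ

/-- Not necessarily smooth vector-valued `k`-forms. -/
abbrev RawVForm (X : Mfd.{u}) (k : ℕ) : Type u := ∀ x : X, X.T x [⋀^Fin k]→L[ℝ] X.T x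

/-- The expression of a form in the chart at `x`. -/
def localForm {X : Mfd.{u}} {q : ℕ} (θ : RawForm X q) (x : X) (y : X.Model) :
    X.Model [⋀^Fin q]→L[ℝ] ℝ :=
  (θ ((X.chart x).symm y)).compContinuousLinearMap (X.dchartSymm x y)

/-- The expression of a vector-valued form in the chart at `x`. -/
def localVForm {X : Mfd.{u}} {k : ℕ} (K : RawVForm X k) (x : X) (y : X.Model) :
    X.Model [⋀^Fin k]→L[ℝ] X.Model :=
  (X.dchart x ((X.chart x).symm y)).compContinuousAlternatingMap
    ((K ((X.chart x).symm y)).compContinuousLinearMap (X.dchartSymm x y))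

/-- The smooth differential `q`-forms: those which are smooth in all charts. -/
def smoothForms (X : Mfd.{u}) (q : ℕ) : Submodule ℝ (RawForm X q) where
  carrier := {θ | ∀ x, ContDiffOn ℝ ∞ (localForm θ x) (X.chart x).target}
  zero_mem' _ := contDiffOn_const (c := 0)
  add_mem' ha hb x := (ha x).add (hb x)
  smul_mem' c _ ha x := (ha x).const_smul c

/-- The smooth vector-valued `k`-forms. -/
def smoothVForms (X : Mfd.{u}) (k : ℕ) : Submodule ℝ (RawVForm X k) where
  carrier := {K | ∀ x, ContDiffOn ℝ ∞ (localVForm K x) (X.chart x).target}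
  zero_mem' x := by
    refine (contDiffOn_const (c := 0)).congr fun y _ => ?_
    ext v
    exact map_zero (X.dchart x ((X.chart x).symm y))
  add_mem' {a b} ha hb x := by
    refine ((ha x).add (hb x)).congr fun y _ => ?_
    ext v
    exact map_add (X.dchart x ((X.chart x).symm y)) _ _
  smul_mem' c a ha x := by
    refine ((ha x).const_smul c).congr fun y _ => ?_
    ext v
    exact map_smul (X.dchart x ((X.chart x).symm y)) _ _

/-- `Ω^q(X)`. -/
def Form (X : Mfd.{u}) (q : ℕ) : Type u := smoothForms X q

instance (X : Mfd.{u}) (q : ℕ) : AddCommGroup (Form X q) :=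
  inferInstanceAs (AddCommGroup (smoothForms X q))

instance (X : Mfd.{u}) (q : ℕ) : Module ℝ (Form X q) :=
  inferInstanceAs (Module ℝ (smoothForms X q))

/-- `Ω^k(X, TX)`. -/
def VForm (X : Mfd.{u}) (k : ℕ) : Type u := smoothVForms X k

instance (X : Mfd.{u}) (k : ℕ) : AddCommGroup (VForm X k) :=
  inferInstanceAs (AddCommGroup (smoothVForms X k))

instance (X : Mfd.{u}) (k : ℕ) : Module ℝ (VForm X k) :=
  inferInstanceAs (Module ℝ (smoothVForms X k))

theorem mdiff_chart {X : Mfd.{u}} (x : X) {z : X} (hz : z ∈ (X.chart x).source) :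
    MDifferentiableAt 𝓘(ℝ, X.Model) 𝓘(ℝ, X.Model) (X.chart x) z :=
  mdifferentiableAt_atlas (chart_mem_atlas _ x) hz

theorem mdiff_chart_symm {X : Mfd.{u}} (x : X) {y : X.Model} (hy : y ∈ (X.chart x).target) :
    MDifferentiableAt 𝓘(ℝ, X.Model) 𝓘(ℝ, X.Model) (X.chart x).symm y :=
  mdifferentiableAt_atlas_symm (chart_mem_atlas _ x) hy

theorem dchartSymm_dchart {X : Mfd.{u}} (x : X) {y : X.Model} (hy : y ∈ (X.chart x).target)
    (v : X.T ((X.chart x).symm y)) :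
    X.dchartSymm x y (X.dchart x ((X.chart x).symm y) v) = v := by
  have h := (mdifferentiable_chart (I := 𝓘(ℝ, X.Model)) x).symm_comp_deriv
    ((X.chart x).map_target hy)
  rw [(X.chart x).right_inv hy] at h
  exact DFunLike.congr_fun h v

/-- A map read in charts. -/
def readMap {X Y : Mfd.{u}} (f : X → Y) (x : X) (z : Y) : X.Model → Y.Model :=
  fun y => Y.chart z (f ((X.chart x).symm y))

/-- The pullback of a form. -/
def rawPullback {X Y : Mfd.{u}} (f : X → Y) {q : ℕ} (θ : RawForm Y q) : RawForm X q :=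
  fun x => (θ (f x)).compContinuousLinearMap (tmap f x)

theorem contDiffAt_readMap {X Y : Mfd.{u}} {f : X → Y} (hf : IsSmooth f) (x : X) (z : Y)
    {y : X.Model} (hy : y ∈ (X.chart x).target) (hz : f ((X.chart x).symm y) ∈ (Y.chart z).source) :
    ContDiffAt ℝ ∞ (readMap f x z) y := by
  rw [← contMDiffAt_iff_contDiffAt]
  have h1 := (contMDiffOn_chart_symm (I := 𝓘(ℝ, X.Model)) (n := ∞) (x := x)).contMDiffAt
    ((X.chart x).open_target.mem_nhds hy)
  have h2 := (contMDiffOn_chart (I := 𝓘(ℝ, Y.Model)) (n := ∞) (x := z)).contMDiffAt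
    ((Y.chart z).open_source.mem_nhds hz)
  exact ContMDiffAt.comp y h2 (ContMDiffAt.comp y hf.contMDiffAt h1)

theorem fderiv_readMap {X Y : Mfd.{u}} {f : X → Y} (hf : IsSmooth f) (x : X) (z : Y)
    {y : X.Model} (hy : y ∈ (X.chart x).target) (hz : f ((X.chart x).symm y) ∈ (Y.chart z).source)
    (v : X.Model) :
    fderiv ℝ (readMap f x z) y v =
      Y.dchart z (f ((X.chart x).symm y)) (tmap f ((X.chart x).symm y) (X.dchartSymm x y v)) := by
  have h1 : MDifferentiableAt 𝓘(ℝ, X.Model) 𝓘(ℝ, Y.Model) f ((X.chart x).symm y) :=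
    hf.mdifferentiableAt (by simp)
  rw [← mfderiv_eq_fderiv]
  have e : readMap f x z = Y.chart z ∘ (f ∘ (X.chart x).symm) := rfl
  rw [e, mfderiv_comp y (mdiff_chart z hz) (h1.comp y (mdiff_chart_symm x hy)),
    mfderiv_comp y h1 (mdiff_chart_symm x hy)]
  rfl

theorem localForm_pullback {X Y : Mfd.{u}} {f : X → Y} (hf : IsSmooth f) {q : ℕ}
    (θ : RawForm Y q) (x : X) (z : Y)
    {y : X.Model} (hy : y ∈ (X.chart x).target)
    (hz : f ((X.chart x).symm y) ∈ (Y.chart z).source) :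
    localForm (rawPullback f θ) x y =
      (localForm θ z (readMap f x z y)).compContinuousLinearMap (fderiv ℝ (readMap f x z) y) := by
  have key : ∀ (w : Y) (hw : w ∈ (Y.chart z).source) (u : Fin q → Y.T w),
      θ w u = (θ ((Y.chart z).symm (Y.chart z w))) (fun i =>
        Y.dchartSymm z (Y.chart z w) (Y.dchart z w (u i))) := by
    intro w hw
    have hwt := (Y.chart z).map_source hw
    obtain ⟨a, ha, rfl⟩ : ∃ a ∈ (Y.chart z).target, (Y.chart z).symm a = w :=
      ⟨_, hwt, (Y.chart z).left_inv hw⟩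
    rw [(Y.chart z).right_inv ha]
    intro u
    simp only [dchartSymm_dchart z ha]
  ext v
  simp only [localForm, rawPullback, ContinuousAlternatingMap.compContinuousLinearMap_apply]
  refine (key _ hz _).trans ?_
  congr 1
  funext i
  simp only [Function.comp_apply, fderiv_readMap hf x z hy hz]
  rfl

theorem eventually_chart {X Y : Mfd.{u}} {f : X → Y} (hf : Continuous f) (x : X) (z : Y)
    {y : X.Model} (hy : y ∈ (X.chart x).target)
    (hz : f ((X.chart x).symm y) ∈ (Y.chart z).source) :
    ∀ᶠ y' in 𝓝 y, y' ∈ (X.chart x).target ∧ f ((X.chart x).symm y') ∈ (Y.chart z).source := by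
  refine ((X.chart x).open_target.mem_nhds hy |> Filter.Eventually.and <| ?_)
  have : ContinuousAt (fun y' => f ((X.chart x).symm y')) y :=
    hf.continuousAt.comp ((X.chart x).continuousAt_symm hy)
  exact this.eventually ((Y.chart z).open_source.mem_nhds hz)

theorem rawPullback_mem {X Y : Mfd.{u}} {f : X → Y} (hf : IsSmooth f) {q : ℕ}
    {θ : RawForm Y q} (hθ : θ ∈ smoothForms Y q) : rawPullback f θ ∈ smoothForms X q := by
  intro x y hy
  refine ContDiffAt.contDiffWithinAt ?_
  have hz : f ((X.chart x).symm y) ∈ (Y.chart (f ((X.chart x).symm y))).source :=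
    mem_chart_source _ _
  set z := f ((X.chart x).symm y)
  have h1 : localForm (rawPullback f θ) x =ᶠ[𝓝 y] fun y' =>
      (localForm θ z (readMap f x z y')).compContinuousLinearMap
        (fderiv ℝ (readMap f x z) y') := by
    filter_upwards [eventually_chart hf.continuous x z hy hz] with y' h
    exact localForm_pullback hf θ x z h.1 h.2
  refine ContDiffAt.congr_of_eventuallyEq ?_ h1
  have hr := contDiffAt_readMap hf x z hy hz
  refine contDiffAt_alt_comp ?_ (hr.fderiv_right (m := ∞) (by simp))
  exact ((hθ z).contDiffAt ((Y.chart z).open_target.mem_nhds ((Y.chart z).map_source hz))).comp y hr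

/-- The pullback `f^* : Ω^q(Y) → Ω^q(X)`. -/
def pullback {X Y : Mfd.{u}} (f : SMap X Y) (q : ℕ) : Form Y q →ₗ[ℝ] Form X q where
  toFun θ := ⟨rawPullback f θ.1, rawPullback_mem f.contMDiff θ.2⟩
  map_add' _ _ := rfl
  map_smul' _ _ := rfl

/-- The exterior derivative, computed at `x` in the chart at `x`. -/
def rawD {X : Mfd.{u}} {q : ℕ} (θ : RawForm X q) : RawForm X (q + 1) := fun x =>
  (extDeriv (localForm θ x) (X.chart x x)).compContinuousLinearMap (X.dchart x x)

theorem localForm_rawD {X : Mfd.{u}} {q : ℕ} {θ : RawForm X q} (hθ : θ ∈ smoothForms X q) (x : X)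
    {y : X.Model} (hy : y ∈ (X.chart x).target) :
    localForm (rawD θ) x y = extDeriv (localForm θ x) y := by
  have hid : IsSmooth (id : X → X) := contMDiff_id
  have hz : id ((X.chart x).symm y) ∈ (X.chart ((X.chart x).symm y)).source :=
    mem_chart_source _ _
  set z := (X.chart x).symm y with hzdef
  have h1 : localForm θ x =ᶠ[𝓝 y] fun y' =>
      (localForm θ z (readMap id x z y')).compContinuousLinearMap
        (fderiv ℝ (readMap id x z) y') := by
    filter_upwards [eventually_chart hid.continuous x z hy hz] with y' h
    have h2 : rawPullback (id : X → X) θ = θ := by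
      funext w
      ext v
      simp only [rawPullback, ContinuousAlternatingMap.compContinuousLinearMap_apply]
      congr 1
      funext i
      simp [tmap, mfderiv_id]
    have h3 := localForm_pullback hid θ x z h.1 h.2
    rwa [h2] at h3
  rw [h1.extDeriv_eq, extDeriv_pullback (r := ∞) _ (contDiffAt_readMap hid x z hy hz)
    (by rw [minSmoothness_of_isRCLikeNormedField]; exact WithTop.coe_le_coe.2 (le_top : (2 : ℕ∞) ≤ ⊤))]
  · ext v
    simp only [localForm, rawD, ContinuousAlternatingMap.compContinuousLinearMap_apply]
    have e : readMap id x z y = X.chart z z := rfl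
    rw [e]
    congr 1
    funext i
    have h4 := fderiv_readMap hid x z hy hz (v i)
    simp only [tmap, mfderiv_id] at h4
    exact h4.symm
  · exact (((hθ z).contDiffAt ((X.chart z).open_target.mem_nhds
      ((X.chart z).map_source hz))).differentiableAt (by simp))

theorem rawD_mem {X : Mfd.{u}} {q : ℕ} {θ : RawForm X q} (hθ : θ ∈ smoothForms X q) :
    rawD θ ∈ smoothForms X (q + 1) := by
  intro x
  refine ContDiffOn.congr ?_ fun y hy => localForm_rawD hθ x hy
  have h1 := (hθ x).fderiv_of_isOpen (m := ∞) (X.chart x).open_target (by simp)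
  exact (ContinuousAlternatingMap.alternatizeUncurryFinCLM ℝ X.Model ℝ).contDiff.comp_contDiffOn h1

/-- The exterior derivative `d : Ω^q(X) → Ω^{q+1}(X)`. -/
def extD (X : Mfd.{u}) (q : ℕ) : Form X q →ₗ[ℝ] Form X (q + 1) where
  toFun θ := ⟨rawD θ.1, rawD_mem θ.2⟩
  map_add' θ η := by
    have h : ∀ (ζ : Form X q) (x : X), DifferentiableAt ℝ (localForm ζ.1 x) (X.chart x x) :=
      fun ζ x => ((ζ.2 x).contDiffAt ((X.chart x).open_target.mem_nhds
        (mem_chart_target _ x))).differentiableAt (by simp)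
    apply Subtype.ext
    funext x
    ext v
    have e := extDeriv_add (h θ x) (h η x)
    exact DFunLike.congr_fun e fun i => X.dchart x x (v i)
  map_smul' c θ := by
    apply Subtype.ext
    funext x
    ext v
    have e := extDeriv_smul (x := X.chart x x) c (localForm θ.1 x)
    exact DFunLike.congr_fun e fun i => X.dchart x x (v i)

theorem wedge_mem {X : Mfd.{u}} {p q : ℕ} (α : Form X p) (β : Form X q) :
    (fun x => wedgeAt (α.1 x) (β.1 x) : RawForm X (p + q)) ∈ smoothForms X (p + q) := by
  intro x y hy
  have hn := (X.chart x).open_target.mem_nhds hy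
  refine ContDiffAt.contDiffWithinAt ?_
  refine (contDiffAt_wedgeAt ((α.2 x).contDiffAt hn) ((β.2 x).contDiffAt hn)).congr_of_eventuallyEq
    (Filter.Eventually.of_forall fun y' => ?_)
  ext v
  simp only [localForm, ContinuousAlternatingMap.compContinuousLinearMap_apply, wedgeAt_apply]
  rfl

/-- The wedge product `Ω^p(X) × Ω^q(X) → Ω^{p+q}(X)`. -/
def wedge (X : Mfd.{u}) (p q : ℕ) : Form X p →ₗ[ℝ] Form X q →ₗ[ℝ] Form X (p + q) :=
  LinearMap.mk₂ ℝ (fun α β => ⟨fun x => wedgeAt (α.1 x) (β.1 x), wedge_mem α β⟩)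
    (fun α α' β => by
      apply Subtype.ext; funext x; ext v
      change wedgeAt (α.1 x + α'.1 x) (β.1 x) v = wedgeAt (α.1 x) (β.1 x) v + wedgeAt (α'.1 x) (β.1 x) v
      simp only [wedgeAt_apply, ContinuousAlternatingMap.add_apply, add_mul, mul_add,
        Finset.sum_add_distrib])
    (fun c α β => by
      apply Subtype.ext; funext x; ext v
      change wedgeAt (c • α.1 x) (β.1 x) v = c • wedgeAt (α.1 x) (β.1 x) v
      simp only [wedgeAt_apply, ContinuousAlternatingMap.smul_apply, smul_eq_mul, Finset.mul_sum]
      exact Finset.sum_congr rfl fun _ _ => by ring)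
    (fun α β β' => by
      apply Subtype.ext; funext x; ext v
      change wedgeAt (α.1 x) (β.1 x + β'.1 x) v = wedgeAt (α.1 x) (β.1 x) v + wedgeAt (α.1 x) (β'.1 x) v
      simp only [wedgeAt_apply, ContinuousAlternatingMap.add_apply, mul_add,
        Finset.sum_add_distrib])
    (fun c α β => by
      apply Subtype.ext; funext x; ext v
      change wedgeAt (α.1 x) (c • β.1 x) v = c • wedgeAt (α.1 x) (β.1 x) v
      simp only [wedgeAt_apply, ContinuousAlternatingMap.smul_apply, smul_eq_mul, Finset.mul_sum]
      exact Finset.sum_congr rfl fun _ _ => by ring)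

theorem ins_mem {X : Mfd.{u}} {k p : ℕ} (K : VForm X k) (θ : Form X (p + 1)) :
    (fun x => insAt (K.1 x) (θ.1 x) : RawForm X (k + p)) ∈ smoothForms X (k + p) := by
  intro x y hy
  have hn := (X.chart x).open_target.mem_nhds hy
  refine ContDiffAt.contDiffWithinAt ?_
  refine (contDiffAt_insAt ((K.2 x).contDiffAt hn) ((θ.2 x).contDiffAt hn)).congr_of_eventuallyEq ?_
  filter_upwards [hn] with y' hy'
  ext v
  simp only [localForm, localVForm, ContinuousAlternatingMap.compContinuousLinearMap_apply,
    insAt_apply]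
  congr 1
  refine Finset.sum_congr rfl fun σ _ => ?_
  congr 2
  funext i
  induction i using Fin.cases with
  | zero => exact (dchartSymm_dchart x hy' _).symm
  | succ i => rfl

/-- The insertion operator `i_K : Ω^{p+1}(X) → Ω^{k+p}(X)`. -/
def ins {X : Mfd.{u}} {k : ℕ} (K : VForm X k) (p : ℕ) : Form X (p + 1) →ₗ[ℝ] Form X (k + p) where
  toFun θ := ⟨fun x => insAt (K.1 x) (θ.1 x), ins_mem K θ⟩
  map_add' θ η := by
    apply Subtype.ext; funext x; ext v
    change insAt (K.1 x) (θ.1 x + η.1 x) v = insAt (K.1 x) (θ.1 x) v + insAt (K.1 x) (η.1 x) v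
    simp only [insAt_apply, ContinuousAlternatingMap.add_apply, mul_add, Finset.sum_add_distrib]
  map_smul' c θ := by
    apply Subtype.ext; funext x; ext v
    change insAt (K.1 x) (c • θ.1 x) v = c • insAt (K.1 x) (θ.1 x) v
    simp only [insAt_apply, ContinuousAlternatingMap.smul_apply, smul_eq_mul, Finset.mul_sum]
    exact Finset.sum_congr rfl fun _ _ => by ring

/-! ### The graded algebra of forms and its derivations -/

/-- The sign `(-1)^n`. -/
def sgn (n : ℤ) : ℝ := ((n.negOnePow : ℤ) : ℝ)

/-- `Ω^•(X) = ⨁_q Ω^q(X)`. -/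
def Forms (X : Mfd.{u}) : Type u := ⨁ q : ℕ, Form X q

instance (X : Mfd.{u}) : AddCommGroup (Forms X) :=
  inferInstanceAs (AddCommGroup (⨁ q : ℕ, Form X q))

instance (X : Mfd.{u}) : Module ℝ (Forms X) := inferInstanceAs (Module ℝ (⨁ q : ℕ, Form X q))

/-- The inclusion `Ω^q(X) → Ω^•(X)`. -/
def homog {X : Mfd.{u}} (q : ℕ) : Form X q →ₗ[ℝ] Forms X :=
  DirectSum.lof ℝ ℕ (fun q => Form X q) q

/-- The component of degree `q` of an element of `Ω^•(X)`. -/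
def comp {X : Mfd.{u}} (q : ℕ) : Forms X →ₗ[ℝ] Form X q :=
  DirectSum.component ℝ ℕ (fun q => Form X q) q

/-- The linear map on `Ω^•(X)` with given restrictions to the `Ω^q(X)`. -/
def fromForms {X : Mfd.{u}} {C : Type*} [AddCommGroup C] [Module ℝ C]
    (f : ∀ q, Form X q →ₗ[ℝ] C) : Forms X →ₗ[ℝ] C :=
  DirectSum.toModule ℝ ℕ C f

/-- The exterior derivative on `Ω^•(X)`. -/
def dR (X : Mfd.{u}) : Forms X →ₗ[ℝ] Forms X :=
  fromForms fun q => homog (q + 1) ∘ₗ extD X q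

/-- The wedge product on `Ω^•(X)`. -/
def wedgeProd (X : Mfd.{u}) : Forms X →ₗ[ℝ] Forms X →ₗ[ℝ] Forms X :=
  fromForms fun p =>
    (fromForms (C := Form X p →ₗ[ℝ] Forms X) fun q =>
      (wedge X p q).flip.compr₂ (homog (p + q))).flip

/-- The pullback on `Ω^•`. -/
def pull {X Y : Mfd.{u}} (f : SMap X Y) : Forms Y →ₗ[ℝ] Forms X :=
  fromForms fun q => homog q ∘ₗ pullback f q

/-- The operator acting on `Ω^q(X)` as `(-1)^q`. -/
def degSign (X : Mfd.{u}) : Forms X →ₗ[ℝ] Forms X :=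
  fromForms fun q => sgn q • homog q

/-- The insertion operator `i_K` on `Ω^•(X)`; it vanishes on functions. -/
def insertion {X : Mfd.{u}} {k : ℕ} (K : VForm X k) : Forms X →ₗ[ℝ] Forms X :=
  fromForms fun
    | 0 => 0
    | p + 1 => homog (k + p) ∘ₗ ins K p

/-- The graded commutator `[A, B] = A B - (-1)^{ab} B A` of operators of degrees `a` and `b`. -/
def gradedComm {C : Type*} [AddCommGroup C] [Module ℝ C] (a b : ℤ) (A B : C →ₗ[ℝ] C) :
    C →ₗ[ℝ] C :=
  A ∘ₗ B - sgn (a * b) • (B ∘ₗ A)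

theorem gradedComm_zero_left {C : Type*} [AddCommGroup C] [Module ℝ C] (a b : ℤ)
    (B : C →ₗ[ℝ] C) : gradedComm a b 0 B = 0 := by
  simp [gradedComm]

theorem gradedComm_add_left {C : Type*} [AddCommGroup C] [Module ℝ C] (a b : ℤ)
    (A A' B : C →ₗ[ℝ] C) :
    gradedComm a b (A + A') B = gradedComm a b A B + gradedComm a b A' B := by
  simp only [gradedComm, LinearMap.add_comp, LinearMap.comp_add, smul_add]
  abel

theorem gradedComm_smul_left {C : Type*} [AddCommGroup C] [Module ℝ C] (a b : ℤ) (c : ℝ)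
    (A B : C →ₗ[ℝ] C) : gradedComm a b (c • A) B = c • gradedComm a b A B := by
  simp only [gradedComm, LinearMap.smul_comp, LinearMap.comp_smul, smul_sub, smul_comm c]

/-- The Lie derivative `L_K = [d, i_K] = d i_K - (-1)^{k-1} i_K d`. -/
def lieD {X : Mfd.{u}} {k : ℕ} (K : VForm X k) : Forms X →ₗ[ℝ] Forms X :=
  gradedComm 1 ((k : ℤ) - 1) (dR X) (insertion K)

/-- `D` is a derivation of degree `l` of `Ω^•(X)`. -/
structure IsDerivation {X : Mfd.{u}} (l : ℤ) (D : Forms X →ₗ[ℝ] Forms X) : Prop where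
  degree : ∀ (q : ℕ) (α : Form X q) (r : ℕ), (r : ℤ) ≠ q + l → comp r (D (homog q α)) = 0
  leibniz : ∀ (q : ℕ) (α : Form X q) (β : Forms X),
    D (wedgeProd X (homog q α) β) =
      wedgeProd X (D (homog q α)) β + sgn (q * l) • wedgeProd X (homog q α) (D β)

/-- `B` is the Frölicher-Nijenhuis bracket of `K` and `L`: `L_B = [L_K, L_L]`. -/
def IsFNBracket {X : Mfd.{u}} {k l : ℕ} (K : VForm X k) (L : VForm X l) (B : VForm X (k + l)) :
    Prop :=
  lieD B = gradedComm k l (lieD K) (lieD L)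

/-- `K` is `f`-related to `L`. -/
def Related {X Y : Mfd.{u}} (f : X → Y) {k : ℕ} (K : VForm X k) (L : VForm Y k) : Prop :=
  ∀ (x : X) (v : Fin k → X.T x), L.1 (f x) (fun i => tmap f x (v i)) = tmap f x (K.1 x v)

/-! ### Fibre products along a submersion -/

/-- `t : G → M` is a submersion. -/
abbrev IsSubm {G M : Mfd.{u}} (t : G → M) : Prop :=
  Manifold.IsSubmersion 𝓘(ℝ, G.Model) 𝓘(ℝ, M.Model) ∞ t

/-- The model of the fibres of a submersion `G → M`. -/
abbrev Fib (G M : Mfd.{u}) : Type :=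
  EuclideanSpace ℝ (Fin (Module.finrank ℝ G.Model - Module.finrank ℝ M.Model))

/-- Charts of `G` and `M` in which `t` is a linear projection. -/
structure SubChart {G M : Mfd.{u}} (t : G → M) where
  dom : OpenPartialHomeomorph G G.Model
  cod : OpenPartialHomeomorph M M.Model
  lin : G.Model ≃L[ℝ] M.Model × Fib G M
  dom_mem : dom ∈ IsManifold.maximalAtlas 𝓘(ℝ, G.Model) ∞ G
  cod_mem : cod ∈ IsManifold.maximalAtlas 𝓘(ℝ, M.Model) ∞ M
  maps : ∀ g ∈ dom.source, t g ∈ cod.source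
  spec : ∀ g ∈ dom.source, cod (t g) = (lin (dom g)).1

theorem IsSubm.exists_subChart {G M : Mfd.{u}} {t : G → M} (ht : IsSubm t) (g : G) :
    ∃ c : SubChart t, g ∈ c.dom.source := by
  obtain ⟨F, hF, hF', h⟩ := ht
  have hg := h g
  have hfd : FiniteDimensional ℝ (M.Model × F) :=
    Module.Finite.equiv hg.equiv.toLinearEquiv
  have hfdF : FiniteDimensional ℝ F :=
    FiniteDimensional.of_injective (LinearMap.inr ℝ M.Model F) LinearMap.inr_injective
  have hrk : Module.finrank ℝ F = Module.finrank ℝ (Fib G M) := by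
    have := hg.equiv.toLinearEquiv.finrank_eq
    rw [Module.finrank_prod] at this
    rw [finrank_euclideanSpace_fin]
    omega
  have hg' := hg.trans_F (ContinuousLinearEquiv.ofFinrankEq hrk)
  refine ⟨⟨hg'.domChart, hg'.codChart, hg'.equiv, hg'.domChart_mem_maximalAtlas,
    hg'.codChart_mem_maximalAtlas, fun x hx => hg'.source_subset_preimage_source hx, ?_⟩,
    hg'.mem_domChart_source⟩
  intro x hx
  have hx' : hg'.domChart x ∈ (hg'.domChart.extend 𝓘(ℝ, G.Model)).target := by
    simpa using hg'.domChart.map_source hx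
  have h1 := hg'.writtenInCharts hx'
  simpa [hg'.domChart.left_inv hx] using h1

/-- A topological space `S` presented as the fibre product of `f : P → M` and `t : G → M`. -/
structure FibPres {P G M : Mfd.{u}} (f : P → M) (t : G → M) (S : Type u) [TopologicalSpace S] where
  fst : S → P
  snd : S → G
  pair : ∀ x g, f x = t g → S
  comm : ∀ z, f (fst z) = t (snd z)
  fst_pair : ∀ x g h, fst (pair x g h) = x
  snd_pair : ∀ x g h, snd (pair x g h) = g
  pair_eta : ∀ z, pair (fst z) (snd z) (comm z) = z
  inducing : Topology.IsInducing fun z => (fst z, snd z)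

section FibreProduct

variable {P G M : Mfd.{u}} {f : P → M} {t : G → M} {S : Type u} [TopologicalSpace S]

theorem FibPres.cont_fst (Q : FibPres f t S) : Continuous Q.fst :=
  continuous_fst.comp Q.inducing.continuous

theorem FibPres.cont_snd (Q : FibPres f t S) : Continuous Q.snd :=
  continuous_snd.comp Q.inducing.continuous

/-- The arrow component of the inverse of `FibPres.chart`. -/
def fibInv (f : P → M) (φ : OpenPartialHomeomorph P P.Model) (c : SubChart t)
    (w : P.Model × Fib G M) : G.Model :=
  c.lin.symm (c.cod (f (φ.symm w.1)), w.2)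

/-- The domain of the inverse of `FibPres.chart`. -/
def fibTarget (f : P → M) (φ : OpenPartialHomeomorph P P.Model) (c : SubChart t) :
    Set (P.Model × Fib G M) :=
  {w | (w.1 ∈ φ.target ∧ f (φ.symm w.1) ∈ c.cod.source) ∧ fibInv f φ c w ∈ c.dom.target}

theorem fibTarget_comm {φ : OpenPartialHomeomorph P P.Model} {c : SubChart t}
    {w : P.Model × Fib G M} (hw : w ∈ fibTarget f φ c) :
    f (φ.symm w.1) = t (c.dom.symm (fibInv f φ c w)) := by
  have h1 := c.dom.map_target hw.2
  refine c.cod.injOn hw.1.2 (c.maps _ h1) ?_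
  rw [c.spec _ h1, c.dom.right_inv hw.2]
  simp [fibInv]

open Classical in
/-- The chart `(x, g) ↦ (φ x, pr₂ (ψ g))` of the fibre product, where `t` reads as the first
projection in the chart `ψ`. -/
def FibPres.chart (Q : FibPres f t S) (hf : Continuous f)
    (φ : OpenPartialHomeomorph P P.Model) (c : SubChart t) (z₀ : S) :
    OpenPartialHomeomorph S (P.Model × Fib G M) where
  toFun z := (φ (Q.fst z), (c.lin (c.dom (Q.snd z))).2)
  invFun w := if h : f (φ.symm w.1) = t (c.dom.symm (fibInv f φ c w)) then Q.pair _ _ h else z₀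
  source := Q.fst ⁻¹' φ.source ∩ Q.snd ⁻¹' c.dom.source
  target := fibTarget f φ c
  map_source' := by
    rintro z ⟨h1, h2⟩
    have e1 : f (φ.symm (φ (Q.fst z))) = t (Q.snd z) := by rw [φ.left_inv h1, Q.comm]
    have e2 : fibInv f φ c (φ (Q.fst z), (c.lin (c.dom (Q.snd z))).2) = c.dom (Q.snd z) := by
      simp only [fibInv, e1, c.spec _ h2, Prod.mk.eta, ContinuousLinearEquiv.symm_apply_apply]
    refine ⟨⟨φ.map_source h1, ?_⟩, ?_⟩
    · rw [e1]; exact c.maps _ h2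
    · rw [e2]; exact c.dom.map_source h2
  map_target' := by
    intro w hw
    rw [dif_pos (fibTarget_comm hw)]
    constructor
    · rw [Set.mem_preimage, Q.fst_pair]; exact φ.map_target hw.1.1
    · rw [Set.mem_preimage, Q.snd_pair]; exact c.dom.map_target hw.2
  left_inv' := by
    rintro z ⟨h1, h2⟩
    have e1 : f (φ.symm (φ (Q.fst z))) = t (Q.snd z) := by rw [φ.left_inv h1, Q.comm]
    have e2 : c.dom.symm (fibInv f φ c (φ (Q.fst z), (c.lin (c.dom (Q.snd z))).2)) = Q.snd z := by
      simp only [fibInv, e1, c.spec _ h2, Prod.mk.eta, ContinuousLinearEquiv.symm_apply_apply,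
        c.dom.left_inv h2]
    have e3 : φ.symm (φ (Q.fst z)) = Q.fst z := φ.left_inv h1
    simp only [e2, e3]
    rw [dif_pos (Q.comm z), Q.pair_eta]
  right_inv' := by
    intro w hw
    rw [dif_pos (fibTarget_comm hw), Q.fst_pair, Q.snd_pair, c.dom.right_inv hw.2,
      φ.right_inv hw.1.1]
    simp [fibInv]
  open_source := (φ.open_source.preimage Q.cont_fst).inter (c.dom.open_source.preimage Q.cont_snd)
  open_target := by
    have c1 : ContinuousOn (fun w : P.Model × Fib G M => f (φ.symm w.1)) {w | w.1 ∈ φ.target} :=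
      hf.comp_continuousOn (φ.continuousOn_symm.comp continuousOn_fst fun _ h => h)
    have o1 : IsOpen {w : P.Model × Fib G M | w.1 ∈ φ.target ∧ f (φ.symm w.1) ∈ c.cod.source} :=
      c1.isOpen_inter_preimage (φ.open_target.preimage continuous_fst) c.cod.open_source
    have c2 : ContinuousOn (fibInv f φ c)
        {w | w.1 ∈ φ.target ∧ f (φ.symm w.1) ∈ c.cod.source} :=
      c.lin.symm.continuous.comp_continuousOn
        ((c.cod.continuousOn.comp (c1.mono fun _ h => h.1) fun _ h => h.2).prodMk continuousOn_snd)
    exact c2.isOpen_inter_preimage o1 c.dom.open_target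
  continuousOn_toFun := by
    refine ContinuousOn.prodMk ?_ ?_
    · exact φ.continuousOn.comp Q.cont_fst.continuousOn fun _ h => h.1
    · exact (continuous_snd.comp c.lin.continuous).comp_continuousOn
        (c.dom.continuousOn.comp Q.cont_snd.continuousOn fun _ h => h.2)
  continuousOn_invFun := by
    rw [Q.inducing.continuousOn_iff]
    have c1 : ContinuousOn (fun w : P.Model × Fib G M => f (φ.symm w.1)) {w | w.1 ∈ φ.target} :=
      hf.comp_continuousOn (φ.continuousOn_symm.comp continuousOn_fst fun _ h => h)
    have c2 : ContinuousOn (fibInv f φ c)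
        {w | w.1 ∈ φ.target ∧ f (φ.symm w.1) ∈ c.cod.source} :=
      c.lin.symm.continuous.comp_continuousOn
        ((c.cod.continuousOn.comp (c1.mono fun _ h => h.1) fun _ h => h.2).prodMk continuousOn_snd)
    have c3 : ContinuousOn (fun w => (φ.symm w.1, c.dom.symm (fibInv f φ c w)))
        (fibTarget f φ c) :=
      (φ.continuousOn_symm.comp continuousOn_fst fun _ h => h.1.1).prodMk
        (c.dom.continuousOn_symm.comp (c2.mono fun _ h => h.1) fun _ h => h.2)
    refine c3.congr fun w hw => ?_
    simp only [Function.comp_apply]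
    rw [dif_pos (fibTarget_comm hw), Q.fst_pair, Q.snd_pair]

theorem FibPres.chart_symm_fst (Q : FibPres f t S) (hf : Continuous f)
    (φ : OpenPartialHomeomorph P P.Model) (c : SubChart t) (z₀ : S)
    {w : P.Model × Fib G M} (hw : w ∈ fibTarget f φ c) :
    Q.fst ((Q.chart hf φ c z₀).symm w) = φ.symm w.1 := by
  exact (congrArg Q.fst (dif_pos (fibTarget_comm hw))).trans (Q.fst_pair _ _ _)

theorem FibPres.chart_symm_snd (Q : FibPres f t S) (hf : Continuous f)
    (φ : OpenPartialHomeomorph P P.Model) (c : SubChart t) (z₀ : S)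
    {w : P.Model × Fib G M} (hw : w ∈ fibTarget f φ c) :
    Q.snd ((Q.chart hf φ c z₀).symm w) = c.dom.symm (fibInv f φ c w) := by
  exact (congrArg Q.snd (dif_pos (fibTarget_comm hw))).trans (Q.snd_pair _ _ _)

/-- The atlas of the fibre product. -/
@[reducible] def FibPres.charted (Q : FibPres f t S) (hf : Continuous f) (ht : IsSubm t) :
    ChartedSpace (P.Model × Fib G M) S where
  atlas := {e | ∃ (c : SubChart t) (x : P) (z₀ : S), e = Q.chart hf (P.chart x) c z₀}
  chartAt z := Q.chart hf (P.chart (Q.fst z)) (ht.exists_subChart (Q.snd z)).choose z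
  mem_chart_source z :=
    ⟨mem_chart_source _ (Q.fst z), (ht.exists_subChart (Q.snd z)).choose_spec⟩
  chart_mem_atlas _ := ⟨_, _, _, rfl⟩

/-- Smoothness of the first component of the inverse chart. -/
theorem fib_smooth_fst (x : P) :
    ContMDiffOn 𝓘(ℝ, P.Model × Fib G M) 𝓘(ℝ, P.Model) ∞
      (fun w : P.Model × Fib G M => (P.chart x).symm w.1) {w | w.1 ∈ (P.chart x).target} :=
  (contMDiffOn_chart_symm (I := 𝓘(ℝ, P.Model)) (n := ∞) (x := x)).comp
    (contDiff_fst.contMDiff.contMDiffOn) fun _ h => h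

/-- Smoothness of the second component of the inverse chart. -/
theorem fib_smooth_snd (hf : IsSmooth f) (x : P) (c : SubChart t) :
    ContMDiffOn 𝓘(ℝ, P.Model × Fib G M) 𝓘(ℝ, G.Model) ∞
      (fun w : P.Model × Fib G M => c.dom.symm (fibInv f (P.chart x) c w))
      (fibTarget f (P.chart x) c) := by
  have h1 : ContMDiffOn 𝓘(ℝ, P.Model × Fib G M) 𝓘(ℝ, M.Model) ∞
      (fun w : P.Model × Fib G M => c.cod (f ((P.chart x).symm w.1)))
      (fibTarget f (P.chart x) c) := by
    refine (contMDiffOn_of_mem_maximalAtlas c.cod_mem).comp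
      (hf.comp_contMDiffOn ((fib_smooth_fst x).mono fun _ h => h.1.1)) fun _ h => h.1.2
  have h2 : ContMDiffOn 𝓘(ℝ, P.Model × Fib G M) 𝓘(ℝ, G.Model) ∞ (fibInv f (P.chart x) c)
      (fibTarget f (P.chart x) c) := by
    rw [contMDiffOn_iff_contDiffOn] at h1 ⊢
    exact c.lin.symm.contDiff.comp_contDiffOn (h1.prodMk contDiffOn_snd)
  exact (contMDiffOn_symm_of_mem_maximalAtlas c.dom_mem).comp h2 fun _ h => h.2

theorem FibPres.isManifold (Q : FibPres f t S) (hf : IsSmooth f) (ht : IsSubm t) :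
    letI := Q.charted hf.continuous ht
    IsManifold 𝓘(ℝ, P.Model × Fib G M) ∞ S := by
  let _ := Q.charted hf.continuous ht
  refine isManifold_of_contDiffOn _ _ _ ?_
  rintro _ _ ⟨c, x, z₀, rfl⟩ ⟨c', x', z₁, rfl⟩
  simp only [modelWithCornersSelf_coe, modelWithCornersSelf_coe_symm, Function.comp_id,
    Function.id_comp, Set.preimage_id, Set.range_id, Set.inter_univ]
  rw [← contMDiffOn_iff_contDiffOn, contMDiffOn_iff_contDiffOn]
  have key : ∀ w ∈ ((Q.chart hf.continuous (P.chart x) c z₀).symm.trans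
      (Q.chart hf.continuous (P.chart x') c' z₁)).source,
      w ∈ fibTarget f (P.chart x) c ∧ (P.chart x).symm w.1 ∈ (P.chart x').source ∧
        c.dom.symm (fibInv f (P.chart x) c w) ∈ c'.dom.source := by
    rintro w ⟨h1, h2⟩
    have h1' : w ∈ fibTarget f (P.chart x) c := h1
    refine ⟨h1', ?_, ?_⟩
    · rw [← Q.chart_symm_fst hf.continuous (P.chart x) c z₀ h1']; exact h2.1
    · rw [← Q.chart_symm_snd hf.continuous (P.chart x) c z₀ h1']; exact h2.2
  have s1 : ContDiffOn ℝ ∞ (fun w : P.Model × Fib G M => P.chart x' ((P.chart x).symm w.1))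
      ((Q.chart hf.continuous (P.chart x) c z₀).symm.trans
      (Q.chart hf.continuous (P.chart x') c' z₁)).source := by
    rw [← contMDiffOn_iff_contDiffOn]
    exact (contMDiffOn_chart (I := 𝓘(ℝ, P.Model)) (n := ∞) (x := x')).comp
      ((fib_smooth_fst x).mono fun w hw => (key w hw).1.1.1) fun w hw => (key w hw).2.1
  have s2 : ContDiffOn ℝ ∞ (fun w : P.Model × Fib G M =>
      c'.dom (c.dom.symm (fibInv f (P.chart x) c w)))
      ((Q.chart hf.continuous (P.chart x) c z₀).symm.trans
      (Q.chart hf.continuous (P.chart x') c' z₁)).source := by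
    rw [← contMDiffOn_iff_contDiffOn]
    exact (contMDiffOn_of_mem_maximalAtlas c'.dom_mem).comp
      ((fib_smooth_snd hf x c).mono fun w hw => (key w hw).1) fun w hw => (key w hw).2.2
  refine (s1.prodMk ((contDiff_snd.comp c'.lin.contDiff).comp_contDiffOn s2)).congr ?_
  intro w hw
  have e1 := Q.chart_symm_fst hf.continuous (P.chart x) c z₀ (key w hw).1
  have e2 := Q.chart_symm_snd hf.continuous (P.chart x) c z₀ (key w hw).1
  exact Prod.ext (congrArg (P.chart x') e1) (congrArg (fun g => (c'.lin (c'.dom g)).2) e2)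

/-- The fibre product of `f : P → M` and a submersion `t : G → M`, as a manifold. -/
def FibPres.mfd (Q : FibPres f t S) (hf : IsSmooth f) (ht : IsSubm t) [T2Space S] :
    Mfd.{u} :=
  letI := Q.charted hf.continuous ht
  letI := Q.isManifold hf ht
  { Model := P.Model × Fib G M, Pt := S }

theorem FibPres.smooth_fst (Q : FibPres f t S) (hf : IsSmooth f) (ht : IsSubm t) [T2Space S] :
    IsSmooth (X := Q.mfd hf ht) (Y := P) Q.fst := by
  let N : Mfd.{u} := Q.mfd hf ht
  intro (z : N)
  have hz : z ∈ (N.chart z).source := mem_chart_source _ z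
  have h1 : ContMDiffOn 𝓘(ℝ, N.Model) 𝓘(ℝ, P.Model) ∞
      (fun z' => (P.chart (Q.fst z)).symm (N.chart z z').1) (N.chart z).source :=
    (fib_smooth_fst (G := G) (M := M) (Q.fst z)).comp
      (contMDiffOn_chart (I := 𝓘(ℝ, N.Model)) (n := ∞) (x := z))
      fun z' hz' => ((N.chart z).map_source hz').1.1
  refine (h1.contMDiffAt ((N.chart z).open_source.mem_nhds hz)).congr_of_eventuallyEq ?_
  filter_upwards [(N.chart z).open_source.mem_nhds hz] with z' hz'
  exact ((P.chart (Q.fst z)).left_inv hz'.1).symm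

theorem FibPres.smooth_snd (Q : FibPres f t S) (hf : IsSmooth f) (ht : IsSubm t) [T2Space S] :
    IsSmooth (X := Q.mfd hf ht) (Y := G) Q.snd := by
  let N : Mfd.{u} := Q.mfd hf ht
  intro (z : N)
  have hz : z ∈ (N.chart z).source := mem_chart_source _ z
  set c := (ht.exists_subChart (Q.snd z)).choose with hc
  have h1 : ContMDiffOn 𝓘(ℝ, N.Model) 𝓘(ℝ, G.Model) ∞
      (fun z' => c.dom.symm (fibInv f (P.chart (Q.fst z)) c (N.chart z z'))) (N.chart z).source :=
    (fib_smooth_snd hf (Q.fst z) c).comp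
      (contMDiffOn_chart (I := 𝓘(ℝ, N.Model)) (n := ∞) (x := z))
      fun z' hz' => (N.chart z).map_source hz'
  refine (h1.contMDiffAt ((N.chart z).open_source.mem_nhds hz)).congr_of_eventuallyEq ?_
  filter_upwards [(N.chart z).open_source.mem_nhds hz] with z' hz'
  have h2 : (N.chart z).symm (N.chart z z') = z' := (N.chart z).left_inv hz'
  have h3 := Q.chart_symm_snd hf.continuous (P.chart (Q.fst z)) c z ((N.chart z).map_source hz')
  rw [← h3]
  exact congrArg Q.snd h2.symm

theorem FibPres.smooth_lift (Q : FibPres f t S) (hf : IsSmooth f) (ht : IsSubm t) [T2Space S]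
    {Y : Mfd.{u}} {h : Y → S} (h1 : IsSmooth (X := Y) (Y := P) fun y => Q.fst (h y))
    (h2 : IsSmooth (X := Y) (Y := G) fun y => Q.snd (h y)) :
    IsSmooth (X := Y) (Y := Q.mfd hf ht) h := by
  have hcont : Continuous h :=
    Q.inducing.continuous_iff.2 (h1.continuous.prodMk h2.continuous)
  let N : Mfd.{u} := Q.mfd hf ht
  let h' : Y → N := h
  intro y
  have hz : h' y ∈ (N.chart (h' y)).source := mem_chart_source _ (h' y)
  set c := (ht.exists_subChart (Q.snd (h y))).choose with hc
  have hopen : IsOpen (h' ⁻¹' (N.chart (h' y)).source) := (N.chart (h' y)).open_source.preimage hcont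
  have s1 : ContMDiffOn 𝓘(ℝ, Y.Model) 𝓘(ℝ, P.Model) ∞
      (fun y' => P.chart (Q.fst (h y)) (Q.fst (h y'))) (h' ⁻¹' (N.chart (h' y)).source) :=
    (contMDiffOn_chart (I := 𝓘(ℝ, P.Model)) (n := ∞) (x := Q.fst (h y))).comp
      h1.contMDiffOn fun y' hy' => hy'.1
  have s2 : ContMDiffOn 𝓘(ℝ, Y.Model) 𝓘(ℝ, G.Model) ∞
      (fun y' => c.dom (Q.snd (h y'))) (h' ⁻¹' (N.chart (h' y)).source) :=
    (contMDiffOn_of_mem_maximalAtlas c.dom_mem).comp h2.contMDiffOn fun y' hy' => hy'.2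
  have s3 : ContMDiffOn 𝓘(ℝ, Y.Model) 𝓘(ℝ, Fib G M) ∞
      (fun y' => (c.lin (c.dom (Q.snd (h y')))).2) (h' ⁻¹' (N.chart (h' y)).source) :=
    (contDiff_snd.comp c.lin.contDiff).contMDiff.comp_contMDiffOn s2
  have s4 : ContMDiffOn 𝓘(ℝ, Y.Model) 𝓘(ℝ, N.Model) ∞
      (fun y' => N.chart (h' y) (h' y')) (h' ⁻¹' (N.chart (h' y)).source) :=
    s1.prodMk_space s3
  have s5 : ContMDiffOn 𝓘(ℝ, Y.Model) 𝓘(ℝ, N.Model) ∞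
      (fun y' => (N.chart (h' y)).symm (N.chart (h' y) (h' y'))) (h' ⁻¹' (N.chart (h' y)).source) :=
    (contMDiffOn_chart_symm (I := 𝓘(ℝ, N.Model)) (n := ∞) (x := h' y)).comp s4
      fun y' hy' => (N.chart (h' y)).map_source hy'
  refine (s5.contMDiffAt (hopen.mem_nhds hz)).congr_of_eventuallyEq ?_
  filter_upwards [hopen.mem_nhds hz] with y' hy'
  exact ((N.chart (h' y)).left_inv hy').symm

end FibreProduct

/-! ### Strings of composable arrows -/

/-- Manifolds of objects and arrows with submersive source and target maps. -/
structure SubmGraph : Type (u + 1) where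
  /-- objects -/
  M : Mfd.{u}
  /-- arrows -/
  G : Mfd.{u}
  s : G → M
  t : G → M
  subm_s : IsSubm s
  subm_t : IsSubm t

namespace SubmGraph

variable (Γ : SubmGraph.{u})

theorem smooth_s : IsSmooth Γ.s := Γ.subm_s.contMDiff

theorem smooth_t : IsSmooth Γ.t := Γ.subm_t.contMDiff

/-- Strings `(g₀, …, g_p)` of `p + 1` arrows with `s(g_i) = t(g_{i+1})`. -/
@[ext] structure Str (p : ℕ) : Type u where
  arr : Fin (p + 1) → Γ.G
  comp : ∀ i j : Fin (p + 1), (i : ℕ) + 1 = j → Γ.s (arr i) = Γ.t (arr j)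

/-- The topology of strings as a subspace of `G^{p+1}`. -/
instance (p : ℕ) : TopologicalSpace (Γ.Str p) := TopologicalSpace.induced Str.arr inferInstance

variable {Γ}

theorem Str.inducing (p : ℕ) : Topology.IsInducing (Str.arr : Γ.Str p → Fin (p + 1) → Γ.G) := ⟨rfl⟩

theorem Str.continuous_arr {p : ℕ} (i : Fin (p + 1)) : Continuous fun x : Γ.Str p => x.arr i :=
  (continuous_apply i).comp (Str.inducing p).continuous

instance (p : ℕ) : T2Space (Γ.Str p) :=
  T2Space.of_injective_continuous (f := Str.arr) (fun _ _ h => Str.ext h)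
    (Str.inducing p).continuous

variable (Γ) in
/-- Strings of length one as the fibre product `M ×_M G`. -/
def basePres : FibPres (id : Γ.M → Γ.M) Γ.t (Γ.Str 0) where
  fst z := Γ.t (z.arr 0)
  snd z := z.arr 0
  pair _ g _ := ⟨fun _ => g, fun i j h => by omega⟩
  comm _ := rfl
  fst_pair _ _ h := h.symm
  snd_pair _ _ _ := rfl
  pair_eta z := Str.ext (funext fun i => by rw [Fin.fin_one_eq_zero i])
  inducing := by
    have h1 : Continuous fun z : Γ.Str 0 => (Γ.t (z.arr 0), z.arr 0) :=
      (Γ.smooth_t.continuous.comp (Str.continuous_arr 0)).prodMk (Str.continuous_arr 0)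
    have h2 : Continuous fun w : Γ.M × Γ.G => (fun _ : Fin 1 => w.2) := by fun_prop
    refine Topology.IsInducing.of_comp h1 h2 ?_
    have h3 : (fun w : Γ.M × Γ.G => (fun _ : Fin 1 => w.2)) ∘
        (fun z : Γ.Str 0 => (Γ.t (z.arr 0), z.arr 0)) = fun z : Γ.Str 0 => z.arr := by
      funext z i
      rw [Fin.fin_one_eq_zero i]
      rfl
    rw [h3]
    exact Str.inducing _

/-- The string without its last arrow. -/
def Str.init {p : ℕ} (z : Γ.Str (p + 1)) : Γ.Str p :=
  ⟨fun i => z.arr i.castSucc, fun i j h => z.comp i.castSucc j.castSucc h⟩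

/-- Append an arrow to a string. -/
def Str.snoc {p : ℕ} (x : Γ.Str p) (g : Γ.G) (h : Γ.s (x.arr (Fin.last p)) = Γ.t g) :
    Γ.Str (p + 1) :=
  ⟨Fin.snoc x.arr g, by
    intro i j hij
    induction j using Fin.lastCases with
    | last =>
      obtain rfl : i = (Fin.last p).castSucc := by
        ext; simp at hij ⊢; omega
      simpa using h
    | cast j =>
      obtain ⟨i, rfl⟩ : ∃ i' : Fin (p + 1), i = i'.castSucc :=
        ⟨⟨i, by have := j.2; simp at hij; omega⟩, rfl⟩
      simpa using x.comp i j hij⟩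

theorem Str.continuous_init {p : ℕ} : Continuous (Str.init : Γ.Str (p + 1) → Γ.Str p) :=
  (Str.inducing p).continuous_iff.2
    (continuous_pi fun i : Fin (p + 1) => Str.continuous_arr i.castSucc)

variable (Γ) in
/-- The source of the last arrow of a string. -/
def lastSource (p : ℕ) (x : Γ.Str p) : Γ.M := Γ.s (x.arr (Fin.last p))

/-- A smooth manifold structure on the space of strings of `p + 1` arrows for which a map into
this space is smooth if and only if its components are. -/
structure StrAtlas (Γ : SubmGraph.{u}) (p : ℕ) where
  Model : Type u
  [normed : NormedAddCommGroup Model]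
  [normedSpace : NormedSpace ℝ Model]
  [finiteDim : FiniteDimensional ℝ Model]
  [charted : ChartedSpace Model (Γ.Str p)]
  [smooth : IsManifold 𝓘(ℝ, Model) ∞ (Γ.Str p)]
  smooth_arrow : ∀ i, IsSmooth (X := { Model := Model, Pt := Γ.Str p }) (Y := Γ.G) fun x => x.arr i
  smooth_lift : ∀ (Y : Mfd.{u}) (h : Y → Γ.Str p),
    (∀ i, IsSmooth (Y := Γ.G) fun y => (h y).arr i) →
      IsSmooth (Y := { Model := Model, Pt := Γ.Str p }) h

attribute [instance] StrAtlas.normed StrAtlas.normedSpace StrAtlas.finiteDim StrAtlas.charted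
  StrAtlas.smooth

/-- The manifold of strings. -/
def StrAtlas.mfd {p : ℕ} (A : StrAtlas Γ p) : Mfd.{u} := { Model := A.Model, Pt := Γ.Str p }

/-- Strings of length `p + 2` as the fibre product of strings of length `p + 1` with `G`. -/
def StrAtlas.succPres {p : ℕ} (A : StrAtlas Γ p) :
    FibPres (P := A.mfd) (Γ.lastSource p) Γ.t (Γ.Str (p + 1)) where
  fst z := z.init
  snd z := z.arr (Fin.last (p + 1))
  pair x g h := Str.snoc x g h
  comm z := z.comp _ _ (by simp)
  fst_pair x g h := Str.ext (funext fun i => by simp [Str.init, Str.snoc])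
  snd_pair x g h := by simp [Str.snoc]
  pair_eta z := Str.ext (Fin.snoc_init_self z.arr)
  inducing := by
    have h1 : Continuous fun z : Γ.Str (p + 1) => (z.init, z.arr (Fin.last (p + 1))) :=
      Str.continuous_init.prodMk (Str.continuous_arr _)
    have h2 : Continuous fun w : Γ.Str p × Γ.G =>
        (Fin.snoc w.1.arr w.2 : Fin (p + 2) → Γ.G) :=
      Continuous.finSnoc ((Str.inducing p).continuous.comp continuous_fst) continuous_snd
    have h3 : (fun w : Γ.Str p × Γ.G => (Fin.snoc w.1.arr w.2 : Fin (p + 2) → Γ.G)) ∘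
        (fun z : Γ.Str (p + 1) => (z.init, z.arr (Fin.last (p + 1)))) = fun z => z.arr := by
      funext z
      exact Fin.snoc_init_self z.arr
    exact Topology.IsInducing.of_comp h1 h2 (h3 ▸ Str.inducing (p + 1))

theorem StrAtlas.smooth_lastSource {p : ℕ} (A : StrAtlas Γ p) :
    IsSmooth (X := A.mfd) (Γ.lastSource p) :=
  Γ.smooth_s.comp (A.smooth_arrow (Fin.last p))

variable (Γ) in
/-- The manifold structure on strings of length one. -/
def baseAtlas : StrAtlas Γ 0 :=
  let N := Γ.basePres.mfd (contMDiff_id) Γ.subm_t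
  { Model := N.Model
    charted := N.charted
    smooth := N.smooth
    smooth_arrow := fun i => by
      rw [Fin.fin_one_eq_zero i]
      exact Γ.basePres.smooth_snd contMDiff_id Γ.subm_t
    smooth_lift := fun Y h hh =>
      Γ.basePres.smooth_lift contMDiff_id Γ.subm_t (Γ.smooth_t.comp (hh 0)) (hh 0) }

/-- The manifold structure on strings of length `p + 2`, from that on strings of length `p + 1`. -/
def succAtlas {p : ℕ} (A : StrAtlas Γ p) : StrAtlas Γ (p + 1) :=
  let N := A.succPres.mfd A.smooth_lastSource Γ.subm_t
  { Model := N.Model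
    charted := N.charted
    smooth := N.smooth
    smooth_arrow := fun i => by
      induction i using Fin.lastCases with
      | last => exact A.succPres.smooth_snd A.smooth_lastSource Γ.subm_t
      | cast i =>
        exact (A.smooth_arrow i).comp (A.succPres.smooth_fst A.smooth_lastSource Γ.subm_t)
    smooth_lift := fun Y h hh =>
      A.succPres.smooth_lift A.smooth_lastSource Γ.subm_t
        (A.smooth_lift Y _ fun i => hh i.castSucc) (hh (Fin.last (p + 1))) }

variable (Γ) in
/-- The manifold structure on strings of length `p + 1`. -/
def strAtlas : ∀ p, StrAtlas Γ p
  | 0 => Γ.baseAtlas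
  | p + 1 => succAtlas (strAtlas p)

variable (Γ) in
/-- The spaces of the nerve: `G^{(0)} = M`, and `G^{(p)}` is the manifold of strings of `p`
composable arrows for `p ≥ 1`. -/
def nerve : ℕ → Mfd.{u}
  | 0 => Γ.M
  | p + 1 => (Γ.strAtlas p).mfd

/-- The `i`-th arrow of a string. -/
def arrow {p : ℕ} (i : Fin (p + 1)) (x : Γ.nerve (p + 1)) : Γ.G := Str.arr (Γ := Γ) x i

theorem arrow_comp {p : ℕ} (x : Γ.nerve (p + 1)) (i j : Fin (p + 1)) (h : (i : ℕ) + 1 = j) :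
    Γ.s (arrow i x) = Γ.t (arrow j x) :=
  Str.comp (Γ := Γ) x i j h

/-- Build a string from its arrows. -/
def ofArrows {p : ℕ} (g : Fin (p + 1) → Γ.G)
    (h : ∀ i j : Fin (p + 1), (i : ℕ) + 1 = j → Γ.s (g i) = Γ.t (g j)) : Γ.nerve (p + 1) :=
  (⟨g, h⟩ : Γ.Str p)

@[simp] theorem arrow_ofArrows {p : ℕ} (g : Fin (p + 1) → Γ.G)
    (h : ∀ i j : Fin (p + 1), (i : ℕ) + 1 = j → Γ.s (g i) = Γ.t (g j)) (i : Fin (p + 1)) :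
    arrow i (ofArrows g h) = g i := rfl

theorem smooth_arrow {p : ℕ} (i : Fin (p + 1)) : IsSmooth (arrow (Γ := Γ) i) :=
  (Γ.strAtlas p).smooth_arrow i

theorem smooth_of_arrow {p : ℕ} {Y : Mfd.{u}} {h : Y → Γ.nerve (p + 1)}
    (hh : ∀ i, IsSmooth fun y => arrow i (h y)) : IsSmooth h :=
  (Γ.strAtlas p).smooth_lift Y h hh

/-- The composable pair `(g, h)`. -/
def pairOf (g h : Γ.G) (hgh : Γ.s g = Γ.t h) : Γ.nerve 2 :=
  ofArrows ![g, h] (by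
    intro i j hij
    fin_cases i <;> fin_cases j <;> simp_all)

end SubmGraph

/-! ### Lie groupoids -/

/-- A Lie groupoid. The value `mul g h` is relevant only for `s g = t h`. -/
structure LieGroupoid : Type (u + 1) extends SubmGraph.{u} where
  unit : M → G
  inv : G → G
  mul : G → G → G
  s_unit : ∀ x, s (unit x) = x
  t_unit : ∀ x, t (unit x) = x
  s_mul : ∀ g h, s g = t h → s (mul g h) = s h
  t_mul : ∀ g h, s g = t h → t (mul g h) = t g
  mul_assoc : ∀ g h k, s g = t h → s h = t k → mul (mul g h) k = mul g (mul h k)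
  unit_mul : ∀ g, mul (unit (t g)) g = g
  mul_unit : ∀ g, mul g (unit (s g)) = g
  s_inv : ∀ g, s (inv g) = t g
  t_inv : ∀ g, t (inv g) = s g
  mul_inv : ∀ g, mul g (inv g) = unit (t g)
  inv_mul : ∀ g, mul (inv g) g = unit (s g)
  smooth_unit : IsSmooth unit
  smooth_inv : IsSmooth inv
  smooth_mul : IsSmooth (X := toSubmGraph.nerve 2) (Y := G)
    fun x => mul (SubmGraph.arrow 0 x) (SubmGraph.arrow 1 x)

namespace LieGroupoid

open SubmGraph

variable (𝒢 : LieGroupoid.{u})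

/-- The multiplication `m : G^{(2)} → G`. -/
def mulMap (x : 𝒢.nerve 2) : 𝒢.G := 𝒢.mul (arrow 0 x) (arrow 1 x)

variable {𝒢}

theorem smooth_mul_comp {Y : Mfd.{u}} {a b : Y → 𝒢.G} (ha : IsSmooth a) (hb : IsSmooth b)
    (hab : ∀ y, 𝒢.s (a y) = 𝒢.t (b y)) : IsSmooth fun y => 𝒢.mul (a y) (b y) := by
  have h1 : IsSmooth fun y => pairOf (Γ := 𝒢.toSubmGraph) (a y) (b y) (hab y) := by
    refine smooth_of_arrow fun i => ?_
    fin_cases i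
    · exact ha
    · exact hb
  exact 𝒢.smooth_mul.comp h1

/-- The arrows of the face `∂_i` of a string with at least two arrows: the first, respectively
last, arrow is dropped if `i` is the first, respectively last, index, and otherwise the
`i`-th and `(i+1)`-st arrows (counted from `1`) are multiplied. -/
def faceArrow {p : ℕ} (i : Fin (p + 3)) (x : 𝒢.nerve (p + 2)) (k : Fin (p + 1)) : 𝒢.G :=
  if (k : ℕ) + 1 < i then arrow k.castSucc x
  else if (k : ℕ) + 1 = i then 𝒢.mul (arrow k.castSucc x) (arrow k.succ x)
  else arrow k.succ x

theorem faceArrow_comp {p : ℕ} (i : Fin (p + 3)) (x : 𝒢.nerve (p + 2)) (k l : Fin (p + 1))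
    (h : (k : ℕ) + 1 = l) : 𝒢.s (faceArrow i x k) = 𝒢.t (faceArrow i x l) := by
  have c1 := arrow_comp x k.castSucc k.succ (by simp)
  have c2 := arrow_comp x l.castSucc l.succ (by simp)
  have e : k.succ = l.castSucc := by ext; simpa using h
  unfold faceArrow
  rw [e] at c1
  split_ifs <;> first
    | omega
    | simp only [𝒢.s_mul _ _ c1, 𝒢.t_mul _ _ c2, e, c1, c2]

/-- The faces of a string of length one: `∂_0 = s` and `∂_1 = t`. -/
def faceZero (i : Fin 2) (x : 𝒢.nerve 1) : 𝒢.M :=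
  if i = 0 then 𝒢.s (arrow 0 x) else 𝒢.t (arrow 0 x)

theorem smooth_faceZero (i : Fin 2) : IsSmooth (faceZero (𝒢 := 𝒢) i) := by
  unfold faceZero
  split_ifs
  · exact 𝒢.smooth_s.comp (smooth_arrow 0)
  · exact 𝒢.smooth_t.comp (smooth_arrow 0)

/-- The face maps `∂_i : G^{(p+1)} → G^{(p)}`. -/
def faceFun : ∀ (p : ℕ), Fin (p + 2) → 𝒢.nerve (p + 1) → 𝒢.nerve p
  | 0, i => faceZero i
  | _ + 1, i => fun x => ofArrows (faceArrow i x) (faceArrow_comp i x)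

theorem smooth_faceFun : ∀ (p : ℕ) (i : Fin (p + 2)), IsSmooth (faceFun (𝒢 := 𝒢) p i)
  | 0, i => smooth_faceZero i
  | p + 1, i => by
    refine smooth_of_arrow fun k => ?_
    simp only [faceFun, arrow_ofArrows, faceArrow]
    split_ifs
    · exact smooth_arrow _
    · exact smooth_mul_comp (smooth_arrow _) (smooth_arrow _) fun x =>
        arrow_comp x k.castSucc k.succ (by simp)
    · exact smooth_arrow _

/-- The face maps as smooth maps. -/
def face (p : ℕ) (i : Fin (p + 2)) : SMap (𝒢.nerve (p + 1)) (𝒢.nerve p) :=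
  ⟨faceFun p i, smooth_faceFun p i⟩

/-- The object over which a unit is inserted in position `i` of a string: the target of the first
arrow for `i = 0`, and the source of the preceding arrow otherwise. -/
def vertex {p : ℕ} (i : Fin (p + 2)) (x : 𝒢.nerve (p + 1)) : 𝒢.M :=
  if h : (i : ℕ) = 0 then 𝒢.t (arrow 0 x) else 𝒢.s (arrow ⟨i - 1, by omega⟩ x)

/-- The arrows of the degenerate string with a unit inserted in position `i`. -/
def degArrow {p : ℕ} (i : Fin (p + 2)) (x : 𝒢.nerve (p + 1)) (k : Fin (p + 2)) : 𝒢.G :=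
  if h : (k : ℕ) < i then arrow ⟨k, by omega⟩ x
  else if h' : (k : ℕ) = i then 𝒢.unit (vertex i x)
  else arrow ⟨k - 1, by omega⟩ x

theorem degArrow_comp {p : ℕ} (i : Fin (p + 2)) (x : 𝒢.nerve (p + 1)) (k l : Fin (p + 2))
    (h : (k : ℕ) + 1 = l) : 𝒢.s (degArrow i x k) = 𝒢.t (degArrow i x l) := by
  obtain ⟨k, hk⟩ := k
  obtain ⟨l, hl⟩ := l
  obtain ⟨i, hi⟩ := i
  simp only at h
  subst h
  simp only [degArrow, vertex]
  split_ifs <;> first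
    | omega
    | exact arrow_comp x _ _ (by simp only; omega)
    | (rw [𝒢.s_unit]; exact arrow_comp x _ _ (by simp only; omega))
    | exact arrow_comp x _ _ rfl
    | (rw [𝒢.t_unit]; subst_vars; rfl)
    | (rw [𝒢.s_unit]; subst_vars; rfl)

/-- The degeneracy maps `s_i : G^{(p)} → G^{(p+1)}`. For `p = 0` this is the unit map. -/
def degFun : ∀ (p : ℕ), Fin (p + 1) → 𝒢.nerve p → 𝒢.nerve (p + 1)
  | 0, _ => fun x => ofArrows (fun _ => 𝒢.unit x) fun i j h => by omega
  | _ + 1, i => fun x => ofArrows (degArrow i x) (degArrow_comp i x)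

theorem smooth_degFun : ∀ (p : ℕ) (i : Fin (p + 1)), IsSmooth (degFun (𝒢 := 𝒢) p i)
  | 0, _ => smooth_of_arrow fun _ => 𝒢.smooth_unit
  | p + 1, i => by
    refine smooth_of_arrow fun k => ?_
    simp only [degFun, arrow_ofArrows, degArrow, vertex]
    split_ifs
    · exact smooth_arrow _
    · exact 𝒢.smooth_unit.comp (𝒢.smooth_t.comp (smooth_arrow _))
    · exact 𝒢.smooth_unit.comp (𝒢.smooth_s.comp (smooth_arrow _))
    · exact smooth_arrow _

/-- The degeneracy maps as smooth maps. -/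
def degen (p : ℕ) (i : Fin (p + 1)) : SMap (𝒢.nerve p) (𝒢.nerve (p + 1)) :=
  ⟨degFun p i, smooth_degFun p i⟩

/-- The identification `g ↦ (g)` of `G` with `G^{(1)}`. -/
def single : SMap 𝒢.G (𝒢.nerve 1) :=
  ⟨fun g => ofArrows (fun _ => g) fun i j h => by omega, smooth_of_arrow fun _ => contMDiff_id⟩

/-! ### The Bott-Shulman-Stasheff double complex -/

variable (𝒢)

/-- `δ = ∑_i (-1)^i ∂_i^* : Ω^•(G^{(p)}) → Ω^•(G^{(p+1)})`. -/
def delta (p : ℕ) : Forms (𝒢.nerve p) →ₗ[ℝ] Forms (𝒢.nerve (p + 1)) :=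
  ∑ i : Fin (p + 2), sgn i • pull (face p i)

/-- `Ω^•(G^{(•)}) = ⨁_p Ω^•(G^{(p)})`. -/
abbrev BSS : Type u := ⨁ p : ℕ, Forms (𝒢.nerve p)

/-- The inclusion of `Ω^•(G^{(p)})`. -/
abbrev inNerve (p : ℕ) : Forms (𝒢.nerve p) →ₗ[ℝ] 𝒢.BSS :=
  DirectSum.lof ℝ ℕ (fun p => Forms (𝒢.nerve p)) p

/-- The total differential, equal to `d + (-1)^q δ` on `Ω^q(G^{(p)})`. -/
def totalD : 𝒢.BSS →ₗ[ℝ] 𝒢.BSS :=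
  DirectSum.toModule ℝ ℕ 𝒢.BSS fun p =>
    𝒢.inNerve p ∘ₗ dR (𝒢.nerve p) + 𝒢.inNerve (p + 1) ∘ₗ 𝒢.delta p ∘ₗ degSign (𝒢.nerve p)

/-- Sequences `(D₀, D₁, …)` of operators on `Ω^•(G^{(0)}), Ω^•(G^{(1)}), …`. -/
abbrev OpSeq : Type u := ∀ p : ℕ, Forms (𝒢.nerve p) →ₗ[ℝ] Forms (𝒢.nerve p)

end LieGroupoid

theorem IsDerivation.zero {X : Mfd.{u}} (l : ℤ) : IsDerivation (X := X) l 0 where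
  degree _ _ _ _ := map_zero _
  leibniz _ _ _ := by simp

theorem IsDerivation.add {X : Mfd.{u}} {l : ℤ} {D D' : Forms X →ₗ[ℝ] Forms X}
    (h : IsDerivation l D) (h' : IsDerivation l D') : IsDerivation l (D + D') where
  degree q α r hr := by
    rw [LinearMap.add_apply, map_add, h.degree q α r hr, h'.degree q α r hr, add_zero]
  leibniz q α β := by
    simp only [LinearMap.add_apply, h.leibniz, h'.leibniz, map_add, smul_add]
    abel

theorem IsDerivation.smul {X : Mfd.{u}} {l : ℤ} {D : Forms X →ₗ[ℝ] Forms X} (c : ℝ)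
    (h : IsDerivation l D) : IsDerivation l (c • D) where
  degree q α r hr := by
    rw [LinearMap.smul_apply, map_smul, h.degree q α r hr, smul_zero]
  leibniz q α β := by
    simp only [LinearMap.smul_apply, h.leibniz, map_smul, smul_add, smul_comm c]

namespace LieGroupoid

open SubmGraph

variable (𝒢 : LieGroupoid.{u})

/-- Derivations of degree `l` of `Ω^•(G^{(•)})`: sequences of derivations of degree `l` which
commute with the degeneracy maps. -/
def derivations (l : ℤ) : Submodule ℝ 𝒢.OpSeq where
  carrier := {D | (∀ p, IsDerivation l (D p)) ∧ ∀ (p : ℕ) (i : Fin (p + 1)),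
    pull (degen p i) ∘ₗ D (p + 1) = D p ∘ₗ pull (degen p i)}
  zero_mem' := ⟨fun _ => IsDerivation.zero l, fun _ _ => by simp⟩
  add_mem' ha hb := ⟨fun p => (ha.1 p).add (hb.1 p), fun p i => by
    simp only [Pi.add_apply, LinearMap.comp_add, LinearMap.add_comp, ha.2 p i, hb.2 p i]⟩
  smul_mem' c _ ha := ⟨fun p => (ha.1 p).smul c, fun p i => by
    simp only [Pi.smul_apply, LinearMap.comp_smul, LinearMap.smul_comp, ha.2 p i]⟩

/-- The operator on `Ω^•(G^{(•)})` defined by a sequence of operators. -/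
def total (D : 𝒢.OpSeq) : 𝒢.BSS →ₗ[ℝ] 𝒢.BSS := DirectSum.lmap D

/-- Derivations of degree `l` of `Ω^•(G^{(•)})` which commute, in the graded sense, with the total
differential. -/
def totalDerivations (l : ℤ) : Submodule ℝ 𝒢.OpSeq where
  carrier := {D | D ∈ 𝒢.derivations l ∧ gradedComm l 1 (𝒢.total D) 𝒢.totalD = 0}
  zero_mem' := ⟨zero_mem _, by
    have h : 𝒢.total 0 = 0 := by ext; simp [total]
    rw [h, gradedComm_zero_left]⟩
  add_mem' {a b} ha hb := ⟨add_mem ha.1 hb.1, by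
    have h : 𝒢.total (a + b) = 𝒢.total a + 𝒢.total b := by ext; simp [total]
    rw [h, gradedComm_add_left, ha.2, hb.2, add_zero]⟩
  smul_mem' c a ha := ⟨Submodule.smul_mem _ c ha.1, by
    have h : 𝒢.total (c • a) = c • 𝒢.total a := by ext; simp [total]
    rw [h, gradedComm_smul_left, ha.2, smul_zero]⟩

/-! ### Multiplicative vector-valued forms -/

/-- The graph of the multiplication of the tangent groupoid `TG ⇉ TM`, over a composable pair
`x = (g, h)`: under the identification `(TG)^{(2)} = T(G^{(2)})` given by the tangent maps of the
two projections, `X ∈ T_g G` and `Y ∈ T_h G` are composable with product `Z = Tm(X, Y)`. -/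
def IsTangentMul {𝒢 : LieGroupoid.{u}} (x : 𝒢.nerve 2) (X : 𝒢.G.T (arrow 0 x))
    (Y : 𝒢.G.T (arrow 1 x)) (Z : 𝒢.G.T (𝒢.mulMap x)) : Prop :=
  ∃ w : (𝒢.nerve 2).T x, tmap (arrow 0) x w = X ∧ tmap (arrow 1) x w = Y ∧ tmap 𝒢.mulMap x w = Z

/-- `K : ⊕^k TG → TG` is a groupoid morphism covering `K_M : ⊕^k TM → TM`: it commutes with the
source and target maps and preserves the multiplication. -/
structure Covers {𝒢 : LieGroupoid.{u}} {k : ℕ} (K : VForm 𝒢.G k) (KM : VForm 𝒢.M k) : Prop where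
  source : Related 𝒢.s K KM
  target : Related 𝒢.t K KM
  mul : ∀ (x : 𝒢.nerve 2) (X : Fin k → 𝒢.G.T (arrow 0 x)) (Y : Fin k → 𝒢.G.T (arrow 1 x))
    (Z : Fin k → 𝒢.G.T (𝒢.mulMap x)), (∀ i, IsTangentMul x (X i) (Y i) (Z i)) →
      IsTangentMul x (K.1 _ X) (K.1 _ Y) (K.1 _ Z)

end LieGroupoid

theorem Related.zero {X Y : Mfd.{u}} (f : X → Y) (k : ℕ) :
    Related f (0 : VForm X k) (0 : VForm Y k) :=
  fun x _ => (map_zero (tmap f x)).symm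

theorem Related.add {X Y : Mfd.{u}} {f : X → Y} {k : ℕ} {K K' : VForm X k} {L L' : VForm Y k}
    (h : Related f K L) (h' : Related f K' L') : Related f (K + K') (L + L') := fun x v =>
  (congrArg₂ (· + ·) (h x v) (h' x v)).trans (map_add (tmap f x) _ _).symm

theorem Related.smul {X Y : Mfd.{u}} {f : X → Y} {k : ℕ} {K : VForm X k} {L : VForm Y k} (c : ℝ)
    (h : Related f K L) : Related f (c • K) (c • L) := fun x v =>
  (congrArg (c • ·) (h x v)).trans (map_smul (tmap f x) _ _).symm

namespace LieGroupoid

open SubmGraph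

variable (𝒢 : LieGroupoid.{u})

/-- The multiplicative vector-valued `k`-forms on `G`. -/
def multForms (k : ℕ) : Submodule ℝ (VForm 𝒢.G k) where
  carrier := {K | ∃ KM : VForm 𝒢.M k, Covers K KM}
  zero_mem' := ⟨0, Related.zero _ _, Related.zero _ _, fun x _ _ _ _ =>
    ⟨0, map_zero _, map_zero _, map_zero _⟩⟩
  add_mem' := by
    rintro K K' ⟨L, h⟩ ⟨L', h'⟩
    refine ⟨L + L', h.source.add h'.source, h.target.add h'.target, fun x X Y Z H => ?_⟩
    obtain ⟨w, h1, h2, h3⟩ := h.mul x X Y Z H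
    obtain ⟨w', h1', h2', h3'⟩ := h'.mul x X Y Z H
    exact ⟨w + w', (map_add _ _ _).trans (congrArg₂ (· + ·) h1 h1'),
      (map_add _ _ _).trans (congrArg₂ (· + ·) h2 h2'),
      (map_add _ _ _).trans (congrArg₂ (· + ·) h3 h3')⟩
  smul_mem' := by
    rintro c K ⟨L, h⟩
    refine ⟨c • L, h.source.smul c, h.target.smul c, fun x X Y Z H => ?_⟩
    obtain ⟨w, h1, h2, h3⟩ := h.mul x X Y Z H
    exact ⟨c • w, (map_smul _ _ _).trans (congrArg (c • ·) h1),
      (map_smul _ _ _).trans (congrArg (c • ·) h2), (map_smul _ _ _).trans (congrArg (c • ·) h3)⟩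

/-- `(K_M, K^{(1)}, K^{(2)}, …)` is the sequence induced by `K`: `K` covers `K_M`, and `K^{(p)}` is
the restriction of `K × ⋯ × K` to `G^{(p)} ⊆ G^p`, i.e. its `i`-th component is `K` applied to the
`i`-th components of tangent vectors. -/
def IsInduced {𝒢 : LieGroupoid.{u}} {k : ℕ} (K : VForm 𝒢.G k)
    (Kbar : ∀ p : ℕ, VForm (𝒢.nerve p) k) : Prop :=
  Covers K (Kbar 0) ∧ ∀ (p : ℕ) (i : Fin (p + 1)), Related (arrow i) (Kbar (p + 1)) K

end LieGroupoid

end MultForms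

end

/-! The proof has an analytic half, valid on any manifold, and a groupoid half.

On a manifold, a derivation of `Ω^•` commuting with `d` is a Lie derivative `L_K`, for a unique `K`.
The Leibniz rule makes derivations local, and by Hadamard's lemma the value of `D f` at a point
depends only on `df` there; this linear dependence is the form `K`. Near a point every form of
positive degree is a combination of forms `dg ∧ β`, so a derivation commuting with `d` and vanishing
on functions is zero. This gives `IsDerivation.exists_eq_lieD`, `IsDerivation.eq_zero` and, in
negative degree, `IsDerivation.eq_zero_of_neg`.

By `gradedComm_total_eq_zero_iff`, commuting with the total differential means that each `D_p`
commutes with `d` and that the sequence commutes with `δ`. A multiplicative `K` induces forms on the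
spaces of strings because tangent vectors to strings are strings of composable tangent vectors.
These forms are related under all faces and degeneracies, so their Lie derivatives commute with
every pullback, in particular with `δ`.

The converse is the hard part. Let `D_p = L_{N_p}`. Compatibility with degeneracies says that the
`N_p` are related under each degeneracy, but compatibility with `δ` only controls an alternating sum
of the defects of the faces. Functions separate points, so at a string `x` the signed defects cancel
within each group of faces having the same value at `x` (`sum_defect_filter`); a face whose value at
`x` is isolated has no defect there. To treat coinciding faces, the dimension of the source and
target fibres is distinguished.

If it is positive, a small change of the first (or last) arrow within its fibre isolates the first
(or last) face, and defects vanish on closed sets: `related_face_first`, `related_face_last`. On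
pairs of arrows the multiplication is then the only face left, and the strings `(g, g⁻¹)` transfer
the result to the target map.

If it is zero, tangent vectors to strings are determined by their image under the target. It
suffices to relate everything to `N_0` along the target, which is done in `defect_target_discrete`
and `related_strTarget`; strings where the faces coincide are degenerate and are handled by the
degeneracies, apart from arrows of order two, where two equal defects add up to zero.

Both cases meet in `related_faces`, and `exists_isInduced_of_delta` recovers `K`. This gives
bijectivity (`lieSeq_bijective`). Graded commutators of admissible sequences are admissible, so
surjectivity produces the bracket of two multiplicative forms. -/

noncomputable section

namespace MultForms

/-! ### Alternating sums -/

section AltSum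

variable {V : Type*} {ι κ : Type*} [Fintype ι] [DecidableEq ι] [Fintype κ] [DecidableEq κ]

/-- The sign of a permutation, as a real number. -/
abbrev rsign (σ : Equiv.Perm ι) : ℝ := ((Equiv.Perm.sign σ : ℤ) : ℝ)

theorem rsign_mul (σ τ : Equiv.Perm ι) : rsign (σ * τ) = rsign σ * rsign τ := by
  simp [rsign, Equiv.Perm.sign_mul]

theorem rsign_mul_self (σ : Equiv.Perm ι) : rsign σ * rsign σ = 1 := by
  rw [← rsign_mul]
  simp [rsign, Equiv.Perm.sign_mul, Int.units_mul_self]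

/-- The alternating sum `∑_σ sgn σ F(v ∘ σ)`. -/
def altSum (F : (ι → V) → ℝ) (v : ι → V) : ℝ :=
  ∑ σ : Equiv.Perm ι, rsign σ * F (fun i => v (σ i))

theorem altSum_reindex (e : ι ≃ κ) (F : (ι → V) → ℝ) (v : κ → V) :
    altSum F (fun i => v (e i)) = altSum (fun w => F fun i => w (e i)) v := by
  unfold altSum
  refine Fintype.sum_equiv e.permCongr _ _ fun σ => ?_
  simp [rsign, Equiv.permCongr_apply]

theorem altSum_perm (e : Equiv.Perm ι) (F : (ι → V) → ℝ) (v : ι → V) :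
    altSum (fun w => F fun i => w (e i)) v = rsign e * altSum F v := by
  unfold altSum
  rw [Finset.mul_sum]
  refine Fintype.sum_equiv (Equiv.mulRight e) _ _ fun σ => ?_
  simp only [Equiv.coe_mulRight, Equiv.Perm.coe_mul, Function.comp_apply, rsign_mul]
  rw [mul_comm (rsign σ) (rsign e), ← mul_assoc, ← mul_assoc, rsign_mul_self, one_mul]

theorem altSum_mul_left (c : ℝ) (F : (ι → V) → ℝ) (v : ι → V) :
    altSum (fun w => c * F w) v = c * altSum F v := by
  simp only [altSum, Finset.mul_sum]
  exact Finset.sum_congr rfl fun _ _ => by ring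

theorem altSum_add (F G : (ι → V) → ℝ) (v : ι → V) :
    altSum (fun w => F w + G w) v = altSum F v + altSum G v := by
  simp only [altSum, mul_add, Finset.sum_add_distrib]

theorem altSum_sum {J : Type*} (s : Finset J) (F : J → (ι → V) → ℝ) (v : ι → V) :
    altSum (fun w => ∑ j ∈ s, F j w) v = ∑ j ∈ s, altSum (F j) v := by
  simp only [altSum, Finset.mul_sum]
  exact Finset.sum_comm

/-- Partial alternation is absorbed by alternation. -/
theorem altSum_partial (φ : Equiv.Perm κ → Equiv.Perm ι) (hφ : ∀ τ, rsign (φ τ) = rsign τ)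
    (F G : (ι → V) → ℝ)
    (hF : ∀ w, F w = ∑ τ : Equiv.Perm κ, rsign τ * G fun i => w (φ τ i)) (v : ι → V) :
    altSum F v = (Fintype.card κ).factorial * altSum G v := by
  have h : ∀ τ : Equiv.Perm κ,
      altSum (fun w => rsign τ * G fun i => w (φ τ i)) v = altSum G v := fun τ => by
    rw [altSum_mul_left, altSum_perm, hφ, ← mul_assoc, rsign_mul_self, one_mul]
  rw [show F = fun w => ∑ τ : Equiv.Perm κ, rsign τ * G fun i => w (φ τ i) from funext hF,
    altSum_sum]
  simp only [h]
  simp [Fintype.card_perm]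

/-- A permutation of the first block. -/
def permLeft (p q : ℕ) (τ : Equiv.Perm (Fin p)) : Equiv.Perm (Fin (p + q)) :=
  finSumFinEquiv.permCongr (Equiv.Perm.sumCongr τ 1)

/-- A permutation of the second block. -/
def permRight (p q : ℕ) (τ : Equiv.Perm (Fin q)) : Equiv.Perm (Fin (p + q)) :=
  finSumFinEquiv.permCongr (Equiv.Perm.sumCongr 1 τ)

@[simp] theorem permLeft_castAdd {p q : ℕ} (τ : Equiv.Perm (Fin p)) (i : Fin p) :
    permLeft p q τ (Fin.castAdd q i) = Fin.castAdd q (τ i) := by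
  simp [permLeft, Equiv.permCongr_apply]

@[simp] theorem permLeft_natAdd {p q : ℕ} (τ : Equiv.Perm (Fin p)) (i : Fin q) :
    permLeft p q τ (Fin.natAdd p i) = Fin.natAdd p i := by
  simp [permLeft, Equiv.permCongr_apply]

@[simp] theorem permRight_castAdd {p q : ℕ} (τ : Equiv.Perm (Fin q)) (i : Fin p) :
    permRight p q τ (Fin.castAdd q i) = Fin.castAdd q i := by
  simp [permRight, Equiv.permCongr_apply]

@[simp] theorem permRight_natAdd {p q : ℕ} (τ : Equiv.Perm (Fin q)) (i : Fin q) :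
    permRight p q τ (Fin.natAdd p i) = Fin.natAdd p (τ i) := by
  simp [permRight, Equiv.permCongr_apply]

theorem rsign_permLeft {p q : ℕ} (τ : Equiv.Perm (Fin p)) :
    rsign (permLeft p q τ) = rsign τ := by
  simp [permLeft, rsign]

theorem rsign_permRight {p q : ℕ} (τ : Equiv.Perm (Fin q)) :
    rsign (permRight p q τ) = rsign τ := by
  simp [permRight, rsign]

theorem altSum_partial_left {p q : ℕ} (A : (Fin p → V) → (Fin q → V) → ℝ)
    (v : Fin (p + q) → V) :
    altSum (fun w : Fin (p + q) → V => altSum (fun u => A u fun j => w (Fin.natAdd p j))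
      fun i => w (Fin.castAdd q i)) v =
    p.factorial * altSum (fun w : Fin (p + q) → V =>
      A (fun i => w (Fin.castAdd q i)) fun j => w (Fin.natAdd p j)) v := by
  rw [altSum_partial (permLeft p q) rsign_permLeft _
    (fun w : Fin (p + q) → V => A (fun i => w (Fin.castAdd q i)) fun j => w (Fin.natAdd p j))]
  · simp
  · intro w
    simp [altSum]

theorem altSum_partial_right {p q : ℕ} (A : (Fin p → V) → (Fin q → V) → ℝ)
    (v : Fin (p + q) → V) :
    altSum (fun w : Fin (p + q) → V => altSum (A fun i => w (Fin.castAdd q i))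
      fun j => w (Fin.natAdd p j)) v =
    q.factorial * altSum (fun w : Fin (p + q) → V =>
      A (fun i => w (Fin.castAdd q i)) fun j => w (Fin.natAdd p j)) v := by
  rw [altSum_partial (permRight p q) rsign_permRight _
    (fun w : Fin (p + q) → V => A (fun i => w (Fin.castAdd q i)) fun j => w (Fin.natAdd p j))]
  · simp
  · intro w
    simp [altSum]

theorem rsign_decomposeFin_zero {n : ℕ} (τ : Equiv.Perm (Fin n)) :
    rsign (Equiv.Perm.decomposeFin.symm (0, τ)) = rsign τ := by
  simp [rsign, Equiv.Perm.decomposeFin.symm_sign]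

theorem altSum_partial_tail {n : ℕ} (A : V → (Fin n → V) → ℝ) (v : Fin (n + 1) → V) :
    altSum (fun w : Fin (n + 1) → V => altSum (A (w 0)) (Fin.tail w)) v =
    n.factorial * altSum (fun w : Fin (n + 1) → V => A (w 0) (Fin.tail w)) v := by
  rw [altSum_partial (fun τ => Equiv.Perm.decomposeFin.symm (0, τ)) rsign_decomposeFin_zero _
    (fun w : Fin (n + 1) → V => A (w 0) (Fin.tail w))]
  · simp
  · intro w
    refine Finset.sum_congr rfl fun τ _ => ?_
    congr 2

/-- The permutations are sorted by the slot `j = σ⁻¹ 0` in which `z` lands. It is `σ⁻¹` which is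
decomposed, so that the transposition acts on the slots of `F` and the remaining permutation on the
entries of `v`. -/
theorem altSum_cons {n : ℕ} (F : (Fin (n + 1) → V) → ℝ) (z : V) (v : Fin n → V) :
    altSum F (Fin.cons z v : Fin (n + 1) → V) = ∑ j : Fin (n + 1), rsign (Equiv.swap 0 j) *
      altSum (fun u => F fun i => (Fin.cons z u : Fin (n + 1) → V) (Equiv.swap 0 j i)) v := by
  have h : altSum F (Fin.cons z v : Fin (n + 1) → V) =
      ∑ x : Fin (n + 1) × Equiv.Perm (Fin n), rsign (Equiv.swap 0 x.1) * (rsign x.2 *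
        F fun i => (Fin.cons z (fun i => v (x.2 i)) : Fin (n + 1) → V)
          (Equiv.swap 0 x.1 i)) := by
    unfold altSum
    refine Fintype.sum_equiv ((Equiv.inv _).trans (Equiv.Perm.decomposeFin.trans
      ((Equiv.refl _).prodCongr (Equiv.inv _)))) _ _ fun σ => ?_
    obtain ⟨⟨j, τ⟩, rfl⟩ : ∃ x, σ = (Equiv.Perm.decomposeFin.symm x)⁻¹ :=
      ⟨Equiv.Perm.decomposeFin σ⁻¹, by simp⟩
    have h0 : Equiv.Perm.decomposeFin.symm (j, τ) =
        Equiv.swap 0 j * Equiv.Perm.decomposeFin.symm (0, τ) := by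
      ext i
      induction i using Fin.cases <;> simp
    have h1 : rsign (Equiv.Perm.decomposeFin.symm (j, τ))⁻¹ =
        rsign (Equiv.swap 0 j) * rsign τ⁻¹ := by
      rw [h0]
      simp [rsign, Equiv.Perm.sign_mul, Equiv.Perm.decomposeFin.symm_sign, mul_comm]
      split_ifs <;> simp
    have h2 : ∀ i, (Equiv.Perm.decomposeFin.symm (0, τ))⁻¹ i =
        Equiv.Perm.decomposeFin.symm (0, τ⁻¹) i := by
      intro i
      rw [Equiv.Perm.inv_eq_iff_eq]
      induction i using Fin.cases <;> simp
    rw [h1, mul_assoc]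
    simp only [Equiv.trans_apply, Equiv.inv_apply, inv_inv, Equiv.apply_symm_apply,
      Equiv.prodCongr_apply, Prod.map, Equiv.refl_apply]
    congr 3
    funext i
    rw [h0, mul_inv_rev, Equiv.Perm.mul_apply, Equiv.swap_inv, h2]
    generalize Equiv.swap 0 j i = m
    induction m using Fin.cases <;> simp
  rw [h, Fintype.sum_prod_type]
  refine Finset.sum_congr rfl fun j _ => ?_
  rw [altSum, Finset.mul_sum]

/-- The permutation of `Fin (a + b)` which exchanges the two blocks. -/
def blockSwap (a b : ℕ) : Equiv.Perm (Fin (a + b)) := finRotate (a + b) ^ b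

theorem val_finRotate_pow (n m : ℕ) (i : Fin n) :
    ((finRotate n ^ m) i : ℕ) = (i + m) % n := by
  induction m with
  | zero => simp [Nat.mod_eq_of_lt i.2]
  | succ m ih =>
    rw [pow_succ', Equiv.Perm.mul_apply]
    obtain ⟨n, rfl⟩ : ∃ n', n = n' + 1 := ⟨n - 1, by have := i.2; omega⟩
    rw [finRotate_apply, Fin.val_add, ih, Fin.val_one', ← Nat.add_mod, add_assoc]

theorem val_blockSwap_castAdd {a b : ℕ} (i : Fin a) :
    (blockSwap a b (Fin.castAdd b i) : ℕ) = i + b := by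
  rw [blockSwap, val_finRotate_pow, Fin.val_castAdd, Nat.mod_eq_of_lt]
  have := i.2
  omega

theorem val_blockSwap_natAdd {a b : ℕ} (i : Fin b) :
    (blockSwap a b (Fin.natAdd a i) : ℕ) = i := by
  have := i.2
  rw [blockSwap, val_finRotate_pow, Fin.val_natAdd,
    show a + (i : ℕ) + b = i + (a + b) by omega, Nat.add_mod_right, Nat.mod_eq_of_lt (by omega)]

/-- A cycle of length `a + b` has sign `(-1)^(a+b-1)`, and `(a+b-1) b` has the parity of `a b`
because `b (b-1)` is even. -/
theorem rsign_blockSwap (a b : ℕ) : rsign (blockSwap a b) = (-1) ^ (a * b) := by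
  have h : Even ((a + b - 1) * b) ↔ Even (a * b) := by
    rcases Nat.eq_zero_or_pos b with rfl | hb
    · simp
    · obtain ⟨b, rfl⟩ : ∃ b', b = b' + 1 := ⟨b - 1, by omega⟩
      simp only [Nat.even_mul, Nat.even_add_one, show a + (b + 1) - 1 = a + b by omega,
        Nat.even_add]
      tauto
  simp only [rsign, blockSwap, map_pow, sign_finRotate, ← pow_mul]
  push_cast
  by_cases h' : Even (a * b)
  · rw [(h.2 h').neg_one_pow, h'.neg_one_pow]
  · rw [Nat.not_even_iff_odd] at h'
    rw [(Nat.not_even_iff_odd.1 fun h'' => by simp_all [← Nat.not_even_iff_odd]).neg_one_pow,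
      h'.neg_one_pow]

end AltSum

/-! ### Leibniz rules on a vector space -/

section BlockPerm

/-- The permutation of `Fin N` which exchanges the consecutive blocks of lengths `a` and `b`. -/
def blockPerm {a b c N : ℕ} (h : a + b + c = N) : Equiv.Perm (Fin N) :=
  (finCongr h).permCongr (permLeft (a + b) c (blockSwap a b))

theorem rsign_blockPerm {a b c N : ℕ} (h : a + b + c = N) :
    rsign (blockPerm h) = (-1) ^ (a * b) := by
  rw [← rsign_blockSwap, ← rsign_permLeft (q := c) (blockSwap a b)]
  simp [blockPerm, rsign]

theorem val_blockPerm {a b c N : ℕ} (h : a + b + c = N) (i : Fin N) :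
    (blockPerm h i : ℕ) = if (i : ℕ) < a then i + b else if (i : ℕ) < a + b then i - a else i := by
  subst h
  simp only [blockPerm, finCongr_refl, Equiv.permCongr_apply, Equiv.refl_symm, Equiv.refl_apply]
  induction i using Fin.addCases with
  | left i =>
    rw [permLeft_castAdd, Fin.val_castAdd]
    induction i using Fin.addCases with
    | left i => simp [val_blockSwap_castAdd]
    | right i => simp [val_blockSwap_natAdd]
  | right i =>
    rw [permLeft_natAdd]
    simp only [Fin.val_natAdd]
    rw [if_neg (by omega), if_neg (by omega)]

end BlockPerm

section AlternatingForms

variable {V : Type*} [AddCommGroup V] [Module ℝ V] [TopologicalSpace V]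

theorem wedgeAt_eq {p q : ℕ} (α : V [⋀^Fin p]→L[ℝ] ℝ) (β : V [⋀^Fin q]→L[ℝ] ℝ)
    (v : Fin (p + q) → V) :
    wedgeAt α β v = ((p.factorial * q.factorial : ℕ) : ℝ)⁻¹ * altSum (fun w =>
      α (fun i => w (Fin.castAdd q i)) * β (fun j => w (Fin.natAdd p j))) v :=
  wedgeAt_apply α β v

theorem insAt_eq {k p : ℕ} (K : V [⋀^Fin k]→L[ℝ] V) (θ : V [⋀^Fin (p + 1)]→L[ℝ] ℝ)
    (v : Fin (k + p) → V) :
    insAt K θ v = ((k.factorial * p.factorial : ℕ) : ℝ)⁻¹ * altSum (fun w =>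
      θ (Fin.cons (K fun i => w (Fin.castAdd p i)) fun j => w (Fin.natAdd k j))) v :=
  insAt_apply K θ v

theorem alt_perm {n : ℕ} (θ : V [⋀^Fin n]→L[ℝ] ℝ) (σ : Equiv.Perm (Fin n)) (v : Fin n → V) :
    θ (fun i => v (σ i)) = rsign σ * θ v := by
  have := θ.toAlternatingMap.map_perm v σ
  rw [Units.smul_def, zsmul_eq_mul] at this
  exact this

theorem altSum_alt {n : ℕ} (θ : V [⋀^Fin n]→L[ℝ] ℝ) (v : Fin n → V) :
    altSum θ v = n.factorial * θ v := by
  simp only [altSum, alt_perm, ← mul_assoc, rsign_mul_self]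
  simp [Fintype.card_perm]

end AlternatingForms

section Leibniz

variable {V : Type*} [NormedAddCommGroup V] [NormedSpace ℝ V]

/-- An alternating form is its own alternation divided by `(n+1)!`. Each of the `n + 1` terms of the
left side alternates to the same sum, since bringing slot `i` to the front is a cycle of sign
`(-1)^i`, which cancels the coefficient. This turns `d` into a full alternation, comparable with the
wedge product. -/
theorem alternatizeUncurryFin_eq {n : ℕ} (A : V →L[ℝ] V [⋀^Fin n]→L[ℝ] ℝ)
    (v : Fin (n + 1) → V) :
    ContinuousAlternatingMap.alternatizeUncurryFin A v =
      (n.factorial : ℝ)⁻¹ * altSum (fun w => A (w 0) (Fin.tail w)) v := by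
  have h1 := altSum_alt (ContinuousAlternatingMap.alternatizeUncurryFin A) v
  have h2 : ∀ i : Fin (n + 1), altSum (fun w : Fin (n + 1) → V =>
      (-1 : ℝ) ^ (i : ℕ) * A (w i) (i.removeNth w)) v =
      altSum (fun w => A (w 0) (Fin.tail w)) v := by
    intro i
    have h3 := altSum_perm i.cycleRange.symm (fun w : Fin (n + 1) → V => A (w 0) (Fin.tail w)) v
    have h4 : rsign i.cycleRange.symm = (-1) ^ (i : ℕ) := by
      simp [rsign, Equiv.Perm.sign_symm, Fin.sign_cycleRange]
    have h5 : (fun w : Fin (n + 1) → V => A (w (i.cycleRange.symm 0))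
        (Fin.tail fun j => w (i.cycleRange.symm j))) = fun w => A (w i) (i.removeNth w) := by
      funext w
      rw [Fin.cycleRange_symm_zero]
      congr 1
      funext j
      simp [Fin.tail, Fin.removeNth]
    rw [h5] at h3
    rw [altSum_mul_left, h3, h4, ← mul_assoc, ← mul_pow]
    simp
  have h6 : ⇑(ContinuousAlternatingMap.alternatizeUncurryFin A) =
      fun w => ∑ i : Fin (n + 1), (-1 : ℝ) ^ (i : ℕ) * A (w i) (i.removeNth w) := by
    funext w
    rw [ContinuousAlternatingMap.alternatizeUncurryFin_apply]
    refine Finset.sum_congr rfl fun i _ => ?_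
    rw [zsmul_eq_mul]
    push_cast
    rfl
  rw [h6, altSum_sum] at h1
  simp only [h2, Finset.sum_const, Finset.card_univ, Fintype.card_fin, nsmul_eq_mul] at h1
  rw [Nat.factorial_succ] at h1
  have hn : (n.factorial : ℝ) ≠ 0 := by positivity
  have hn' : ((n + 1 : ℕ) : ℝ) ≠ 0 := by positivity
  push_cast at h1 hn'
  rw [mul_assoc] at h1
  have h7 := mul_left_cancel₀ hn' h1
  rw [h7, h6]
  field_simp

/-- The pointwise content of `d(α ∧ β) = dα ∧ β + (-1)^p α ∧ dβ`: `A` and `B` play the derivatives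
of `α` and `β`, and `hC` is the product rule. Every term is a multiple of a full alternation over `p
+ q + 1` arguments; in the second one the slot of differentiation has to pass the `p` arguments of
`α`. -/
theorem alternatizeUncurryFin_wedge {p q : ℕ} (A : V →L[ℝ] V [⋀^Fin p]→L[ℝ] ℝ)
    (B : V →L[ℝ] V [⋀^Fin q]→L[ℝ] ℝ) (α : V [⋀^Fin p]→L[ℝ] ℝ) (β : V [⋀^Fin q]→L[ℝ] ℝ)
    (C : V →L[ℝ] V [⋀^Fin (p + q)]→L[ℝ] ℝ)
    (hC : ∀ u, C u = wedgeAt (A u) β + wedgeAt α (B u)) (v : Fin (p + q + 1) → V) :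
    ContinuousAlternatingMap.alternatizeUncurryFin C v =
      wedgeAt (ContinuousAlternatingMap.alternatizeUncurryFin A) β
        (fun i => v (Fin.cast (by omega) i)) +
      (-1) ^ p * wedgeAt α (ContinuousAlternatingMap.alternatizeUncurryFin B) v := by
  have hp : (p.factorial : ℝ) ≠ 0 := by positivity
  have hq : (q.factorial : ℝ) ≠ 0 := by positivity
  have hp1 : ((p + 1).factorial : ℝ) ≠ 0 := by positivity
  have hq1 : ((q + 1).factorial : ℝ) ≠ 0 := by positivity
  have hpq : ((p + q).factorial : ℝ) ≠ 0 := by positivity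
  set c : ℝ := ((p.factorial * q.factorial : ℕ) : ℝ)⁻¹ with hc
  have e1 : ContinuousAlternatingMap.alternatizeUncurryFin C v =
      c * altSum (fun w : Fin (p + q + 1) → V => A (w 0) (fun i => Fin.tail w (Fin.castAdd q i)) *
        β fun j => Fin.tail w (Fin.natAdd p j)) v +
      c * altSum (fun w : Fin (p + q + 1) → V => α (fun i => Fin.tail w (Fin.castAdd q i)) *
        B (w 0) fun j => Fin.tail w (Fin.natAdd p j)) v := by
    rw [alternatizeUncurryFin_eq]
    simp only [hC, ContinuousAlternatingMap.add_apply, wedgeAt_eq, altSum_add, altSum_mul_left]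
    rw [altSum_partial_tail (fun z u => A z (fun i => u (Fin.castAdd q i)) *
      β fun j => u (Fin.natAdd p j)), altSum_partial_tail (fun z u =>
      α (fun i => u (Fin.castAdd q i)) * B z fun j => u (Fin.natAdd p j)), hc]
    push_cast
    field_simp
  have e2 : wedgeAt (ContinuousAlternatingMap.alternatizeUncurryFin A) β
        (fun i => v (Fin.cast (by omega) i)) =
      c * altSum (fun w : Fin (p + q + 1) → V => A (w 0) (fun i => Fin.tail w (Fin.castAdd q i)) *
        β fun j => Fin.tail w (Fin.natAdd p j)) v := by
    rw [wedgeAt_eq]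
    simp only [alternatizeUncurryFin_eq, mul_assoc, altSum_mul_left]
    have h := altSum_partial_left (p := p + 1) (q := q)
      (fun u w => A (u 0) (Fin.tail u) * β w) (fun i => v (Fin.cast (by omega) i))
    have h' : ∀ (F : (Fin (p + 1) → V) → ℝ) (u : Fin (p + 1) → V) (b : ℝ),
        altSum F u * b = altSum (fun w => F w * b) u := fun F u b => by
      simp only [mul_comm _ b, altSum_mul_left]
    simp only [h']
    rw [h]
    have h2 := altSum_reindex (finCongr (show p + 1 + q = p + q + 1 by omega))
      (fun w : Fin (p + 1 + q) → V => A (w (Fin.castAdd q 0))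
        (Fin.tail fun i => w (Fin.castAdd q i)) * β fun j => w (Fin.natAdd (p + 1) j)) v
    simp only [finCongr_apply] at h2
    rw [h2]
    have h3 : (fun w : Fin (p + q + 1) → V =>
        A (w (Fin.cast (by omega) (Fin.castAdd q (0 : Fin (p + 1)))))
        (Fin.tail fun i : Fin (p + 1) => w (Fin.cast (by omega) (Fin.castAdd q i))) *
        β fun j => w (Fin.cast (by omega) (Fin.natAdd (p + 1) j))) =
        fun w : Fin (p + q + 1) → V => A (w 0) (fun i => Fin.tail w (Fin.castAdd q i)) *
        β fun j => Fin.tail w (Fin.natAdd p j) := by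
      funext w
      congr 2
      · funext j
        simp only [Fin.tail]
        congr 1
        ext
        simp
        omega
    rw [h3, hc]
    push_cast
    field_simp
  have e3 : wedgeAt α (ContinuousAlternatingMap.alternatizeUncurryFin B) v = (-1) ^ p *
      (c * altSum (fun w : Fin (p + q + 1) → V => α (fun i => Fin.tail w (Fin.castAdd q i)) *
        B (w 0) fun j => Fin.tail w (Fin.natAdd p j)) v) := by
    rw [wedgeAt_eq]
    simp only [alternatizeUncurryFin_eq, mul_left_comm (α _), altSum_mul_left]
    have h := altSum_partial_right (p := p) (q := q + 1)
      (fun u w => α u * B (w 0) (Fin.tail w)) v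
    simp only [altSum_mul_left] at h
    rw [h]
    -- The slot of differentiation stands in position `p` and is wanted in position `0`; exchanging
    -- blocks of lengths `p` and `1` has sign `(-1)^p`.
    have h2 := altSum_perm (blockPerm (show p + 1 + q = p + q + 1 by omega))
      (fun w : Fin (p + (q + 1)) → V => α (fun i => w (Fin.castAdd (q + 1) i)) *
        B (w (Fin.natAdd p 0)) (Fin.tail fun j => w (Fin.natAdd p j))) v
    rw [rsign_blockPerm, mul_one] at h2
    have h3 : (fun w : Fin (p + q + 1) → V =>
        α (fun i => w (blockPerm (show p + 1 + q = p + q + 1 by omega) (Fin.castAdd (q + 1) i))) *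
        B (w (blockPerm (show p + 1 + q = p + q + 1 by omega) (Fin.natAdd p (0 : Fin (q + 1)))))
          (Fin.tail fun j => w (blockPerm (show p + 1 + q = p + q + 1 by omega)
            (Fin.natAdd p j)))) =
        fun w : Fin (p + q + 1) → V => α (fun i => Fin.tail w (Fin.castAdd q i)) *
        B (w 0) fun j => Fin.tail w (Fin.natAdd p j) := by
      funext w
      have e0 : blockPerm (show p + 1 + q = p + q + 1 by omega)
          (Fin.natAdd p (0 : Fin (q + 1))) = 0 := by
        ext
        rw [val_blockPerm]
        simp
      rw [e0]
      congr 2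
      · funext i
        simp only [Fin.tail]
        congr 1
        ext
        rw [val_blockPerm]
        simp
      · funext i
        simp only [Fin.tail]
        congr 1
        ext
        rw [val_blockPerm]
        simp only [Fin.val_natAdd, Fin.val_succ]
        rw [if_neg (by omega), if_neg (by omega)]
        omega
    rw [h3] at h2
    rw [h2, hc, show (-1 : ℝ) ^ p * (((p.factorial * q.factorial : ℕ) : ℝ)⁻¹ * ((-1) ^ p *
      altSum (fun w : Fin (p + (q + 1)) → V => α (fun i => w (Fin.castAdd (q + 1) i)) *
        B (w (Fin.natAdd p 0)) (Fin.tail fun j => w (Fin.natAdd p j))) v)) =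
      ((-1 : ℝ) ^ p * (-1) ^ p) * (((p.factorial * q.factorial : ℕ) : ℝ)⁻¹ *
      altSum (fun w : Fin (p + (q + 1)) → V => α (fun i => w (Fin.castAdd (q + 1) i)) *
        B (w (Fin.natAdd p 0)) (Fin.tail fun j => w (Fin.natAdd p j))) v) by ring,
      ← mul_pow]
    push_cast
    simp
    field_simp
  rw [e1, e2, e3, ← mul_assoc ((-1 : ℝ) ^ p), ← mul_pow]
  simp

end Leibniz

/-! ### The Leibniz rule for the insertion of a vector-valued form. -/

section InsertionLeibniz

variable {V : Type*} [AddCommGroup V] [Module ℝ V] [TopologicalSpace V]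

theorem permLeft_swap {p q : ℕ} (a b : Fin p) :
    permLeft p q (Equiv.swap a b) = Equiv.swap (Fin.castAdd q a) (Fin.castAdd q b) := by
  ext i
  induction i using Fin.addCases with
  | left i => rw [permLeft_castAdd, (Fin.castAdd_injective p q).map_swap]
  | right i =>
    rw [permLeft_natAdd, Equiv.swap_apply_of_ne_of_ne] <;>
      · rw [Ne, Fin.ext_iff]
        simp
        omega

theorem alt_cons_last {p : ℕ} (α : V [⋀^Fin (p + 1)]→L[ℝ] ℝ) (y : Fin (p + 1) → V) :
    α (Fin.cons (y (Fin.last p)) fun i => y i.castSucc) = (-1) ^ p * α y := by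
  have h : (Fin.cons (y (Fin.last p)) fun i => y i.castSucc : Fin (p + 1) → V) =
      fun i => y ((finRotate (p + 1)).symm i) := by
    funext i
    induction i using Fin.cases with
    | zero =>
      rw [Fin.cons_zero]
      exact congrArg y (by rw [Equiv.eq_symm_apply, finRotate_last])
    | succ i =>
      rw [Fin.cons_succ]
      exact congrArg y (by rw [Equiv.eq_symm_apply, finRotate_apply, Fin.coeSucc_eq_succ])
  rw [h, alt_perm]
  simp [rsign, Equiv.Perm.sign_symm, sign_finRotate]

/-- Contraction of `α ∧ β` with a vector `z`: by `altSum_cons`, `z` lands in one of `p + 1` slots of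
`α` or `q + 1` slots of `β`, and slots of the same factor contribute equally. The sign `(-1)^(p+1)`
comprises the transposition bringing `z` into `β` and the cycle putting the arguments of `α` back in
order. -/
theorem altSum_tensor_cons {p q : ℕ} (α : V [⋀^Fin (p + 1)]→L[ℝ] ℝ)
    (β : V [⋀^Fin (q + 1)]→L[ℝ] ℝ) (z : V) (v : Fin (p + 1 + q) → V) :
    altSum (fun w : Fin (p + 1 + (q + 1)) → V => α (fun i => w (Fin.castAdd (q + 1) i)) *
        β fun j => w (Fin.natAdd (p + 1) j)) (Fin.cons z v : Fin (p + 1 + q + 1) → V) =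
      (p + 1) * altSum (fun u : Fin (p + 1 + q) → V =>
        α (Fin.cons z fun i : Fin p => u ⟨i, by omega⟩) *
        β (fun j : Fin (q + 1) => u ⟨p + j, by omega⟩)) v +
      (-1) ^ (p + 1) * ((q + 1) * altSum (fun u : Fin (p + 1 + q) → V =>
        α (fun i => u (Fin.castAdd q i)) * β (Fin.cons z fun j => u (Fin.natAdd (p + 1) j))) v) := by
  set F : (Fin (p + 1 + (q + 1)) → V) → ℝ := fun w => α (fun i => w (Fin.castAdd (q + 1) i)) *
        β fun j => w (Fin.natAdd (p + 1) j) with hF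
  have hL : ∀ (τ : Equiv.Perm (Fin (p + 1))) (w : Fin (p + 1 + (q + 1)) → V),
      F (fun i => w (permLeft (p + 1) (q + 1) τ i)) = rsign τ * F w := by
    intro τ w
    simp only [hF, permLeft_castAdd, permLeft_natAdd]
    rw [alt_perm α τ fun i => w (Fin.castAdd (q + 1) i), mul_assoc]
  have hR : ∀ (τ : Equiv.Perm (Fin (q + 1))) (w : Fin (p + 1 + (q + 1)) → V),
      F (fun i => w (permRight (p + 1) (q + 1) τ i)) = rsign τ * F w := by
    intro τ w
    simp only [hF, permRight_castAdd, permRight_natAdd]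
    rw [alt_perm β τ fun i => w (Fin.natAdd (p + 1) i), mul_left_comm]
  have e1 : ∀ u : Fin (p + 1 + q) → V, F (Fin.cons z u : Fin (p + 1 + q + 1) → V) =
      α (Fin.cons z fun i : Fin p => u ⟨i, by omega⟩) *
        β (fun j : Fin (q + 1) => u ⟨p + j, by omega⟩) := by
    intro u
    simp only [hF]
    congr 2
    · funext i
      induction i using Fin.cases with
      | zero => rfl
      | succ i => rfl
    · funext j
      have : (Fin.natAdd (p + 1) j : Fin (p + 1 + (q + 1))) =
          Fin.succ (⟨p + j, by omega⟩ : Fin (p + 1 + q)) := by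
        ext
        simp
        omega
      rw [this, Fin.cons_succ]
  -- The first slot of `β`, which stands for all its slots.
  let P : Fin (p + 1 + q + 1) := Fin.natAdd (p + 1) (0 : Fin (q + 1))
  have e2 : ∀ u : Fin (p + 1 + q) → V,
      F (fun i => (Fin.cons z u : Fin (p + 1 + q + 1) → V) (Equiv.swap 0 P i)) =
      (-1) ^ p * (α (fun i => u (Fin.castAdd q i)) *
        β (Fin.cons z fun j => u (Fin.natAdd (p + 1) j))) := by
    intro u
    rw [← mul_assoc, ← alt_cons_last α]
    simp only [hF]
    congr 2
    · funext i
      induction i using Fin.cases with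
      | zero =>
        have : (Fin.castAdd (q + 1) (0 : Fin (p + 1)) : Fin (p + 1 + q + 1)) = 0 := rfl
        rw [this, Equiv.swap_apply_left]
        rfl
      | succ i =>
        rw [Equiv.swap_apply_of_ne_of_ne]
        · rfl
        · simp [Fin.ext_iff]
        · have := i.2
          simp [Fin.ext_iff, P]
          omega
    · funext j
      induction j using Fin.cases with
      | zero =>
        change (Fin.cons z u : Fin (p + 1 + q + 1) → V) (Equiv.swap 0 P P) = _
        rw [Equiv.swap_apply_right]
        rfl
      | succ j =>
        rw [Equiv.swap_apply_of_ne_of_ne]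
        · rfl
        · simp [Fin.ext_iff]
        · simp [Fin.ext_iff, P]
  have s1 : ∀ i : Fin (p + 1), rsign (Equiv.swap (0 : Fin (p + 1 + q + 1)) (Fin.castAdd (q + 1) i)) *
      altSum (fun u => F fun j => (Fin.cons z u : Fin (p + 1 + q + 1) → V)
        (Equiv.swap 0 (Fin.castAdd (q + 1) i) j)) v =
      altSum (fun u => F (Fin.cons z u : Fin (p + 1 + q + 1) → V)) v := by
    intro i
    have h : Equiv.swap (0 : Fin (p + 1 + q + 1)) (Fin.castAdd (q + 1) i) =
        permLeft (p + 1) (q + 1) (Equiv.swap 0 i) := (permLeft_swap (q := q + 1) 0 i).symm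
    rw [h]
    simp only [hL, altSum_mul_left]
    rw [rsign_permLeft, ← mul_assoc, rsign_mul_self, one_mul]
  have s2 : ∀ j : Fin (q + 1), rsign (Equiv.swap (0 : Fin (p + 1 + q + 1)) (Fin.natAdd (p + 1) j)) *
      altSum (fun u => F fun i => (Fin.cons z u : Fin (p + 1 + q + 1) → V)
        (Equiv.swap 0 (Fin.natAdd (p + 1) j) i)) v =
      - altSum (fun u => F fun i => (Fin.cons z u : Fin (p + 1 + q + 1) → V)
        (Equiv.swap 0 P i)) v := by
    intro j
    -- A permutation inside the block of `β` carries `P` to the slot `j`. It fixes slot `0`, so it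
    -- descends to a permutation `s'` of the entries of `u`, which is absorbed by the alternation
    -- over `u`.
    let s : Equiv.Perm (Fin (p + 1 + q + 1)) := permRight (p + 1) (q + 1) (Equiv.swap 0 j)
    have hs0 : s 0 = 0 := permRight_castAdd (Equiv.swap 0 j) (0 : Fin (p + 1))
    have hsP : s P = Fin.natAdd (p + 1) j := by
      have := permRight_natAdd (p := p + 1) (Equiv.swap 0 j) 0
      rwa [Equiv.swap_apply_left] at this
    have hc : ∀ i, Equiv.swap 0 (Fin.natAdd (p + 1) j) (s i) = s (Equiv.swap 0 P i) := by
      intro i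
      have h := Equiv.mul_swap_eq_swap_mul s 0 P
      rw [hs0, hsP] at h
      exact (DFunLike.congr_fun h i).symm
    let s' := (Equiv.Perm.decomposeFin s).2
    have hs : s = Equiv.Perm.decomposeFin.symm (0, s') := by
      rw [Equiv.eq_symm_apply]
      refine Prod.ext ?_ rfl
      have h := Equiv.Perm.decomposeFin_symm_apply_zero (Equiv.Perm.decomposeFin s).1 s'
      rw [← h]
      change Equiv.Perm.decomposeFin.symm (Equiv.Perm.decomposeFin s) 0 = 0
      rw [Equiv.symm_apply_apply, hs0]
    have hs' : rsign s' = rsign (Equiv.swap 0 j) := by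
      rw [← rsign_decomposeFin_zero, ← hs]
      exact rsign_permRight _
    have hcons : ∀ (u : Fin (p + 1 + q) → V) (i : Fin (p + 1 + q + 1)),
        (Fin.cons z u : Fin (p + 1 + q + 1) → V) (s i) =
          (Fin.cons z (fun i => u (s' i)) : Fin (p + 1 + q + 1) → V) i := by
      intro u i
      rw [hs]
      induction i using Fin.cases <;> simp
    have h1 : ∀ u : Fin (p + 1 + q) → V, (F fun i => (Fin.cons z u : Fin (p + 1 + q + 1) → V)
        (Equiv.swap 0 (Fin.natAdd (p + 1) j) i)) = rsign (Equiv.swap 0 j) *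
        F fun i => (Fin.cons z (fun i => u (s' i)) : Fin (p + 1 + q + 1) → V)
          (Equiv.swap 0 P i) := by
      intro u
      have h := hR (Equiv.swap 0 j) fun i => (Fin.cons z u : Fin (p + 1 + q + 1) → V)
        (Equiv.swap 0 (Fin.natAdd (p + 1) j) i)
      have h' : (fun i => (Fin.cons z u : Fin (p + 1 + q + 1) → V)
          (Equiv.swap 0 (Fin.natAdd (p + 1) j) (s i))) =
          fun i => (Fin.cons z (fun i => u (s' i)) : Fin (p + 1 + q + 1) → V)
            (Equiv.swap 0 P i) := by
        funext i
        rw [hc, hcons]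
      change F (fun i => (Fin.cons z u : Fin (p + 1 + q + 1) → V)
          (Equiv.swap 0 (Fin.natAdd (p + 1) j) (s i))) = _ at h
      refine Eq.trans ?_
        (congrArg (rsign (Equiv.swap 0 j) * ·) ((congrArg F h').symm.trans h)).symm
      rw [← mul_assoc, rsign_mul_self, one_mul]
    simp only [h1, altSum_mul_left]
    rw [altSum_perm s' (fun u => F fun i => (Fin.cons z u : Fin (p + 1 + q + 1) → V)
          (Equiv.swap 0 P i)), hs', ← mul_assoc (rsign _) (rsign _) (altSum _ _),
      rsign_mul_self, one_mul]
    have : rsign (Equiv.swap (0 : Fin (p + 1 + q + 1)) (Fin.natAdd (p + 1) j)) = -1 := by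
      rw [rsign, Equiv.Perm.sign_swap]
      · simp
      · simp [Fin.ext_iff]
        omega
    rw [this, neg_one_mul]
  rw [altSum_cons]
  have hsum := Fin.sum_univ_add (fun j : Fin (p + 1 + (q + 1)) =>
    rsign (Equiv.swap (0 : Fin (p + 1 + q + 1)) j) *
      altSum (fun u => F fun i => (Fin.cons z u : Fin (p + 1 + q + 1) → V)
        (Equiv.swap 0 j i)) v)
  refine hsum.trans ?_
  simp only [s1, s2, e1, e2, altSum_mul_left, Finset.sum_const, Finset.card_univ,
    Fintype.card_fin, nsmul_eq_mul]
  push_cast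
  ring

/-- Apply `altSum_tensor_cons` with `z` a value of `K`. In the term where `z` enters `β`, the `k`
arguments of `K` are moved past the `p + 1` arguments of `α`; this sign `(-1)^(k(p+1))` and the sign
`(-1)^(p+1)` of the contraction make up `(-1)^((k+1)(p+1))`, as for an operator of degree `k - 1`.
-/
theorem insAt_wedgeAt {k p q : ℕ} (K : V [⋀^Fin k]→L[ℝ] V) (α : V [⋀^Fin (p + 1)]→L[ℝ] ℝ)
    (β : V [⋀^Fin (q + 1)]→L[ℝ] ℝ) (v : Fin (k + (p + 1 + q)) → V) :
    insAt (p := p + 1 + q) K (wedgeAt α β : V [⋀^Fin (p + 1 + (q + 1))]→L[ℝ] ℝ) v =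
      wedgeAt (insAt K α) β (fun i => v (Fin.cast (by omega) i)) +
      (-1) ^ ((k + 1) * (p + 1)) * wedgeAt α (insAt K β) (fun i => v (Fin.cast (by omega) i)) := by
  have hp : (p.factorial : ℝ) ≠ 0 := by positivity
  have hq : (q.factorial : ℝ) ≠ 0 := by positivity
  have hk : (k.factorial : ℝ) ≠ 0 := by positivity
  have hp1 : ((p + 1).factorial : ℝ) ≠ 0 := by positivity
  have hq1 : ((q + 1).factorial : ℝ) ≠ 0 := by positivity
  have hkp : ((k + p).factorial : ℝ) ≠ 0 := by positivity
  have hkq : ((k + q).factorial : ℝ) ≠ 0 := by positivity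
  have hpq : ((p + 1 + q).factorial : ℝ) ≠ 0 := by positivity
  set S₁ := altSum (fun w : Fin (k + (p + 1 + q)) → V =>
    α (Fin.cons (K fun i => w (Fin.castAdd _ i)) fun i : Fin p => w ⟨k + i, by omega⟩) *
      β fun j : Fin (q + 1) => w ⟨k + (p + j), by omega⟩) v with hS₁
  set S₂ := altSum (fun w : Fin (k + (p + 1 + q)) → V =>
    α (fun i : Fin (p + 1) => w ⟨k + i, by omega⟩) *
      β (Fin.cons (K fun i => w (Fin.castAdd _ i)) fun j : Fin q => w ⟨k + (p + 1 + j), by omega⟩)) v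
    with hS₂
  have e1 : insAt (p := p + 1 + q) K (wedgeAt α β : V [⋀^Fin (p + 1 + (q + 1))]→L[ℝ] ℝ) v =
      ((k.factorial : ℝ) * p.factorial * (q + 1).factorial)⁻¹ * S₁ +
      (-1) ^ (p + 1) * (((k.factorial : ℝ) * (p + 1).factorial * q.factorial)⁻¹ * S₂) := by
    rw [insAt_eq]
    have h : ∀ w : Fin (k + (p + 1 + q)) → V,
        wedgeAt α β (Fin.cons (K fun i => w (Fin.castAdd _ i)) fun j => w (Fin.natAdd k j) :
          Fin (p + 1 + q + 1) → V) = _ := fun w =>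
      (wedgeAt_eq α β _).trans (congrArg _ (altSum_tensor_cons α β _ _))
    simp only [h, altSum_mul_left, altSum_add]
    rw [altSum_partial_right (fun (a : Fin k → V) (u : Fin (p + 1 + q) → V) =>
        α (Fin.cons (K a) fun i : Fin p => u ⟨i, by omega⟩) *
        β (fun j : Fin (q + 1) => u ⟨p + j, by omega⟩)),
      altSum_partial_right (fun (a : Fin k → V) (u : Fin (p + 1 + q) → V) =>
        α (fun i => u (Fin.castAdd q i)) * β (Fin.cons (K a) fun j => u (Fin.natAdd (p + 1) j)))]
    have h1 : altSum (fun w : Fin (k + (p + 1 + q)) → V =>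
        α (Fin.cons (K fun i => w (Fin.castAdd _ i)) fun i : Fin p =>
          w (Fin.natAdd k ⟨i, by omega⟩)) *
        β (fun j : Fin (q + 1) => w (Fin.natAdd k ⟨p + j, by omega⟩))) v = S₁ := rfl
    have h2 : altSum (fun w : Fin (k + (p + 1 + q)) → V =>
        α (fun i => w (Fin.natAdd k (Fin.castAdd q i))) *
        β (Fin.cons (K fun i => w (Fin.castAdd _ i)) fun j =>
          w (Fin.natAdd k (Fin.natAdd (p + 1) j)))) v = S₂ := rfl
    rw [h1, h2, Nat.factorial_succ p, Nat.factorial_succ q]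
    push_cast
    field_simp
  have e2 : wedgeAt (insAt K α) β (fun i => v (Fin.cast (by omega) i)) =
      ((k.factorial : ℝ) * p.factorial * (q + 1).factorial)⁻¹ * S₁ := by
    rw [wedgeAt_eq]
    simp only [insAt_eq, mul_assoc, altSum_mul_left]
    have h := altSum_partial_left (p := k + p) (q := q + 1)
      (fun u w => α (Fin.cons (K fun i => u (Fin.castAdd _ i)) fun j => u (Fin.natAdd k j)) * β w)
      (fun i => v (Fin.cast (by omega) i))
    have h' : ∀ (F : (Fin (k + p) → V) → ℝ) (u : Fin (k + p) → V) (b : ℝ),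
        altSum F u * b = altSum (fun w => F w * b) u := fun F u b => by
      simp only [mul_comm _ b, altSum_mul_left]
    simp only [h']
    rw [h]
    have h2 := altSum_reindex (finCongr (show k + p + (q + 1) = k + (p + 1 + q) by omega))
      (fun w : Fin (k + p + (q + 1)) → V =>
        α (Fin.cons (K fun i => w (Fin.castAdd _ (Fin.castAdd _ i)))
          fun j => w (Fin.castAdd _ (Fin.natAdd k j))) * β fun j => w (Fin.natAdd (k + p) j)) v
    simp only [finCongr_apply] at h2
    rw [h2]
    have h3 : (fun w : Fin (k + (p + 1 + q)) → V =>
        α (Fin.cons (K fun i => w (Fin.cast (by omega) (Fin.castAdd (q + 1) (Fin.castAdd p i))))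
          fun j => w (Fin.cast (by omega) (Fin.castAdd (q + 1) (Fin.natAdd k j)))) *
        β fun j => w (Fin.cast (by omega) (Fin.natAdd (k + p) j))) =
        fun w : Fin (k + (p + 1 + q)) → V =>
        α (Fin.cons (K fun i => w (Fin.castAdd _ i)) fun i : Fin p => w ⟨k + i, by omega⟩) *
          β fun j : Fin (q + 1) => w ⟨k + (p + j), by omega⟩ := by
      funext w
      congr 2
      funext j
      congr 1
      ext
      simp
      omega
    rw [h3, ← hS₁]
    push_cast
    field_simp
  have e3 : wedgeAt α (insAt K β) (fun i => v (Fin.cast (by omega) i)) =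
      (-1) ^ ((p + 1) * k) *
      (((k.factorial : ℝ) * (p + 1).factorial * q.factorial)⁻¹ * S₂) := by
    rw [wedgeAt_eq]
    simp only [insAt_eq, mul_left_comm (α _), altSum_mul_left]
    have h := altSum_partial_right (p := p + 1) (q := k + q)
      (fun u w => α u * β (Fin.cons (K fun i => w (Fin.castAdd _ i)) fun j => w (Fin.natAdd k j)))
      (fun i => v (Fin.cast (by omega) i))
    simp only [altSum_mul_left] at h
    rw [h]
    have h2 := altSum_reindex (finCongr (show p + 1 + (k + q) = k + (p + 1 + q) by omega))
      (fun w : Fin (p + 1 + (k + q)) → V => α (fun i => w (Fin.castAdd _ i)) *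
        β (Fin.cons (K fun i => w (Fin.natAdd (p + 1) (Fin.castAdd _ i)))
          fun j => w (Fin.natAdd (p + 1) (Fin.natAdd k j)))) v
    simp only [finCongr_apply] at h2
    rw [h2]
    -- The arguments of `α` come first here, whereas `S₂` has those of `K` first.
    have h3 := altSum_perm (blockPerm (show p + 1 + k + q = k + (p + 1 + q) by omega))
      (fun w : Fin (k + (p + 1 + q)) → V =>
        α (fun i => w (Fin.cast (show p + 1 + (k + q) = k + (p + 1 + q) by omega)
          (Fin.castAdd (k + q) i))) *
        β (Fin.cons (K fun i => w (Fin.cast (show p + 1 + (k + q) = k + (p + 1 + q) by omega)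
            (Fin.natAdd (p + 1) (Fin.castAdd q i))))
          fun j => w (Fin.cast (show p + 1 + (k + q) = k + (p + 1 + q) by omega)
            (Fin.natAdd (p + 1) (Fin.natAdd k j))))) v
    rw [rsign_blockPerm] at h3
    have h4 : (fun w : Fin (k + (p + 1 + q)) → V =>
        α (fun i => w (blockPerm (show p + 1 + k + q = k + (p + 1 + q) by omega)
          (Fin.cast (show p + 1 + (k + q) = k + (p + 1 + q) by omega) (Fin.castAdd (k + q) i)))) *
        β (Fin.cons (K fun i => w (blockPerm (show p + 1 + k + q = k + (p + 1 + q) by omega)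
          (Fin.cast (show p + 1 + (k + q) = k + (p + 1 + q) by omega)
            (Fin.natAdd (p + 1) (Fin.castAdd q i)))))
          fun j => w (blockPerm (show p + 1 + k + q = k + (p + 1 + q) by omega)
          (Fin.cast (show p + 1 + (k + q) = k + (p + 1 + q) by omega)
            (Fin.natAdd (p + 1) (Fin.natAdd k j)))))) =
        fun w : Fin (k + (p + 1 + q)) → V => α (fun i : Fin (p + 1) => w ⟨k + i, by omega⟩) *
          β (Fin.cons (K fun i => w (Fin.castAdd _ i))
            fun j : Fin q => w ⟨k + (p + 1 + j), by omega⟩) := by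
      funext w
      congr 2
      · funext i
        congr 1
        ext
        rw [val_blockPerm]
        have := i.2
        simp only [Fin.val_cast, Fin.val_castAdd]
        rw [if_pos this]
        omega
      · congr 1
        · congr 1
          funext i
          congr 1
          ext
          rw [val_blockPerm]
          have := i.2
          simp only [Fin.val_cast, Fin.val_castAdd, Fin.val_natAdd]
          rw [if_neg (by omega), if_pos (by omega)]
          omega
        · funext j
          congr 1
          ext
          rw [val_blockPerm]
          have := j.2
          simp only [Fin.val_cast, Fin.val_natAdd]
          rw [if_neg (by omega), if_neg (by omega)]
          omega
    rw [h4, ← hS₂] at h3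
    rw [h3]
    have hsq : ((-1 : ℝ) ^ ((p + 1) * k)) * (-1) ^ ((p + 1) * k) = 1 := by
      rw [← mul_pow]; simp
    generalize altSum (fun w : Fin (k + (p + 1 + q)) → V =>
        α (fun i => w (Fin.cast (show p + 1 + (k + q) = k + (p + 1 + q) by omega)
          (Fin.castAdd (k + q) i))) *
        β (Fin.cons (K fun i => w (Fin.cast (show p + 1 + (k + q) = k + (p + 1 + q) by omega)
            (Fin.natAdd (p + 1) (Fin.castAdd q i))))
          fun j => w (Fin.cast (show p + 1 + (k + q) = k + (p + 1 + q) by omega)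
            (Fin.natAdd (p + 1) (Fin.natAdd k j))))) v = S
    rw [show (-1 : ℝ) ^ ((p + 1) * k) * (((k.factorial : ℝ) * (p + 1).factorial * q.factorial)⁻¹ *
      ((-1) ^ ((p + 1) * k) * S)) = ((-1 : ℝ) ^ ((p + 1) * k) * (-1) ^ ((p + 1) * k)) *
      (((k.factorial : ℝ) * (p + 1).factorial * q.factorial)⁻¹ * S) by ring, hsq]
    push_cast
    field_simp
  have hs : (-1 : ℝ) ^ ((k + 1) * (p + 1)) * (-1) ^ ((p + 1) * k) = (-1) ^ (p + 1) := by
    rw [← pow_add, show (k + 1) * (p + 1) + (p + 1) * k = (p + 1) + 2 * ((p + 1) * k) by ring,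
      pow_add, pow_mul]
    simp
  rw [e1, e2, e3, ← mul_assoc ((-1 : ℝ) ^ ((k + 1) * (p + 1))), hs]

end InsertionLeibniz

/-! ### Signs and graded pieces -/

theorem sgn_add (a b : ℤ) : sgn (a + b) = sgn a * sgn b := by
  simp [sgn, Int.negOnePow_add]

@[simp] theorem sgn_natCast (n : ℕ) : sgn n = (-1) ^ n := by
  simp [sgn, Int.negOnePow_def]

@[simp] theorem sgn_zero : sgn 0 = 1 := by simp [sgn]

@[simp] theorem sgn_one : sgn 1 = -1 := by simp [sgn]

theorem sgn_mul_self (a : ℤ) : sgn a * sgn a = 1 := by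
  rw [← sgn_add]
  simp [sgn, Int.negOnePow_even _ (Even.add_self a)]

theorem sgn_sub (a b : ℤ) : sgn (a - b) = sgn a * sgn b := by
  simp [sgn, Int.negOnePow_sub]

section Graded

variable {X : Mfd.{u}}

theorem Form.ext {q : ℕ} {α β : Form X q} (h : ∀ x v, α.1 x v = β.1 x v) : α = β :=
  Subtype.ext (funext fun x => ContinuousAlternatingMap.ext (h x))

@[simp] theorem fromForms_homog {C : Type*} [AddCommGroup C] [Module ℝ C]
    (f : ∀ q, Form X q →ₗ[ℝ] C) (q : ℕ) (α : Form X q) : fromForms f (homog q α) = f q α :=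
  DirectSum.toModule_lof ℝ q α

@[simp] theorem comp_homog (q : ℕ) (α : Form X q) : comp q (homog q α) = α :=
  DirectSum.component.lof_self ℝ q α

theorem comp_homog_ne {q r : ℕ} (h : q ≠ r) (α : Form X q) : comp r (homog q α) = 0 :=
  (DirectSum.component.of ℝ r q α).trans (dif_neg h)

theorem Forms.ext {a b : Forms X} (h : ∀ q, comp q a = comp q b) : a = b :=
  DFinsupp.ext h

theorem Forms.hom_ext {C : Type*} [AddCommGroup C] [Module ℝ C] {f g : Forms X →ₗ[ℝ] C}
    (h : ∀ q (α : Form X q), f (homog q α) = g (homog q α)) : f = g :=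
  DirectSum.linearMap_ext ℝ fun q => LinearMap.ext (h q)

theorem homog_injective (q : ℕ) : Function.Injective (homog (X := X) q) := fun a b h => by
  rw [← comp_homog q a, h, comp_homog]

/-- Forms whose degrees are only propositionally equal, such as `0 + q` and `q`, are compared inside
`Forms X`. -/
theorem homog_eq_homog {m n : ℕ} (h : m = n) {α : Form X m} {β : Form X n}
    (hv : ∀ x v, α.1 x (fun i => v (Fin.cast h i)) = β.1 x v) : homog m α = homog n β := by
  subst h
  exact congrArg _ (Form.ext hv)

/-- Transport of a form along an equality of degrees. -/
def castForm {m n : ℕ} (h : m = n) (α : Form X m) : Form X n := h ▸ α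

@[simp] theorem homog_castForm {m n : ℕ} (h : m = n) (α : Form X m) :
    homog n (castForm h α) = homog m α := by
  subst h
  rfl

theorem localForm_castForm {m n : ℕ} (h : m = n) (α : Form X m) (x : X) (y : X.Model)
    (v : Fin n → X.Model) :
    localForm (castForm h α).1 x y v = localForm α.1 x y fun i => v (Fin.cast h i) := by
  subst h
  rfl

/-- `a` has degree `m`. -/
def IsHomog (m : ℤ) (a : Forms X) : Prop := ∀ r : ℕ, (r : ℤ) ≠ m → comp r a = 0

theorem IsHomog.exists_eq {q : ℕ} {a : Forms X} (h : IsHomog (q : ℤ) a) :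
    a = homog q (comp q a) := by
  refine Forms.ext fun r => ?_
  by_cases hr : q = r
  · subst hr; rw [comp_homog]
  · rw [comp_homog_ne hr, h r fun h' => hr (by exact_mod_cast h'.symm)]

/-- Integer degrees make it possible to speak of the degree `m + l` of `D a` when it is negative;
there is then nothing but zero. -/
theorem IsHomog.eq_zero {m : ℤ} (hm : m < 0) {a : Forms X} (h : IsHomog m a) : a = 0 :=
  Forms.ext fun r => by rw [h r (by omega), map_zero]

theorem isHomog_homog (q : ℕ) (α : Form X q) : IsHomog (q : ℤ) (homog q α) := fun r hr =>
  comp_homog_ne (fun h => hr (by rw [h])) α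

@[simp] theorem dR_homog (q : ℕ) (α : Form X q) : dR X (homog q α) = homog (q + 1) (extD X q α) :=
  fromForms_homog _ _ _

@[simp] theorem wedgeProd_homog {p q : ℕ} (α : Form X p) (β : Form X q) :
    wedgeProd X (homog p α) (homog q β) = homog (p + q) (wedge X p q α β) := by
  rw [wedgeProd, fromForms_homog, LinearMap.flip_apply, fromForms_homog]
  rfl

@[simp] theorem pull_homog {Y : Mfd.{u}} (f : SMap X Y) (q : ℕ) (α : Form Y q) :
    pull f (homog q α) = homog q (pullback f q α) := fromForms_homog _ _ _

@[simp] theorem degSign_homog (q : ℕ) (α : Form X q) :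
    degSign X (homog q α) = sgn q • homog q α := fromForms_homog _ _ _

@[simp] theorem insertion_homog_zero {k : ℕ} (K : VForm X k) (α : Form X 0) :
    insertion K (homog 0 α) = 0 := fromForms_homog _ _ _

@[simp] theorem insertion_homog_succ {k : ℕ} (K : VForm X k) (p : ℕ) (α : Form X (p + 1)) :
    insertion K (homog (p + 1) α) = homog (k + p) (ins K p α) := fromForms_homog _ _ _

/-- The product of a function and a form. -/
def mulForm {q : ℕ} (f : Form X 0) (β : Form X q) : Form X q :=
  ⟨fun x => (f.1 x 0) • β.1 x, fun x => by
    have h : ContDiffOn ℝ ∞ (fun y => localForm f.1 x y 0) (X.chart x).target := fun y hy =>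
      ((ContinuousAlternatingMap.apply ℝ X.Model ℝ (0 : Fin 0 → X.Model)).contDiff.contDiffAt.comp y
        ((f.2 x).contDiffAt ((X.chart x).open_target.mem_nhds hy))).contDiffWithinAt
    refine (h.smul (β.2 x)).congr fun y _ => ?_
    ext v
    change f.1 _ 0 • β.1 _ _ = f.1 _ _ • β.1 _ _
    congr 2
    exact Subsingleton.elim _ _⟩

theorem wedgeAt_zero_left {V : Type*} [AddCommGroup V] [Module ℝ V] [TopologicalSpace V] {q : ℕ}
    (f : V [⋀^Fin 0]→L[ℝ] ℝ) (β : V [⋀^Fin q]→L[ℝ] ℝ) (v : Fin (0 + q) → V) :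
    wedgeAt f β v = f 0 * β (fun i => v (Fin.cast (by omega) i)) := by
  have h : ∀ w : Fin 0 → V, f w = f 0 := fun w => congrArg f (Subsingleton.elim _ _)
  have h1 := altSum_reindex (finCongr (show q = 0 + q by omega)) β v
  have h2 : (fun w : Fin (0 + q) → V => β fun j => w (Fin.natAdd 0 j)) =
      fun w => β fun i => w (finCongr (show q = 0 + q by omega) i) := by
    funext w
    congr 1
    funext i
    congr 1
    ext
    simp
  rw [wedgeAt_eq]
  simp only [h, altSum_mul_left]
  rw [h2, ← h1, altSum_alt]
  have : (q.factorial : ℝ) ≠ 0 := by positivity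
  simp
  field_simp

theorem wedgeAt_zero_right {V : Type*} [AddCommGroup V] [Module ℝ V] [TopologicalSpace V] {q : ℕ}
    (α : V [⋀^Fin q]→L[ℝ] ℝ) (f : V [⋀^Fin 0]→L[ℝ] ℝ) (v : Fin (q + 0) → V) :
    wedgeAt α f v = f 0 * α v := by
  have h : ∀ w : Fin 0 → V, f w = f 0 := fun w => congrArg f (Subsingleton.elim _ _)
  rw [wedgeAt_eq]
  simp only [h, mul_comm _ (f 0), altSum_mul_left]
  have h2 : altSum (fun w : Fin (q + 0) → V => α fun i => w (Fin.castAdd 0 i)) v = _ :=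
    altSum_alt α v
  rw [h2]
  have : (q.factorial : ℝ) ≠ 0 := by positivity
  simp
  field_simp

@[simp] theorem wedgeProd_function {q : ℕ} (f : Form X 0) (β : Form X q) :
    wedgeProd X (homog 0 f) (homog q β) = homog q (mulForm f β) := by
  rw [wedgeProd_homog]
  refine homog_eq_homog (zero_add q) fun x v => ?_
  exact wedgeAt_zero_left _ _ _

@[simp] theorem wedgeProd_function_right {q : ℕ} (f : Form X 0) (β : Form X q) :
    wedgeProd X (homog q β) (homog 0 f) = homog q (mulForm f β) := by
  rw [wedgeProd_homog]
  refine homog_eq_homog (add_zero q) fun x v => ?_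
  exact wedgeAt_zero_right _ _ _

end Graded

/-! ### The exterior derivative, pullbacks and insertions -/

section Operators

variable {X Y : Mfd.{u}}

theorem dchart_dchartSymm (x : X) {y : X.Model} (hy : y ∈ (X.chart x).target) (v : X.Model) :
    X.dchart x ((X.chart x).symm y) (X.dchartSymm x y v) = v := by
  have h := (mdifferentiable_chart (I := 𝓘(ℝ, X.Model)) x).comp_symm_deriv hy
  exact DFunLike.congr_fun h v

theorem dchartSymm_surjective (x : X) {y : X.Model} (hy : y ∈ (X.chart x).target) :
    Function.Surjective (X.dchartSymm x y) := fun v => ⟨_, dchartSymm_dchart x hy v⟩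

/-- Forms agree at a point if their chart expressions do. -/
theorem eq_of_localForm_eq {q : ℕ} {θ η : RawForm X q} (x : X) {y : X.Model}
    (hy : y ∈ (X.chart x).target) (h : localForm θ x y = localForm η x y) :
    θ ((X.chart x).symm y) = η ((X.chart x).symm y) := by
  ext v
  choose w hw using fun i => dchartSymm_surjective x hy (v i)
  have := DFunLike.congr_fun h w
  simp only [localForm, ContinuousAlternatingMap.compContinuousLinearMap_apply] at this
  convert this using 2 <;> exact funext fun i => (hw i).symm

theorem eq_of_localForm_eq_self {q : ℕ} {θ η : RawForm X q} (x : X)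
    (h : localForm θ x (X.chart x x) = localForm η x (X.chart x x)) : θ x = η x := by
  have h1 := eq_of_localForm_eq x (mem_chart_target _ x) h
  rwa [(X.chart x).left_inv (mem_chart_source _ x)] at h1

theorem Form.ext_local {q : ℕ} {α β : Form X q}
    (h : ∀ x, localForm α.1 x (X.chart x x) = localForm β.1 x (X.chart x x)) : α = β :=
  Subtype.ext (funext fun x => eq_of_localForm_eq_self x (h x))

theorem Form.contDiffAt_localForm {q : ℕ} (α : Form X q) (x : X) {y : X.Model}
    (hy : y ∈ (X.chart x).target) : ContDiffAt ℝ ∞ (localForm α.1 x) y :=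
  (α.2 x).contDiffAt ((X.chart x).open_target.mem_nhds hy)

theorem minSmoothness_le_infty : minSmoothness ℝ 2 ≤ ∞ := by
  rw [minSmoothness_of_isRCLikeNormedField]
  exact WithTop.coe_le_coe.2 (le_top : (2 : ℕ∞) ≤ ⊤)

theorem extD_extD (q : ℕ) (α : Form X q) : extD X (q + 1) (extD X q α) = 0 := by
  refine Form.ext_local fun x => ?_
  have hx := mem_chart_target X.Model x
  have h1 : localForm (extD X (q + 1) (extD X q α)).1 x (X.chart x x) =
      extDeriv (localForm (extD X q α).1 x) (X.chart x x) := localForm_rawD (extD X q α).2 x hx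
  -- At each point `rawD` is defined in the chart at that point. To differentiate again, its
  -- expression in the fixed chart at `x` is needed on a neighbourhood, which is what
  -- `localForm_rawD` supplies.
  have h2 : localForm (extD X q α).1 x =ᶠ[𝓝 (X.chart x x)] extDeriv (localForm α.1 x) := by
    filter_upwards [(X.chart x).open_target.mem_nhds hx] with y hy
    exact localForm_rawD α.2 x hy
  rw [h1, h2.extDeriv_eq,
    extDeriv_extDeriv_apply (α.contDiffAt_localForm x hx) minSmoothness_le_infty]
  rfl

theorem dR_dR (a : Forms X) : dR X (dR X a) = 0 := by
  have : dR X ∘ₗ dR X = 0 := Forms.hom_ext fun q α => by simp [extD_extD]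
  exact LinearMap.congr_fun this a

theorem pullback_extD (f : SMap X Y) (q : ℕ) (α : Form Y q) :
    pullback f (q + 1) (extD Y q α) = extD X q (pullback f q α) := by
  refine Form.ext_local fun x => ?_
  have hx := mem_chart_target X.Model x
  have hz : f ((X.chart x).symm (X.chart x x)) ∈ (Y.chart (f x)).source := by
    rw [(X.chart x).left_inv (mem_chart_source _ x)]
    exact mem_chart_source _ _
  have h1 : localForm (extD X q (pullback f q α)).1 x (X.chart x x) =
      extDeriv (localForm (pullback f q α).1 x) (X.chart x x) :=
    localForm_rawD (pullback f q α).2 x hx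
  have h2 : localForm (pullback f q α).1 x =ᶠ[𝓝 (X.chart x x)] fun y =>
      (localForm α.1 (f x) (readMap f x (f x) y)).compContinuousLinearMap
        (fderiv ℝ (readMap f x (f x)) y) := by
    filter_upwards [eventually_chart f.contMDiff.continuous x (f x) hx hz] with y h
    exact localForm_pullback f.contMDiff α.1 x (f x) h.1 h.2
  have h3 : localForm (pullback f (q + 1) (extD Y q α)).1 x (X.chart x x) = _ :=
    localForm_pullback f.contMDiff (extD Y q α).1 x (f x) hx hz
  have hr : readMap f x (f x) (X.chart x x) ∈ (Y.chart (f x)).target :=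
    (Y.chart (f x)).map_source hz
  have h4 : localForm (extD Y q α).1 (f x) (readMap f x (f x) (X.chart x x)) =
      extDeriv (localForm α.1 (f x)) (readMap f x (f x) (X.chart x x)) :=
    localForm_rawD α.2 (f x) hr
  rw [h1, h2.extDeriv_eq, h3, h4, extDeriv_pullback (r := ∞)
    ((α.contDiffAt_localForm (f x) hr).differentiableAt (by simp))
    (contDiffAt_readMap f.contMDiff x (f x) hx hz) minSmoothness_le_infty]

theorem pull_dR (f : SMap X Y) : pull f ∘ₗ dR Y = dR X ∘ₗ pull f :=
  Forms.hom_ext fun q α => by simp [pullback_extD]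

theorem wedgeAt_comp {V W : Type*} [AddCommGroup V] [Module ℝ V] [TopologicalSpace V]
    [AddCommGroup W] [Module ℝ W] [TopologicalSpace W] {p q : ℕ} (α : W [⋀^Fin p]→L[ℝ] ℝ)
    (β : W [⋀^Fin q]→L[ℝ] ℝ) (A : V →L[ℝ] W) :
    (wedgeAt α β).compContinuousLinearMap A =
      wedgeAt (α.compContinuousLinearMap A) (β.compContinuousLinearMap A) := by
  ext v
  rw [ContinuousAlternatingMap.compContinuousLinearMap_apply, wedgeAt_apply, wedgeAt_apply]
  rfl

theorem fderiv_alt_apply {E V : Type*} [NormedAddCommGroup E] [NormedSpace ℝ E]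
    [NormedAddCommGroup V] [NormedSpace ℝ V] {q : ℕ} {f : E → V [⋀^Fin q]→L[ℝ] ℝ} {y : E}
    (hf : DifferentiableAt ℝ f y) (u : E) (v : Fin q → V) :
    fderiv ℝ f y u v = fderiv ℝ (fun z => f z v) y u := by
  have h := (ContinuousAlternatingMap.apply ℝ V ℝ v).hasFDerivAt.comp y hf.hasFDerivAt
  exact (DFunLike.congr_fun h.fderiv u).symm

theorem fderiv_wedgeAt {E V : Type*} [NormedAddCommGroup E] [NormedSpace ℝ E]
    [NormedAddCommGroup V] [NormedSpace ℝ V] [FiniteDimensional ℝ V] {p q : ℕ}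
    {α : E → V [⋀^Fin p]→L[ℝ] ℝ} {β : E → V [⋀^Fin q]→L[ℝ] ℝ} {y : E}
    (hα : ContDiffAt ℝ ∞ α y) (hβ : ContDiffAt ℝ ∞ β y) (u : E) :
    fderiv ℝ (fun z => wedgeAt (α z) (β z)) y u =
      wedgeAt (fderiv ℝ α y u) (β y) + wedgeAt (α y) (fderiv ℝ β y u) := by
  have dα := hα.differentiableAt (by simp)
  have dβ := hβ.differentiableAt (by simp)
  have ha : ∀ v, HasFDerivAt (fun z => α z v) (fderiv ℝ (fun z => α z v) y) y := fun v =>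
    (((ContinuousAlternatingMap.apply ℝ V ℝ v).differentiableAt).comp y dα).hasFDerivAt
  have hb : ∀ v, HasFDerivAt (fun z => β z v) (fderiv ℝ (fun z => β z v) y) y := fun v =>
    (((ContinuousAlternatingMap.apply ℝ V ℝ v).differentiableAt).comp y dβ).hasFDerivAt
  ext v
  rw [fderiv_alt_apply ((contDiffAt_wedgeAt hα hβ).differentiableAt (by simp)),
    ContinuousAlternatingMap.add_apply]
  simp only [wedgeAt_apply]
  have h := (HasFDerivAt.fun_sum (u := Finset.univ) fun (σ : Equiv.Perm (Fin (p + q))) _ =>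
    ((ha fun i => v (σ (Fin.castAdd q i))).mul (hb fun j => v (σ (Fin.natAdd p j)))).const_mul
      ((Equiv.Perm.sign σ : ℤ) : ℝ)).const_mul (((p.factorial * q.factorial : ℕ) : ℝ)⁻¹)
  refine (DFunLike.congr_fun h.fderiv u).trans ?_
  simp only [smul_apply, sum_apply, add_apply, smul_eq_mul, ← fderiv_alt_apply dα,
    ← fderiv_alt_apply dβ]
  rw [← mul_add, ← Finset.sum_add_distrib]
  congr 1
  refine Finset.sum_congr rfl fun σ _ => ?_
  ring

theorem localForm_wedge {p q : ℕ} (α : Form X p) (β : Form X q) (x : X) (y : X.Model) :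
    localForm (wedge X p q α β).1 x y = wedgeAt (localForm α.1 x y) (localForm β.1 x y) :=
  wedgeAt_comp (α.1 ((X.chart x).symm y)) (β.1 ((X.chart x).symm y)) (X.dchartSymm x y)

theorem extD_wedge {p q : ℕ} (α : Form X p) (β : Form X q) :
    extD X (p + q) (wedge X p q α β) =
      castForm (show p + 1 + q = p + q + 1 by omega) (wedge X (p + 1) q (extD X p α) β) +
        sgn p • (wedge X p (q + 1) α (extD X q β) : Form X (p + q + 1)) := by
  refine Form.ext_local fun x => ?_
  have hx := mem_chart_target X.Model x
  have h1 : localForm (extD X (p + q) (wedge X p q α β)).1 x (X.chart x x) =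
      extDeriv (localForm (wedge X p q α β).1 x) (X.chart x x) :=
    localForm_rawD (wedge X p q α β).2 x hx
  have h2 : localForm (wedge X p q α β).1 x =
      fun y => wedgeAt (localForm α.1 x y) (localForm β.1 x y) :=
    funext (localForm_wedge α β x)
  have h3 : localForm (extD X p α).1 x (X.chart x x) = extDeriv (localForm α.1 x) (X.chart x x) :=
    localForm_rawD α.2 x hx
  have h4 : localForm (extD X q β).1 x (X.chart x x) = extDeriv (localForm β.1 x) (X.chart x x) :=
    localForm_rawD β.2 x hx
  have h5 := localForm_wedge (extD X p α) β x (X.chart x x)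
  have h6 := localForm_wedge α (extD X q β) x (X.chart x x)
  rw [h3] at h5
  rw [h4] at h6
  rw [h1, h2]
  ext v
  refine (alternatizeUncurryFin_wedge (fderiv ℝ (localForm α.1 x) (X.chart x x))
    (fderiv ℝ (localForm β.1 x) (X.chart x x)) _ _ _
    (fderiv_wedgeAt (α.contDiffAt_localForm x hx) (β.contDiffAt_localForm x hx)) v).trans ?_
  have h7 : localForm (castForm (show p + 1 + q = p + q + 1 by omega)
      (wedge X (p + 1) q (extD X p α) β) + sgn p •
        (wedge X p (q + 1) α (extD X q β) : Form X (p + q + 1))).1 x (X.chart x x) v =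
      localForm (castForm (show p + 1 + q = p + q + 1 by omega)
        (wedge X (p + 1) q (extD X p α) β)).1 x (X.chart x x) v +
      sgn p * localForm (wedge X p (q + 1) α (extD X q β)).1 x (X.chart x x) v := rfl
  rw [h7, localForm_castForm, h5, h6, sgn_natCast]
  rfl

theorem dR_wedge {p : ℕ} (α : Form X p) (b : Forms X) :
    dR X (wedgeProd X (homog p α) b) =
      wedgeProd X (dR X (homog p α)) b + sgn p • wedgeProd X (homog p α) (dR X b) := by
  have key : dR X ∘ₗ wedgeProd X (homog p α) =
      wedgeProd X (dR X (homog p α)) + sgn p • wedgeProd X (homog p α) ∘ₗ dR X := by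
    refine Forms.hom_ext fun q β => ?_
    simp only [LinearMap.comp_apply, wedgeProd_homog, dR_homog, LinearMap.add_apply,
      LinearMap.smul_apply]
    rw [extD_wedge, map_add, map_smul, homog_castForm]
    rfl
  exact LinearMap.congr_fun key b

end Operators

/-! ### Derivations -/

section Derivations

variable {X Y : Mfd.{u}}

theorem IsDerivation.isHomog {l : ℤ} {D : Forms X →ₗ[ℝ] Forms X} (h : IsDerivation l D) {m : ℤ}
    {a : Forms X} (ha : IsHomog m a) : IsHomog (m + l) (D a) := by
  rcases lt_or_ge m 0 with hm | hm
  · rw [ha.eq_zero hm, map_zero]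
    exact fun _ _ => map_zero _
  · lift m to ℕ using hm
    rw [ha.exists_eq]
    exact h.degree m _

theorem IsDerivation.leibniz_homog {l : ℤ} {D : Forms X →ₗ[ℝ] Forms X} (h : IsDerivation l D)
    {m : ℤ} {a : Forms X} (ha : IsHomog m a) (b : Forms X) :
    D (wedgeProd X a b) = wedgeProd X (D a) b + sgn (m * l) • wedgeProd X a (D b) := by
  rcases lt_or_ge m 0 with hm | hm
  · simp [ha.eq_zero hm]
  · lift m to ℕ using hm
    rw [ha.exists_eq]
    exact h.leibniz m _ b

/-- In the expansion of `[A, B]` on a product, the mixed terms `(A α)(B β)` and `(B α)(A β)` each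
occur twice with opposite signs. -/
theorem IsDerivation.gradedComm {a b : ℤ} {A B : Forms X →ₗ[ℝ] Forms X} (hA : IsDerivation a A)
    (hB : IsDerivation b B) : IsDerivation (a + b) (gradedComm a b A B) where
  degree q α := by
    change IsHomog _ _
    have h1 := hA.isHomog (hB.isHomog (isHomog_homog q α))
    have h2 := hB.isHomog (hA.isHomog (isHomog_homog q α))
    intro r hr
    simp only [MultForms.gradedComm, LinearMap.sub_apply, LinearMap.smul_apply,
      LinearMap.comp_apply, map_sub, map_smul]
    rw [h1 r (by omega), h2 r (by omega), smul_zero, sub_zero]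
  leibniz q α β := by
    have ha := isHomog_homog q α
    simp only [MultForms.gradedComm, LinearMap.sub_apply, LinearMap.smul_apply,
      LinearMap.comp_apply, hA.leibniz_homog ha, hB.leibniz_homog ha, map_add, map_smul,
      hA.leibniz_homog (hB.isHomog ha), hB.leibniz_homog (hA.isHomog ha), map_sub]
    have e1 : sgn ((q + b) * a) = sgn (q * a) * sgn (a * b) := by rw [← sgn_add]; congr 1; ring
    have e2 : sgn ((q + a) * b) = sgn (q * b) * sgn (a * b) := by rw [← sgn_add]; congr 1; ring
    have e3 : sgn (q * (a + b)) = sgn (q * a) * sgn (q * b) := by rw [← sgn_add]; congr 1; ring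
    have e4 := sgn_mul_self (a * b)
    rw [e1, e2, e3]
    have e5 : sgn (a * b) * (sgn (q * b) * sgn (a * b)) = sgn (q * b) := by
      rw [mul_left_comm, e4, mul_one]
    simp only [smul_add, smul_sub, smul_smul, e5, mul_comm (sgn (q * b)) (sgn (q * a)),
      mul_comm (sgn (q * a)) (sgn (a * b)), mul_assoc]
    module

theorem IsDerivation.sub {l : ℤ} {D D' : Forms X →ₗ[ℝ] Forms X} (h : IsDerivation l D)
    (h' : IsDerivation l D') : IsDerivation l (D - D') := by
  have := h.add (h'.smul (-1))
  rwa [neg_one_smul, ← sub_eq_add_neg] at this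

theorem isDerivation_dR : IsDerivation 1 (dR X) where
  degree q α := by
    rw [dR_homog]
    intro r hr
    exact comp_homog_ne (fun h => hr (by subst h; push_cast; rfl)) _
  leibniz q α β := by
    rw [mul_one, dR_wedge]

theorem insAt_comp {V W : Type*} [AddCommGroup V] [Module ℝ V] [TopologicalSpace V]
    [AddCommGroup W] [Module ℝ W] [TopologicalSpace W] {k p : ℕ} (K : V [⋀^Fin k]→L[ℝ] V)
    (L : W [⋀^Fin k]→L[ℝ] W) (θ : W [⋀^Fin (p + 1)]→L[ℝ] ℝ) (A : V →L[ℝ] W)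
    (h : ∀ v : Fin k → V, L (fun i => A (v i)) = A (K v)) :
    (insAt L θ).compContinuousLinearMap A = insAt K (θ.compContinuousLinearMap A) := by
  ext v
  rw [ContinuousAlternatingMap.compContinuousLinearMap_apply, insAt_apply, insAt_apply]
  refine congrArg _ (Finset.sum_congr rfl fun σ _ => congrArg _ ?_)
  rw [ContinuousAlternatingMap.compContinuousLinearMap_apply]
  congr 1
  funext i
  induction i using Fin.cases with
  | zero => exact h _
  | succ i => rfl

theorem pull_insertion (f : SMap X Y) {k : ℕ} {K : VForm X k} {L : VForm Y k}
    (h : Related f K L) : pull f ∘ₗ insertion L = insertion K ∘ₗ pull f := by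
  refine Forms.hom_ext fun q α => ?_
  cases q with
  | zero => simp
  | succ p =>
    simp only [LinearMap.comp_apply, insertion_homog_succ, pull_homog]
    refine congrArg _ (Subtype.ext (funext fun x => ?_))
    exact insAt_comp (K.1 x) (L.1 (f x)) (α.1 (f x)) (tmap f x) (h x)

theorem pull_lieD (f : SMap X Y) {k : ℕ} {K : VForm X k} {L : VForm Y k}
    (h : Related f K L) : pull f ∘ₗ lieD L = lieD K ∘ₗ pull f := by
  have h1 := pull_insertion f h
  have h2 := pull_dR f
  simp only [lieD, gradedComm, LinearMap.comp_sub, LinearMap.sub_comp, LinearMap.comp_smul,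
    LinearMap.smul_comp]
  rw [← LinearMap.comp_assoc, h2, LinearMap.comp_assoc, h1, ← LinearMap.comp_assoc,
    ← LinearMap.comp_assoc, h1,
    LinearMap.comp_assoc (dR Y), h2]
  rfl

theorem ins_mulForm {k p : ℕ} (K : VForm X k) (f : Form X 0) (β : Form X (p + 1)) :
    ins K p (mulForm f β) = mulForm f (ins K p β) := by
  refine Form.ext fun x v => ?_
  refine (insAt_apply (K.1 x) (f.1 x 0 • β.1 x) v).trans ?_
  refine Eq.trans ?_ (congrArg (f.1 x 0 * ·) (insAt_apply (K.1 x) (β.1 x) v)).symm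
  simp only [ContinuousAlternatingMap.smul_apply, smul_eq_mul, Finset.mul_sum]
  exact Finset.sum_congr rfl fun _ _ => by ring

/-- If one factor is a function, this is linearity of `i_K` over functions; for two factors of
positive degree it is `insAt_wedgeAt` at each point. -/
theorem isDerivation_insertion {k : ℕ} (K : VForm X k) :
    IsDerivation ((k : ℤ) - 1) (insertion K) where
  degree q α := by
    intro r hr
    cases q with
    | zero => simp
    | succ p =>
      rw [insertion_homog_succ]
      exact comp_homog_ne (fun h => hr (by subst h; push_cast; ring)) _
  leibniz q α b := by
    have key : insertion K ∘ₗ wedgeProd X (homog q α) = wedgeProd X (insertion K (homog q α)) +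
        sgn (q * ((k : ℤ) - 1)) • wedgeProd X (homog q α) ∘ₗ insertion K := by
      refine Forms.hom_ext fun r β => ?_
      simp only [LinearMap.comp_apply, LinearMap.add_apply, LinearMap.smul_apply]
      cases q with
      | zero =>
        cases r with
        | zero => simp
        | succ r =>
          rw [wedgeProd_function, insertion_homog_succ, insertion_homog_succ, wedgeProd_function,
            ins_mulForm]
          simp
      | succ p =>
        cases r with
        | zero =>
          rw [wedgeProd_function_right, insertion_homog_succ, insertion_homog_succ,
            wedgeProd_function_right, ins_mulForm]
          simp
        | succ r =>
          have e : wedgeProd X (homog (p + 1) α) (homog (r + 1) β) =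
            homog (p + 1 + r + 1) (wedge X (p + 1) (r + 1) α β : Form X (p + 1 + (r + 1))) :=
            wedgeProd_homog α β
          rw [e]
          simp only [insertion_homog_succ, wedgeProd_homog]
          have h1 : homog (k + p + (r + 1)) (wedge X (k + p) (r + 1) (ins K p α) β) =
              homog (k + (p + 1 + r)) (castForm (show k + p + (r + 1) = _ by omega) _) :=
            (homog_castForm _ _).symm
          have h2 : homog (p + 1 + (k + r)) (wedge X (p + 1) (k + r) α (ins K r β)) =
              homog (k + (p + 1 + r)) (castForm (show p + 1 + (k + r) = _ by omega) _) :=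
            (homog_castForm _ _).symm
          rw [h1, h2, ← map_smul, ← map_add]
          congr 1
          have hc : ∀ {m n : ℕ} (h : m = n) (γ : Form X m) (x : X) (v : Fin n → X.T x),
              (castForm h γ).1 x v = γ.1 x fun i => v (Fin.cast h i) := by
            intro m n h γ x v
            subst h
            rfl
          refine Form.ext fun x v => ?_
          refine (insAt_wedgeAt (K.1 x) (α.1 x) (β.1 x) v).trans ?_
          have g1 := hc (show k + p + (r + 1) = k + (p + 1 + r) by omega)
            (wedge X (k + p) (r + 1) (ins K p α) β) x v
          have g2 := hc (show p + 1 + (k + r) = k + (p + 1 + r) by omega)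
            (wedge X (p + 1) (k + r) α (ins K r β)) x v
          refine congrArg₂ (· + ·) g1.symm ?_
          -- The exponents `(k+1)(p+1)` and `(k-1)(p+1)` differ by an even number.
          have hs : (-1 : ℝ) ^ ((k + 1) * (p + 1)) = sgn (((p + 1 : ℕ) : ℤ) * ((k : ℤ) - 1)) := by
            rw [← sgn_natCast]
            have : (((k + 1) * (p + 1) : ℕ) : ℤ) =
                ((p + 1 : ℕ) : ℤ) * ((k : ℤ) - 1) + ((p + 1 : ℕ) + (p + 1 : ℕ)) := by
              push_cast; ring
            rw [this, sgn_add, sgn_add, sgn_mul_self, mul_one]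
          rw [hs]
          exact congrArg (sgn (((p + 1 : ℕ) : ℤ) * ((k : ℤ) - 1)) * ·) g2.symm
    exact LinearMap.congr_fun key b

theorem isDerivation_lieD {k : ℕ} (K : VForm X k) : IsDerivation (k : ℤ) (lieD K) := by
  have := isDerivation_dR.gradedComm (isDerivation_insertion K)
  rwa [show (1 : ℤ) + (k - 1) = k by ring] at this

/-- `D` commutes, in the graded sense, with the exterior derivative. -/
def CommutesD (l : ℤ) (D : Forms X →ₗ[ℝ] Forms X) : Prop :=
  ∀ a, D (dR X a) = sgn l • dR X (D a)

/-- Since `d² = 0`, both sides reduce to `d i_K d`. -/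
theorem commutesD_lieD {k : ℕ} (K : VForm X k) : CommutesD (k : ℤ) (lieD K) := by
  intro a
  simp only [lieD, gradedComm, LinearMap.sub_apply, LinearMap.smul_apply, LinearMap.comp_apply,
    dR_dR, map_zero, smul_zero, sub_zero, map_sub, map_smul, zero_sub, smul_neg, smul_smul]
  have : sgn (k : ℤ) * sgn (1 * ((k : ℤ) - 1)) = -1 := by
    rw [one_mul, sgn_sub, ← mul_assoc, sgn_mul_self]; simp
  rw [this]
  simp

theorem CommutesD.gradedComm {a b : ℤ} {A B : Forms X →ₗ[ℝ] Forms X} (hA : CommutesD a A)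
    (hB : CommutesD b B) : CommutesD (a + b) (gradedComm a b A B) := by
  intro c
  simp only [MultForms.gradedComm, LinearMap.sub_apply, LinearMap.smul_apply,
    LinearMap.comp_apply, hA c, hB c, map_smul, hA (B c), hB (A c), map_sub, sgn_add]
  module

theorem CommutesD.sub {l : ℤ} {D D' : Forms X →ₗ[ℝ] Forms X} (h : CommutesD l D)
    (h' : CommutesD l D') : CommutesD l (D - D') := by
  intro a
  simp only [LinearMap.sub_apply, h a, h' a, map_sub, smul_sub]

/-- Since `K` is alternating, the `k!` terms of the alternation are equal and cancel the normalising
factor. -/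
theorem insAt_one {V : Type*} [AddCommGroup V] [Module ℝ V] [TopologicalSpace V] {k : ℕ}
    (K : V [⋀^Fin k]→L[ℝ] V) (θ : V [⋀^Fin (0 + 1)]→L[ℝ] ℝ) (v : Fin k → V) :
    insAt (p := 0) K θ v = θ fun _ => K v := by
  have h : ∀ w : Fin (k + 0) → V, θ (Fin.cons (K fun i => w (Fin.castAdd 0 i))
      fun j => w (Fin.natAdd k j)) = θ fun _ => K w := fun w => by
    congr 1
    funext i
    rw [Fin.fin_one_eq_zero i]
    rfl
  have h2 : ∀ σ : Equiv.Perm (Fin k), (θ fun _ => K fun i => v (σ i)) =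
      rsign σ * θ fun _ => K v := fun σ => by
    have h3 := K.toAlternatingMap.map_perm v σ
    rw [Units.smul_def] at h3
    have h4 : (K fun i => v (σ i)) = rsign σ • K v := h3.trans (by rw [Int.cast_smul_eq_zsmul]; rfl)
    rw [h4]
    have h5 := θ.map_smul_univ (fun _ => rsign σ) (fun _ => K v)
    simpa using h5
  rw [insAt_eq]
  have h6 : (∑ σ : Equiv.Perm (Fin (k + 0)), rsign σ * θ fun _ => K fun i => v (σ i)) =
      k.factorial * θ fun _ => K v := by
    refine (Finset.sum_congr rfl fun σ _ => congrArg (rsign σ * ·) (h2 σ)).trans ?_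
    simp only [← mul_assoc, rsign_mul_self]
    simp [Fintype.card_perm]
  have h7 : altSum (fun w : Fin (k + 0) → V => θ (Fin.cons (K fun i => w (Fin.castAdd 0 i))
      fun j => w (Fin.natAdd k j))) v = k.factorial * θ fun _ => K v :=
    (Finset.sum_congr rfl fun σ _ => congrArg (rsign σ * ·) (h _)).trans h6
  rw [h7]
  have : (k.factorial : ℝ) ≠ 0 := by positivity
  simp
  field_simp

/-- The value of `L_K f` is `df ∘ K`, up to sign. -/
theorem lieD_function {k : ℕ} (K : VForm X k) (f : Form X 0) :
    lieD K (homog 0 f) = sgn k • homog k (ins K 0 (extD X 0 f)) := by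
  simp only [lieD, gradedComm, LinearMap.sub_apply, LinearMap.smul_apply, LinearMap.comp_apply,
    dR_homog, insertion_homog_succ, insertion_homog_zero, map_zero, zero_sub]
  rw [one_mul, sgn_sub, sgn_one, mul_neg_one, neg_smul, neg_neg]
  rfl

theorem ins_extD_apply {k : ℕ} (K : VForm X k) (f : Form X 0) (x : X) (v : Fin k → X.T x) :
    (ins K 0 (extD X 0 f)).1 x v = (extD X 0 f).1 x fun _ => K.1 x v :=
  insAt_one (K.1 x) ((extD X 0 f).1 x) v

end Derivations

/-! ### The lemma of Hadamard -/

section Hadamard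

variable {E W : Type u} [NormedAddCommGroup E] [NormedSpace ℝ E] [FiniteDimensional ℝ E]
  [NormedAddCommGroup W] [NormedSpace ℝ W]

theorem hasFDerivAt_integral_unit {G : ℝ × E → W} (hG : ContDiff ℝ ∞ G) (y : E) :
    HasFDerivAt (fun z => ∫ t in (0 : ℝ)..1, G (t, z))
      (∫ t in (0 : ℝ)..1, fderiv ℝ G (t, y) ∘L ContinuousLinearMap.inr ℝ ℝ E) y := by
  have hc : Continuous fun x : ℝ × E => fderiv ℝ G x ∘L ContinuousLinearMap.inr ℝ ℝ E :=
    (hG.continuous_fderiv (by simp)).clm_comp continuous_const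
  have hcy : ∀ z : E, Continuous fun t : ℝ => G (t, z) := fun z => by
    have := hG.continuous
    fun_prop
  -- Compactness of `[0, 1] × closedBall y 1` provides the constant that dominates the derivative of
  -- the integrand.
  obtain ⟨C, hC⟩ := ((isCompact_Icc (a := (0 : ℝ)) (b := 1)).prod
    (isCompact_closedBall y 1)).exists_bound_of_continuousOn hc.continuousOn
  refine intervalIntegral.hasFDerivAt_integral_of_dominated_of_fderiv_le
    (F := fun z t => G (t, z))
    (F' := fun z t => fderiv ℝ G (t, z) ∘L ContinuousLinearMap.inr ℝ ℝ E) (bound := fun _ => C)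
    (Metric.closedBall_mem_nhds y one_pos) ?_ ((hcy y).intervalIntegrable _ _) ?_ ?_
    intervalIntegrable_const ?_
  · exact Filter.Eventually.of_forall fun z => (hcy z).aestronglyMeasurable
  · exact (hc.comp (by fun_prop : Continuous fun t : ℝ => (t, y))).aestronglyMeasurable
  · refine Filter.Eventually.of_forall fun t ht z hz => hC (t, z) ⟨?_, hz⟩
    rw [Set.uIoc_of_le zero_le_one] at ht
    exact ⟨ht.1.le, ht.2⟩
  · refine Filter.Eventually.of_forall fun t _ z _ => ?_
    have h1 : HasFDerivAt (fun z : E => (t, z)) (ContinuousLinearMap.inr ℝ ℝ E) z :=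
      hasFDerivAt_prodMk_right t z
    exact ((hG.differentiable (by simp)) (t, z)).hasFDerivAt.comp z h1

/-- The derivative of such an integral is an integral of the same kind with values in `E →L[ℝ] W`;
the target space therefore varies in the induction. -/
theorem contDiff_integral_unit_nat (n : ℕ) : ∀ {W : Type u} [NormedAddCommGroup W]
    [NormedSpace ℝ W] {G : ℝ × E → W}, ContDiff ℝ ∞ G →
      ContDiff ℝ n fun z => ∫ t in (0 : ℝ)..1, G (t, z) := by
  induction n with
  | zero =>
    intro W _ _ G hG
    rw [Nat.cast_zero, contDiff_zero]
    exact continuous_iff_continuousAt.2 fun y => (hasFDerivAt_integral_unit hG y).continuousAt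
  | succ n ih =>
    intro W _ _ G hG
    rw [Nat.cast_add, Nat.cast_one, contDiff_succ_iff_fderiv]
    refine ⟨fun y => (hasFDerivAt_integral_unit hG y).differentiableAt, by simp, ?_⟩
    have h : fderiv ℝ (fun z => ∫ t in (0 : ℝ)..1, G (t, z)) = fun y =>
        ∫ t in (0 : ℝ)..1, fderiv ℝ G (t, y) ∘L ContinuousLinearMap.inr ℝ ℝ E :=
      funext fun y => (hasFDerivAt_integral_unit hG y).fderiv
    rw [h]
    exact ih (G := fun x => fderiv ℝ G x ∘L ContinuousLinearMap.inr ℝ ℝ E)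
      ((hG.fderiv_right (m := ∞) (by simp)).clm_comp contDiff_const)

/-- A smooth function is, to first order at `y₀`, a linear combination of the coordinates with
smooth coefficients. -/
theorem exists_hadamard {F : E → ℝ} (hF : ContDiff ℝ ∞ F) (y₀ : E) :
    ∃ H : E → E →L[ℝ] ℝ, ContDiff ℝ ∞ H ∧ H y₀ = fderiv ℝ F y₀ ∧
      ∀ y, F y = F y₀ + H y (y - y₀) := by
  have hG : ContDiff ℝ ∞ fun x : ℝ × E => fderiv ℝ F (y₀ + x.1 • (x.2 - y₀)) :=
    (hF.fderiv_right (m := ∞) (by simp)).comp (by fun_prop)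
  -- The average of the differential along the segment from `y₀` to `y`; the identity is the
  -- fundamental theorem of calculus on this segment.
  refine ⟨fun y => ∫ t in (0 : ℝ)..1, fderiv ℝ F (y₀ + t • (y - y₀)), ?_, by simp, fun y => ?_⟩
  · exact contDiff_infty.2 fun n => contDiff_integral_unit_nat n hG
  · have hd : ∀ t : ℝ, HasDerivAt (fun t : ℝ => F (y₀ + t • (y - y₀)))
        (fderiv ℝ F (y₀ + t • (y - y₀)) (y - y₀)) t := fun t => by
      have h1 : HasDerivAt (fun t : ℝ => y₀ + t • (y - y₀)) (y - y₀) t := by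
        simpa using ((hasDerivAt_id t).smul_const (y - y₀)).const_add y₀
      exact ((hF.differentiable (by simp)) _).hasFDerivAt.comp_hasDerivAt t h1
    have hcont : Continuous fun t : ℝ => fderiv ℝ F (y₀ + t • (y - y₀)) :=
      (hF.continuous_fderiv (by simp)).comp (by fun_prop)
    have h2 := intervalIntegral.integral_eq_sub_of_hasDerivAt (a := 0) (b := 1)
      (fun t _ => hd t) ((hcont.clm_apply continuous_const).intervalIntegrable _ _)
    rw [ContinuousLinearMap.intervalIntegral_apply (hcont.intervalIntegrable _ _), h2]
    simp

end Hadamard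

/-! ### Local constructions of forms -/

section Local

variable {X : Mfd.{u}}

theorem rawPullback_id {q : ℕ} (θ : RawForm X q) : rawPullback (id : X → X) θ = θ := by
  funext w
  ext v
  simp only [rawPullback, ContinuousAlternatingMap.compContinuousLinearMap_apply]
  congr 1
  funext i
  simp [tmap, mfderiv_id]

/-- Smoothness of a form may be checked in one chart at each point. -/
theorem smoothForms_of_local {q : ℕ} {θ : RawForm X q} (h : ∀ p : X, ∃ c : X,
    p ∈ (X.chart c).source ∧ ContDiffAt ℝ ∞ (localForm θ c) (X.chart c p)) :
    θ ∈ smoothForms X q := by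
  intro z y hy
  obtain ⟨c, hc, hθ⟩ := h ((X.chart z).symm y)
  have hid : IsSmooth (id : X → X) := contMDiff_id
  have h1 : localForm θ z =ᶠ[𝓝 y] fun y' => (localForm θ c (readMap id z c y')
      ).compContinuousLinearMap (fderiv ℝ (readMap id z c) y') := by
    filter_upwards [eventually_chart hid.continuous z c hy hc] with y' h
    have h3 := localForm_pullback hid θ z c h.1 h.2
    rwa [rawPullback_id] at h3
  refine ContDiffAt.contDiffWithinAt (ContDiffAt.congr_of_eventuallyEq ?_ h1)
  have hr := contDiffAt_readMap hid z c hy hc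
  have h2 : ContDiffAt ℝ ∞ (localForm θ c) (readMap id z c y) := hθ
  exact contDiffAt_alt_comp (f := fun y' => localForm θ c (readMap id z c y'))
    (ContDiffAt.comp y h2 hr) (hr.fderiv_right (m := ∞) (by simp))

theorem apply_eq_localForm {q : ℕ} (θ : RawForm X q) (c : X) {x : X}
    (hx : x ∈ (X.chart c).source) (v : Fin q → X.T x) :
    θ x v = localForm θ c (X.chart c x) fun i => X.dchart c x (v i) := by
  obtain ⟨a, ha, rfl⟩ : ∃ a ∈ (X.chart c).target, (X.chart c).symm a = x :=
    ⟨_, (X.chart c).map_source hx, (X.chart c).left_inv hx⟩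
  rw [(X.chart c).right_inv ha]
  simp only [localForm, ContinuousAlternatingMap.compContinuousLinearMap_apply]
  congr 1
  funext i
  exact (dchartSymm_dchart c ha (v i)).symm

variable {c : X} (χ : SmoothBumpFunction 𝓘(ℝ, X.Model) c)

/-- The not necessarily smooth form `χ · η`, where `η` is a form on the image of the chart. -/
def rawBumpForm {q : ℕ} (η : X.Model → X.Model [⋀^Fin q]→L[ℝ] ℝ) : RawForm X q := fun x =>
  χ x • (η (X.chart c x)).compContinuousLinearMap (X.dchart c x)

theorem localForm_rawBumpForm {q : ℕ} (η : X.Model → X.Model [⋀^Fin q]→L[ℝ] ℝ) {y : X.Model}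
    (hy : y ∈ (X.chart c).target) :
    localForm (rawBumpForm χ η) c y = χ.toContDiffBump y • η y := by
  have h1 : χ ((X.chart c).symm y) = χ.toContDiffBump y := by
    rw [χ.eqOn_source ((X.chart c).map_target hy)]
    simp [(X.chart c).right_inv hy]
  ext v
  change χ ((X.chart c).symm y) • η (X.chart c ((X.chart c).symm y))
    (fun i => X.dchart c ((X.chart c).symm y) (X.dchartSymm c y (v i))) =
      χ.toContDiffBump y • η y v
  rw [h1, (X.chart c).right_inv hy]
  congr 2
  funext i
  exact dchart_dchartSymm c hy (v i)

theorem rawBumpForm_mem {q : ℕ} {η : X.Model → X.Model [⋀^Fin q]→L[ℝ] ℝ}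
    (hη : ContDiffOn ℝ ∞ η (X.chart c).target) : rawBumpForm χ η ∈ smoothForms X q := by
  refine smoothForms_of_local fun p => ?_
  by_cases hp : p ∈ (X.chart c).source
  · refine ⟨c, hp, ?_⟩
    have hy := (X.chart c).map_source hp
    have hn := (X.chart c).open_target.mem_nhds hy
    refine (χ.toContDiffBump.contDiff.contDiffAt.smul (hη.contDiffAt hn)).congr_of_eventuallyEq ?_
    filter_upwards [hn] with y hy'
    exact localForm_rawBumpForm χ η hy'
  · refine ⟨p, mem_chart_source _ p, ?_⟩
    have h1 : ∀ᶠ z in 𝓝 p, χ z = 0 := by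
      -- The closed support of the bump function lies in the chart domain, so `χ` vanishes on a
      -- whole neighbourhood of a point outside this domain.
      have h2 : p ∉ tsupport χ := fun h => hp (χ.tsupport_subset_chartAt_source h)
      filter_upwards [(isClosed_tsupport _).isOpen_compl.mem_nhds h2] with z hz
      exact image_eq_zero_of_notMem_tsupport hz
    have h3 : ∀ᶠ y in 𝓝 (X.chart p p), χ ((X.chart p).symm y) = 0 := by
      have := (X.chart p).continuousAt_symm (mem_chart_target X.Model p)
      rw [ContinuousAt, (X.chart p).left_inv (mem_chart_source _ p)] at this
      exact this.eventually h1
    refine (contDiffAt_const (c := (0 : X.Model [⋀^Fin q]→L[ℝ] ℝ))).congr_of_eventuallyEq ?_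
    filter_upwards [h3] with y hy
    ext v
    change χ ((X.chart p).symm y) • _ = (0 : ℝ)
    rw [hy, zero_smul]

/-- The form `χ · η`, where `η` is a form on the image of the chart. -/
def bumpForm {q : ℕ} (η : X.Model → X.Model [⋀^Fin q]→L[ℝ] ℝ)
    (hη : ContDiffOn ℝ ∞ η (X.chart c).target) : Form X q :=
  ⟨rawBumpForm χ η, rawBumpForm_mem χ hη⟩

theorem eventually_localForm_bumpForm {q : ℕ} {η : X.Model → X.Model [⋀^Fin q]→L[ℝ] ℝ}
    (hη : ContDiffOn ℝ ∞ η (X.chart c).target) :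
    ∀ᶠ y in 𝓝 (X.chart c c), localForm (bumpForm χ η hη).1 c y = η y := by
  filter_upwards [(X.chart c).open_target.mem_nhds (mem_chart_target X.Model c),
    χ.toContDiffBump.eventuallyEq_one] with y hy h1
  refine (localForm_rawBumpForm χ η hy).trans ?_
  have : χ.toContDiffBump y = 1 := h1
  rw [this, one_smul]

theorem bumpForm_eq_zero {q : ℕ} {η : X.Model → X.Model [⋀^Fin q]→L[ℝ] ℝ}
    (hη : ContDiffOn ℝ ∞ η (X.chart c).target) {x : X} (hx : x ∉ tsupport χ) :
    (bumpForm χ η hη).1 x = 0 := by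
  change χ x • _ = _
  rw [image_eq_zero_of_notMem_tsupport hx, zero_smul]

/-- The function `χ · h`, where `h` is a function on the image of the chart. -/
def bumpFun (h : X.Model → ℝ) (hh : ContDiff ℝ ∞ h) : Form X 0 :=
  bumpForm χ (fun y => ContinuousAlternatingMap.constOfIsEmpty ℝ X.Model (Fin 0) (h y))
    ((ContinuousAlternatingMap.constOfIsEmptyLIE ℝ X.Model ℝ (Fin 0)).contDiff.comp hh).contDiffOn

theorem eventually_localForm_bumpFun {h : X.Model → ℝ} (hh : ContDiff ℝ ∞ h) :
    ∀ᶠ y in 𝓝 (X.chart c c), localForm (bumpFun χ h hh).1 c y =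
      ContinuousAlternatingMap.constOfIsEmpty ℝ X.Model (Fin 0) (h y) :=
  eventually_localForm_bumpForm χ _

theorem eventually_localForm_extD_bumpFun {h : X.Model → ℝ} (hh : ContDiff ℝ ∞ h) :
    ∀ᶠ y in 𝓝 (X.chart c c), ∀ v : Fin 1 → X.Model,
      localForm (extD X 0 (bumpFun χ h hh)).1 c y v = fderiv ℝ h y (v 0) := by
  filter_upwards [(eventually_localForm_bumpFun χ hh).eventually_nhds,
    (X.chart c).open_target.mem_nhds (mem_chart_target X.Model c)] with y hy hy'
  intro v
  have h1 : localForm (extD X 0 (bumpFun χ h hh)).1 c y =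
      extDeriv (localForm (bumpFun χ h hh).1 c) y := localForm_rawD (bumpFun χ h hh).2 c hy'
  rw [h1, Filter.EventuallyEq.extDeriv_eq hy, extDeriv_constOfIsEmpty]
  rfl

theorem extD_bumpFun_apply {h : X.Model → ℝ} (hh : ContDiff ℝ ∞ h) (v : X.T c) :
    (extD X 0 (bumpFun χ h hh)).1 c (fun _ => v) = fderiv ℝ h (X.chart c c) (X.dchart c c v) := by
  rw [apply_eq_localForm _ c (mem_chart_source _ c)]
  exact (eventually_localForm_extD_bumpFun χ hh).self_of_nhds _

theorem bumpFun_apply {h : X.Model → ℝ} (hh : ContDiff ℝ ∞ h) (v : Fin 0 → X.T c) :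
    (bumpFun χ h hh).1 c v = h (X.chart c c) := by
  rw [apply_eq_localForm _ c (mem_chart_source _ c)]
  rw [(eventually_localForm_bumpFun χ hh).self_of_nhds]
  rfl

theorem eventually_of_localForm {q : ℕ} {θ : RawForm X q} {c : X}
    (h : ∀ᶠ y in 𝓝 (X.chart c c), localForm θ c y = 0) : ∀ᶠ x in 𝓝 c, θ x = 0 := by
  have h1 := (X.chart c).continuousAt (mem_chart_source _ c)
  filter_upwards [h1.eventually h, (X.chart c).open_source.mem_nhds (mem_chart_source _ c)]
    with x hx hx'
  ext v
  rw [apply_eq_localForm θ c hx', hx]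
  rfl

/-- A bump function at `x` with support in a given neighbourhood. -/
theorem exists_bump (x : X) {U : Set X} (hU : U ∈ 𝓝 x) :
    ∃ χ : SmoothBumpFunction 𝓘(ℝ, X.Model) x, tsupport χ ⊆ U := by
  obtain ⟨χ, -, h⟩ := (SmoothBumpFunction.nhds_basis_tsupport (I := 𝓘(ℝ, X.Model)) x).mem_iff.1 hU
  exact ⟨χ, h⟩

/-- A function with given differential at `x` which vanishes near a finite set of other points. -/
theorem exists_function (x : X) (ξ : X.Model →L[ℝ] ℝ) {S : Set X} (hS : S.Finite) (hx : x ∉ S) :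
    ∃ f : Form X 0, (∀ v : X.T x, (extD X 0 f).1 x (fun _ => v) = ξ (X.dchart x x v)) ∧
      ∀ z ∈ S, (extD X 0 f).1 z = 0 := by
  -- The function is the linear form `ξ` read in the chart, cut off away from `S`.
  obtain ⟨χ, hχ⟩ := exists_bump x (hS.isClosed.isOpen_compl.mem_nhds hx)
  refine ⟨bumpFun χ ξ ξ.contDiff, fun v => by rw [extD_bumpFun_apply]; simp, fun z hz => ?_⟩
  have hz' : z ∉ tsupport χ := fun h => hχ h hz
  refine eq_of_localForm_eq_self (η := 0) z ?_
  have h1 : localForm (extD X 0 (bumpFun χ ξ ξ.contDiff)).1 z (X.chart z z) =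
      extDeriv (localForm (bumpFun χ ξ ξ.contDiff).1 z) (X.chart z z) :=
    localForm_rawD (bumpFun χ ξ ξ.contDiff).2 z (mem_chart_target _ z)
  have h2 : localForm (bumpFun χ ξ ξ.contDiff).1 z =ᶠ[𝓝 (X.chart z z)] fun _ => 0 := by
    have h3 := (X.chart z).continuousAt_symm (mem_chart_target X.Model z)
    rw [ContinuousAt, (X.chart z).left_inv (mem_chart_source _ z)] at h3
    filter_upwards [h3.eventually ((isClosed_tsupport _).isOpen_compl.mem_nhds hz')] with y hy
    ext v
    simp only [localForm, ContinuousAlternatingMap.compContinuousLinearMap_apply]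
    have h4 : (bumpFun χ ξ ξ.contDiff).1 ((X.chart z).symm y) = 0 := bumpForm_eq_zero χ _ hy
    rw [h4]
    rfl
  rw [h1, h2.extDeriv_eq]
  ext v
  simp [extDeriv, ContinuousAlternatingMap.alternatizeUncurryFin_apply]
  rfl

end Local

/-! ### Locality of derivations -/

section Locality

variable {X Y : Mfd.{u}}

theorem Forms.mem_of_homog {S : Submodule ℝ (Forms X)} {a : Forms X}
    (h : ∀ r, homog r (comp r a) ∈ S) : a ∈ S := by
  classical
  have e : ∑ r ∈ DFinsupp.support a, homog r (comp r a) = a :=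
    DirectSum.sum_support_of (β := fun q => Form X q) a
  rw [← e]
  exact sum_mem fun r _ => h r

/-- The forms which vanish at `x`. -/
def vanishing (x : X) : Submodule ℝ (Forms X) where
  carrier := {a | ∀ r, (comp r a).1 x = 0}
  zero_mem' r := by rw [map_zero]; rfl
  add_mem' {a b} ha hb r := by
    rw [map_add]
    exact (congrArg₂ (· + ·) (ha r) (hb r)).trans (add_zero _)
  smul_mem' c a ha r := by
    rw [map_smul]
    exact (congrArg (c • ·) (ha r)).trans (smul_zero _)

theorem homog_mem_vanishing {x : X} {q : ℕ} {α : Form X q} :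
    homog q α ∈ vanishing x ↔ α.1 x = 0 := by
  refine ⟨fun h => ?_, fun h r => ?_⟩
  · have := h q
    rwa [comp_homog] at this
  · by_cases hr : q = r
    · subst hr
      rwa [comp_homog]
    · rw [comp_homog_ne hr]
      rfl

theorem eq_zero_of_mem_vanishing {a : Forms X} (h : ∀ x, a ∈ vanishing x) : a = 0 :=
  Forms.ext fun r => Subtype.ext (funext fun x => by rw [h x r, map_zero]; rfl)

theorem wedgeProd_mem_vanishing_left {x : X} {a : Forms X} (ha : a ∈ vanishing x) (b : Forms X) :
    wedgeProd X a b ∈ vanishing x := by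
  refine Forms.mem_of_homog (S := (vanishing x).comap ((wedgeProd X).flip b)) fun p => ?_
  refine Forms.mem_of_homog
    (S := (vanishing x).comap (wedgeProd X (homog p (comp p a)))) fun q => ?_
  rw [Submodule.mem_comap, wedgeProd_homog, homog_mem_vanishing]
  change wedgeAt ((comp p a).1 x) ((comp q b).1 x) = 0
  rw [ha p]
  ext v
  simp [wedgeAt_apply]

theorem wedgeProd_mem_vanishing_right {x : X} (a : Forms X) {b : Forms X} (hb : b ∈ vanishing x) :
    wedgeProd X a b ∈ vanishing x := by
  refine Forms.mem_of_homog (S := (vanishing x).comap ((wedgeProd X).flip b)) fun p => ?_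
  refine Forms.mem_of_homog
    (S := (vanishing x).comap (wedgeProd X (homog p (comp p a)))) fun q => ?_
  rw [Submodule.mem_comap, wedgeProd_homog, homog_mem_vanishing]
  change wedgeAt ((comp p a).1 x) ((comp q b).1 x) = 0
  rw [hb q]
  ext v
  simp [wedgeAt_apply]

/-- The constant function `1`. -/
def oneForm (X : Mfd.{u}) : Form X 0 :=
  ⟨fun x => ContinuousAlternatingMap.constOfIsEmpty ℝ (X.T x) (Fin 0) 1, fun _ =>
    (contDiffOn_const (c := ContinuousAlternatingMap.constOfIsEmpty ℝ X.Model (Fin 0) (1 : ℝ))).congr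
      fun _ _ => rfl⟩

theorem wedgeProd_one_right (a : Forms X) : wedgeProd X a (homog 0 (oneForm X)) = a := by
  have : (wedgeProd X).flip (homog 0 (oneForm X)) = LinearMap.id := by
    refine Forms.hom_ext fun q α => ?_
    rw [LinearMap.flip_apply, wedgeProd_function_right]
    exact congrArg (homog q) (Form.ext fun x v => one_mul _)
  exact LinearMap.congr_fun this a

theorem wedgeProd_one_left (a : Forms X) : wedgeProd X (homog 0 (oneForm X)) a = a := by
  have : wedgeProd X (homog 0 (oneForm X)) = LinearMap.id := by
    refine Forms.hom_ext fun q α => ?_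
    rw [wedgeProd_function]
    exact congrArg (homog q) (Form.ext fun x v => one_mul _)
  exact LinearMap.congr_fun this a

/-- The Leibniz rule for `1 ∧ 1 = 1` gives `D 1 = 2 D 1`. -/
theorem IsDerivation.map_one {l : ℤ} {D : Forms X →ₗ[ℝ] Forms X} (h : IsDerivation l D) :
    D (homog 0 (oneForm X)) = 0 := by
  have h1 := h.leibniz 0 (oneForm X) (homog 0 (oneForm X))
  rw [wedgeProd_one_right, wedgeProd_one_left, wedgeProd_one_right] at h1
  simpa using h1

theorem IsDerivation.map_mulForm {l : ℤ} {D : Forms X →ₗ[ℝ] Forms X} (h : IsDerivation l D)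
    {q : ℕ} (f : Form X 0) (β : Form X q) :
    D (homog q (mulForm f β)) =
      wedgeProd X (D (homog 0 f)) (homog q β) + wedgeProd X (homog 0 f) (D (homog q β)) := by
  rw [← wedgeProd_function, h.leibniz]
  simp

/-- Derivations are local operators. -/
theorem IsDerivation.map_mem_vanishing {l : ℤ} {D : Forms X →ₗ[ℝ] Forms X} (h : IsDerivation l D)
    {q : ℕ} {η : Form X q} {x : X} (hη : ∀ᶠ z in 𝓝 x, η.1 z = 0) :
    D (homog q η) ∈ vanishing x := by
  obtain ⟨χ, hχ⟩ := exists_bump x hη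
  let b : Form X 0 := bumpFun χ (fun _ => 1) contDiff_const
  -- The function `b` is `1` at `x` and is supported where `η` vanishes. In the Leibniz rule for `(1
  -- - b) η` each term then contains a factor, `η` or `1 - b`, that vanishes at `x`.
  have h1 : mulForm (oneForm X - b) η = η := by
    refine Form.ext fun z v => ?_
    change (1 - b.1 z 0) * η.1 z v = η.1 z v
    by_cases hz : z ∈ tsupport χ
    · have : η.1 z = 0 := hχ hz
      rw [this]
      simp
    · have : b.1 z = 0 := bumpForm_eq_zero χ _ hz
      rw [this]
      simp
  rw [← h1, h.map_mulForm]
  refine add_mem (wedgeProd_mem_vanishing_right _ (homog_mem_vanishing.2 hη.self_of_nhds))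
    (wedgeProd_mem_vanishing_left (homog_mem_vanishing.2 ?_) _)
  ext v
  change 1 - b.1 x v = 0
  rw [bumpFun_apply, sub_self]

/-- The differential of a function at `x`. -/
def dAt (f : Form X 0) (x : X) : X.T x →L[ℝ] ℝ :=
  (ContinuousAlternatingMap.ofSubsingleton ℝ (X.T x) ℝ (0 : Fin 1)).symm ((extD X 0 f).1 x)

theorem dAt_apply (f : Form X 0) (x : X) (v : X.T x) :
    dAt f x v = (extD X 0 f).1 x fun _ => v := by
  rfl

theorem dAt_add (f g : Form X 0) (x : X) : dAt (f + g) x = dAt f x + dAt g x := by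
  ext v
  rw [_root_.add_apply]
  simp only [dAt_apply, map_add]
  rfl

theorem dAt_smul (c : ℝ) (f : Form X 0) (x : X) : dAt (c • f) x = c • dAt f x := by
  ext v
  rw [_root_.smul_apply]
  simp only [dAt_apply, map_smul]
  rfl

/-- The differential at `x` as a linear map. -/
def dAtLinear (x : X) : Form X 0 →ₗ[ℝ] (X.T x →L[ℝ] ℝ) where
  toFun f := dAt f x
  map_add' f g := dAt_add f g x
  map_smul' c f := dAt_smul c f x

theorem dAt_pullback (f : SMap X Y) (φ : Form Y 0) (x : X) (v : X.T x) :
    dAt (pullback f 0 φ) x v = dAt φ (f x) (tmap f x v) := by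
  rw [dAt_apply, ← pullback_extD]
  rfl

theorem exists_dAt (x : X) (ξ : X.Model →L[ℝ] ℝ) {S : Set X} (hS : S.Finite) (hx : x ∉ S) :
    ∃ f : Form X 0, (∀ v : X.T x, dAt f x v = ξ (X.dchart x x v)) ∧ ∀ z ∈ S, dAt f z = 0 := by
  obtain ⟨f, h1, h2⟩ := exists_function x ξ hS hx
  refine ⟨f, h1, fun z hz => ?_⟩
  ext v
  rw [dAt_apply, h2 z hz]
  rfl

theorem dchart_injective (x : X) : Function.Injective (X.dchart x x) := by
  have h := (mdifferentiable_chart (I := 𝓘(ℝ, X.Model)) x).symm_comp_deriv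
    (mem_chart_source X.Model x)
  intro v w hvw
  exact (DFunLike.congr_fun h v).symm.trans ((congrArg (X.dchartSymm x (X.chart x x)) hvw).trans
    (DFunLike.congr_fun h w))

theorem dchart_surjective (x : X) : Function.Surjective (X.dchart x x) :=
  (mdifferentiable_chart (I := 𝓘(ℝ, X.Model)) x).mfderiv_surjective (mem_chart_source _ x)

/-- A tangent vector is determined by the differentials of functions. -/
theorem eq_zero_of_dAt (x : X) {v : X.T x} {S : Set X} (hS : S.Finite) (hx : x ∉ S)
    (h : ∀ f : Form X 0, (∀ z ∈ S, dAt f z = 0) → dAt f x v = 0) : v = 0 := by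
  refine dchart_injective x ?_
  rw [map_zero]
  by_contra hv
  obtain ⟨ξ, hξ⟩ := SeparatingDual.exists_ne_zero (R := ℝ) hv
  obtain ⟨f, h1, h2⟩ := exists_dAt x ξ hS hx
  exact hξ ((h1 v).symm.trans (h f h2))

theorem eq_of_dAt {x : X} {v w : X.T x} (h : ∀ f : Form X 0, dAt f x v = dAt f x w) : v = w :=
  sub_eq_zero.1 (eq_zero_of_dAt x Set.finite_empty (Set.notMem_empty x) fun f _ => by
    rw [map_sub, h f, sub_self])

theorem localForm_mulForm {q : ℕ} (f : Form X 0) (β : Form X q) (c : X) (y : X.Model)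
    (v : Fin q → X.Model) :
    localForm (mulForm f β).1 c y v = localForm f.1 c y 0 * localForm β.1 c y v := by
  have h : (fun i => X.dchartSymm c y ((0 : Fin 0 → X.Model) i)) = 0 := Subsingleton.elim _ _
  change f.1 ((X.chart c).symm y) 0 * _ =
    f.1 ((X.chart c).symm y) (fun i => X.dchartSymm c y ((0 : Fin 0 → X.Model) i)) * _
  rw [h]
  rfl

/-- A function is represented, near a point, by a globally defined smooth function on the model
space. -/
theorem exists_contDiff_localForm (f : Form X 0) (c : X) : ∃ F : X.Model → ℝ, ContDiff ℝ ∞ F ∧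
    ∀ᶠ y in 𝓝 (X.chart c c), localForm f.1 c y 0 = F y := by
  let χ : SmoothBumpFunction 𝓘(ℝ, X.Model) c := Classical.arbitrary _
  have hs : tsupport χ.toContDiffBump ⊆ (X.chart c).target := by
    rw [χ.toContDiffBump.tsupport_eq]
    intro y hy
    have := χ.closedBall_subset ⟨hy, by simp⟩
    simpa using this
  -- Outside the target of the chart the local expression has no meaning, but the bump function is
  -- supported inside the target, so the product is smooth everywhere.
  refine ⟨fun y => χ.toContDiffBump y * localForm f.1 c y 0, ?_, ?_⟩
  · rw [← contMDiff_iff_contDiff]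
    refine contMDiff_of_tsupport fun y hy => ?_
    have hy' := hs (tsupport_mul_subset_left hy)
    rw [contMDiffAt_iff_contDiffAt]
    exact χ.toContDiffBump.contDiff.contDiffAt.mul
      ((ContinuousAlternatingMap.apply ℝ X.Model ℝ (0 : Fin 0 → X.Model)).contDiff.contDiffAt.comp y
        (f.contDiffAt_localForm c hy'))
  · filter_upwards [χ.toContDiffBump.eventuallyEq_one] with y hy
    rw [hy]
    simp

theorem dAt_eq_fderiv {f : Form X 0} {c : X} {F : X.Model → ℝ}
    (h : ∀ᶠ y in 𝓝 (X.chart c c), localForm f.1 c y 0 = F y) (v : X.T c) :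
    dAt f c v = fderiv ℝ F (X.chart c c) (X.dchart c c v) := by
  have h1 : localForm f.1 c =ᶠ[𝓝 (X.chart c c)] fun y =>
      ContinuousAlternatingMap.constOfIsEmpty ℝ X.Model (Fin 0) (F y) := by
    filter_upwards [h] with y hy
    ext w
    rw [← Subsingleton.elim (0 : Fin 0 → X.Model) w, hy]
    rfl
  rw [dAt_apply]
  change extDeriv (localForm f.1 c) (X.chart c c) (fun _ => X.dchart c c v) = _
  rw [h1.extDeriv_eq, extDeriv_constOfIsEmpty]
  rfl

/-- The value of a derivation on a function at `x` depends only on the differential at `x`. -/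
theorem IsDerivation.map_function_mem_vanishing {l : ℤ} {D : Forms X →ₗ[ℝ] Forms X}
    (h : IsDerivation l D) {f : Form X 0} {x : X} (hf : dAt f x = 0) :
    D (homog 0 f) ∈ vanishing x := by
  obtain ⟨F, hF, hfF⟩ := exists_contDiff_localForm f x
  obtain ⟨H, hH, hH0, hFH⟩ := exists_hadamard hF (X.chart x x)
  have hH0' : H (X.chart x x) = 0 := by
    rw [hH0]
    ext v
    obtain ⟨w, rfl⟩ := dchart_surjective x v
    rw [← dAt_eq_fderiv hfF, hf]
    rfl
  let χ : SmoothBumpFunction 𝓘(ℝ, X.Model) x := Classical.arbitrary _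
  let b := Module.finBasis ℝ X.Model
  have s1 : ∀ j, ContDiff ℝ ∞ fun y => H y (b j) := fun j => hH.clm_apply contDiff_const
  have s2 : ∀ j, ContDiff ℝ ∞ fun y => b.equivFunL (y - X.chart x x) j := fun j =>
    contDiff_pi.1 (b.equivFunL.contDiff.comp (contDiff_id.sub contDiff_const)) j
  let a := fun j => bumpFun χ _ (s1 j)
  let a' := fun j => bumpFun χ _ (s2 j)
  -- Near `x`, Hadamard's lemma writes `f` as a constant plus products `a j · a' j` of functions
  -- both vanishing at `x`: `a' j` is a centred coordinate, and `a j` vanishes because `df` does.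
  -- Locality removes the remainder, and the Leibniz rule shows that `D` of each product vanishes at
  -- `x`.
  have hz : ∀ᶠ z in 𝓝 x, (f - F (X.chart x x) • oneForm X - ∑ j, mulForm (a j) (a' j)).1 z = 0 := by
    refine eventually_of_localForm ?_
    have e1 := Filter.eventually_all.2 fun j => eventually_localForm_bumpFun χ (s1 j)
    have e2 := Filter.eventually_all.2 fun j => eventually_localForm_bumpFun χ (s2 j)
    filter_upwards [hfF, e1, e2] with y h0 h1 h2
    have hl : ∀ g : Fin (Module.finrank ℝ X.Model) → Form X 0,
        localForm (∑ j, g j).1 x y 0 = ∑ j, localForm (g j).1 x y 0 := fun g =>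
      map_sum (⟨⟨fun g : Form X 0 => localForm g.1 x y 0, fun _ _ => rfl⟩, fun _ _ => rfl⟩ :
        Form X 0 →ₗ[ℝ] ℝ) g _
    ext w
    rw [← Subsingleton.elim (0 : Fin 0 → X.Model) w]
    change localForm f.1 x y 0 - F (X.chart x x) * 1 -
      localForm (∑ j, mulForm (a j) (a' j)).1 x y 0 = 0
    rw [hl, h0, hFH y]
    have : ∀ j, localForm (mulForm (a j) (a' j)).1 x y 0 =
        b.equivFunL (y - X.chart x x) j • H y (b j) := fun j => by
      rw [localForm_mulForm, h1 j, h2 j, smul_eq_mul, mul_comm]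
      rfl
    simp only [this]
    rw [mul_one, add_sub_cancel_left, sub_eq_zero]
    conv_lhs => rw [← b.sum_equivFun (y - X.chart x x)]
    rw [map_sum]
    simp only [map_smul]
    rfl
  have h1 := h.map_mem_vanishing hz
  simp only [map_sub, map_smul, map_sum, h.map_one, smul_zero, sub_zero] at h1
  have h2 : ∑ j, D (homog 0 (mulForm (a j) (a' j))) ∈ vanishing x := by
    refine sum_mem fun j _ => ?_
    rw [h.map_mulForm]
    refine add_mem (wedgeProd_mem_vanishing_right _ (homog_mem_vanishing.2 ?_))
      (wedgeProd_mem_vanishing_left (homog_mem_vanishing.2 ?_) _)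
    · ext v
      rw [bumpFun_apply, sub_self]
      simp
    · ext v
      rw [bumpFun_apply, hH0']
      rfl
  simpa using add_mem h1 h2

end Locality

/-! ### The classification of derivations -/

section Classification

variable {X Y : Mfd.{u}}

theorem VForm.ext {k : ℕ} {K L : VForm X k} (h : ∀ x v, K.1 x v = L.1 x v) : K = L :=
  Subtype.ext (funext fun x => ContinuousAlternatingMap.ext (h x))

/-- A vector-valued form is smooth if its composition with the differentials of sufficiently many
functions is. -/
theorem smoothVForms_of_dAt {k : ℕ} {K : RawVForm X k}
    (h : ∀ (x : X) (v : X.T x), v ≠ 0 → ∃ f : Form X 0, dAt f x v ≠ 0 ∧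
      ∃ θ : Form X k, ∀ y w, θ.1 y w = dAt f y (K y w)) : K ∈ smoothVForms X k := by
  intro c y₀ hy₀
  refine ContDiffAt.contDiffWithinAt ?_
  let L : Form X 0 → X.Model → X.Model →L[ℝ] ℝ := fun f y =>
    (ContinuousAlternatingMap.ofSubsingletonLIE (𝕜 := ℝ) (E := X.Model) (F := ℝ) (0 : Fin 1)).symm
      (localForm (extD X 0 f).1 c y)
  have hL : ∀ f y v, L f y v = dAt f ((X.chart c).symm y) (X.dchartSymm c y v) :=
    fun f y v => rfl
  have hLs : ∀ f, ContDiffAt ℝ ∞ (L f) y₀ := fun f =>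
    (ContinuousAlternatingMap.ofSubsingletonLIE (𝕜 := ℝ) (E := X.Model) (F := ℝ)
      (0 : Fin 1)).symm.contDiff.contDiffAt.comp y₀ ((extD X 0 f).contDiffAt_localForm c hy₀)
  -- The covectors at `y₀` which are differentials of functions `f` for which `df ∘ K` is smooth. By
  -- hypothesis they annihilate no non-zero vector, so they are all covectors, and functions with
  -- the coordinate forms as differentials at `y₀` can be chosen.
  let W : Submodule ℝ (Module.Dual ℝ X.Model) :=
    { carrier := {ξ | ∃ f : Form X 0, (∀ v, L f y₀ v = ξ v) ∧
        ∃ θ : Form X k, ∀ y w, θ.1 y w = dAt f y (K y w)}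
      zero_mem' := ⟨0, fun v => by
        rw [hL]; exact DFunLike.congr_fun (map_zero (dAtLinear ((X.chart c).symm y₀))) _, 0,
        fun y w => (DFunLike.congr_fun (map_zero (dAtLinear y)) (K y w)).symm⟩
      add_mem' := by
        rintro ξ ξ' ⟨f, h1, θ, h2⟩ ⟨f', h1', θ', h2'⟩
        refine ⟨f + f', fun v => ?_, θ + θ', fun y w => ?_⟩
        · rw [hL, dAt_add, LinearMap.add_apply, ← h1, ← h1', hL, hL]; rfl
        · rw [dAt_add]; exact congrArg₂ (· + ·) (h2 y w) (h2' y w)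
      smul_mem' := by
        rintro r ξ ⟨f, h1, θ, h2⟩
        refine ⟨r • f, fun v => ?_, r • θ, fun y w => ?_⟩
        · rw [hL, dAt_smul, LinearMap.smul_apply, ← h1, hL]; rfl
        · rw [dAt_smul]; exact congrArg (r • ·) (h2 y w) }
  have hW : W = ⊤ := by
    have h1 : W.dualCoannihilator = ⊥ := by
      rw [eq_bot_iff]
      intro v hv
      rw [Submodule.mem_dualCoannihilator] at hv
      rw [Submodule.mem_bot]
      by_contra hne
      have hne' : X.dchartSymm c y₀ v ≠ 0 := fun h0 => hne <| by
        rw [← dchart_dchartSymm c hy₀ v]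
        exact (congrArg _ h0).trans (map_zero _)
      obtain ⟨f, hf, θ, hθ⟩ := h _ _ hne'
      exact hf (hv (L f y₀).toLinearMap ⟨f, fun _ => rfl, θ, hθ⟩)
    rw [← Subspace.dualCoannihilator_dualAnnihilator_eq (W := W), h1,
      Submodule.dualAnnihilator_bot]
  let b := Module.finBasis ℝ X.Model
  have hj : ∀ j, b.coord j ∈ W := fun j => hW ▸ Submodule.mem_top
  choose f hf θ hθ using hj
  -- The matrix of the differentials of the chosen functions. It is the identity at `y₀`, hence
  -- invertible nearby, and `B · K` has the smooth components `θ j`; so `K` is `B⁻¹` applied to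
  -- smooth data.
  let B : X.Model → X.Model →L[ℝ] X.Model := fun y => ∑ j, (L (f j) y).smulRight (b j)
  have hB : ContDiffAt ℝ ∞ B y₀ :=
    ContDiffAt.sum fun j _ => (hLs (f j)).smulRight contDiffAt_const
  have hB0 : B y₀ = ((1 : (X.Model →L[ℝ] X.Model)ˣ) : X.Model →L[ℝ] X.Model) := by
    ext v
    simp only [B, _root_.sum_apply, ContinuousLinearMap.smulRight_apply, hf]
    exact b.sum_repr v
  have hinv : ContDiffAt ℝ ∞ (fun y => Ring.inverse (B y)) y₀ := by
    have h1 : ContDiffAt ℝ ∞ (Ring.inverse : (X.Model →L[ℝ] X.Model) → _) (B y₀) := by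
      rw [hB0]
      exact contDiffAt_ringInverse ℝ _
    exact ContDiffAt.comp y₀ h1 hB
  refine contDiffAt_alt_of_apply fun v => ?_
  have hR : ContDiffAt ℝ ∞ (fun y => ∑ j, localForm (θ j).1 c y v • b j) y₀ :=
    ContDiffAt.sum fun j _ => (contDiffAt_alt_apply (v := fun _ => v)
      ((θ j).contDiffAt_localForm c hy₀) fun _ => contDiffAt_const).smul contDiffAt_const
  refine (hinv.clm_apply hR).congr_of_eventuallyEq ?_
  have hunit : ∀ᶠ y in 𝓝 y₀, IsUnit (B y) := by
    refine hB.continuousAt.eventually ?_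
    rw [hB0]
    exact Units.nhds _
  filter_upwards [hunit, (X.chart c).open_target.mem_nhds hy₀] with y hy hy'
  have e : ∑ j, localForm (θ j).1 c y v • b j = B y (localVForm K c y v) := by
    simp only [B, _root_.sum_apply, ContinuousLinearMap.smulRight_apply]
    refine Finset.sum_congr rfl fun j _ => ?_
    congr 1
    rw [hL]
    refine (hθ j _ _).trans ?_
    congr 1
    exact (dchartSymm_dchart c hy' _).symm
  rw [e]
  have := Ring.inverse_mul_cancel (B y) hy
  exact (DFunLike.congr_fun this (localVForm K c y v)).symm

/-- Euler's identity `∑ ξ_j ∧ ι_{e_j} θ = (deg θ) θ`: the sum over `j` rebuilds the vector put into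
the first slot of `θ`, so that each permutation contributes the same value. It expresses any form of
positive degree through one-forms. -/
theorem sum_wedgeAt_curryLeft {V : Type*} [NormedAddCommGroup V] [NormedSpace ℝ V] {ι : Type*}
    [Fintype ι] {q : ℕ} (e : ι → V) (ξ : ι → V [⋀^Fin 1]→L[ℝ] ℝ)
    (h : ∀ v : V, ∑ j, ξ j (fun _ => v) • e j = v) (θ : V [⋀^Fin (q + 1)]→L[ℝ] ℝ)
    (v : Fin (1 + q) → V) :
    ∑ j, wedgeAt (ξ j) (θ.curryLeft (e j)) v =
      (q + 1) * θ fun i => v (Fin.cast (Nat.add_comm q 1) i) := by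
  have h1 : ∀ σ : Equiv.Perm (Fin (1 + q)), ∑ j, (ξ j (fun i => v (σ (Fin.castAdd q i))) *
      θ.curryLeft (e j) (fun i => v (σ (Fin.natAdd 1 i)))) =
        θ fun i => v (σ (Fin.cast (Nat.add_comm q 1) i)) := fun σ => by
    have e2 : (fun i => v (σ (Fin.cast (Nat.add_comm q 1) i))) =
        Fin.cons (v (σ (Fin.castAdd q 0))) fun i => v (σ (Fin.natAdd 1 i)) := by
      funext i
      induction i using Fin.cases with
      | zero => rfl
      | succ i =>
        rw [Fin.cons_succ]
        congr 2
        ext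
        simp [add_comm]
    have e3 : ∀ w : V, θ (Fin.cons w fun i => v (σ (Fin.natAdd 1 i))) =
        θ.curryLeft w fun i => v (σ (Fin.natAdd 1 i)) := fun w => rfl
    rw [e2, e3]
    conv_rhs => rw [← h (v (σ (Fin.castAdd q 0)))]
    rw [map_sum]
    simp only [map_smul, ContinuousAlternatingMap.sum_apply, ContinuousAlternatingMap.smul_apply,
      smul_eq_mul]
    refine Finset.sum_congr rfl fun j _ => ?_
    congr 2
    funext i
    rw [Fin.fin_one_eq_zero i]
  simp only [wedgeAt_apply]
  rw [← Finset.mul_sum, Finset.sum_comm]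
  simp only [← Finset.mul_sum, h1]
  have h2 : ∀ σ : Equiv.Perm (Fin (1 + q)), ((Equiv.Perm.sign σ : ℤ) : ℝ) *
      θ (fun i => v (σ (Fin.cast (Nat.add_comm q 1) i))) =
        θ fun i => v (Fin.cast (Nat.add_comm q 1) i) := fun σ => by
    let τ : Equiv.Perm (Fin (q + 1)) := (finCongr (Nat.add_comm q 1)).symm.permCongr σ
    have h3 := θ.toAlternatingMap.map_perm (fun i => v (Fin.cast (Nat.add_comm q 1) i)) τ
    have h4 : Equiv.Perm.sign τ = Equiv.Perm.sign σ := Equiv.Perm.sign_permCongr _ _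
    have h5 : ((fun i => v (Fin.cast (Nat.add_comm q 1) i)) ∘ τ) =
        fun i => v (σ (Fin.cast (Nat.add_comm q 1) i)) := rfl
    rw [h4, h5] at h3
    have h6 : θ (fun i => v (σ (Fin.cast (Nat.add_comm q 1) i))) =
      Equiv.Perm.sign σ • θ fun i => v (Fin.cast (Nat.add_comm q 1) i) := h3
    rw [h6, Units.smul_def, zsmul_eq_mul, ← mul_assoc, ← Int.cast_mul, ← Units.val_mul,
      Int.units_mul_self]
    simp
  simp only [h2, Finset.sum_const, Finset.card_univ, Fintype.card_perm, Fintype.card_fin,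
    nsmul_eq_mul]
  have h3 : (1 + q).factorial = (q + 1) * q.factorial := by
    rw [Nat.add_comm 1 q, Nat.factorial_succ]
  rw [h3]
  have : (q.factorial : ℝ) ≠ 0 := by exact_mod_cast q.factorial_ne_zero
  push_cast
  field_simp
  simp

/-- A derivation which commutes with `d` and vanishes on functions is zero. -/
theorem IsDerivation.eq_zero {l : ℤ} {D : Forms X →ₗ[ℝ] Forms X} (h : IsDerivation l D)
    (hd : CommutesD l D) (h0 : ∀ f : Form X 0, D (homog 0 f) = 0) : D = 0 := by
  refine Forms.hom_ext fun q => ?_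
  induction q with
  | zero => exact h0
  | succ q ih =>
    intro η
    refine eq_zero_of_mem_vanishing fun x => ?_
    let χ : SmoothBumpFunction 𝓘(ℝ, X.Model) x := Classical.arbitrary _
    let b := Module.finBasis ℝ X.Model
    let g := fun j => bumpFun χ (fun y => b.equivFunL y j)
      (contDiff_pi.1 b.equivFunL.contDiff j)
    have hβ : ∀ j, ContDiffOn ℝ ∞ (fun y => (localForm η.1 x y).curryLeft (b j))
        (X.chart x).target := fun j y hy =>
      (contDiffAt_alt_of_apply fun v => contDiffAt_alt_apply
        (v := fun _ => Fin.cons (b j) v)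
        (η.contDiffAt_localForm x hy) fun _ => contDiffAt_const).contDiffWithinAt
    let β := fun j => bumpForm χ _ (hβ j)
    -- Near `x`, `η` equals `(q+1)⁻¹ ∑ dg_j ∧ β_j`, with `g_j` the cut-off coordinates and `β_j` the
    -- cut-off contractions of `η` with the coordinate vectors.
    have hz : ∀ᶠ z in 𝓝 x, (castForm (Nat.add_comm q 1) η - ((q : ℝ) + 1)⁻¹ •
        ∑ j, wedge X 1 q (extD X 0 (g j)) (β j)).1 z = 0 := by
      refine eventually_of_localForm ?_
      have e1 := Filter.eventually_all.2 fun j => eventually_localForm_extD_bumpFun χ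
        (contDiff_pi.1 b.equivFunL.contDiff j)
      have e2 := Filter.eventually_all.2 fun j => eventually_localForm_bumpForm χ (hβ j)
      filter_upwards [e1, e2] with y h1 h2
      ext v
      have hl : ∀ g : Fin (Module.finrank ℝ X.Model) → Form X (1 + q),
          localForm (∑ j, g j).1 x y v = ∑ j, localForm (g j).1 x y v := fun g =>
        map_sum (⟨⟨fun g : Form X (1 + q) => localForm g.1 x y v, fun _ _ => rfl⟩,
          fun _ _ => rfl⟩ : Form X (1 + q) →ₗ[ℝ] ℝ) g _
      change localForm (castForm (Nat.add_comm q 1) η).1 x y v - ((q : ℝ) + 1)⁻¹ *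
        localForm (∑ j, wedge X 1 q (extD X 0 (g j)) (β j)).1 x y v = 0
      rw [hl, localForm_castForm]
      simp only [localForm_wedge]
      have h3 : ∀ j, localForm (β j).1 x y = (localForm η.1 x y).curryLeft (b j) := h2
      simp only [h3]
      rw [sum_wedgeAt_curryLeft (fun j => b j) (fun j => localForm (extD X 0 (g j)).1 x y)]
      · have : (q : ℝ) + 1 ≠ 0 := by positivity
        field_simp
        simp
      · intro w
        conv_rhs => rw [← b.sum_equivFun w]
        refine Finset.sum_congr rfl fun j _ => ?_
        congr 1
        refine (h1 j fun _ => w).trans ?_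
        have : (fun y => b.equivFunL y j) =
            ((ContinuousLinearMap.proj j ∘L b.equivFunL.toContinuousLinearMap) :
              X.Model →L[ℝ] ℝ) := rfl
        rw [this, ContinuousLinearMap.fderiv]
        rfl
    have h1 := h.map_mem_vanishing hz
    -- `D` kills `dg_j`, being `± d (D g_j)`, and kills `β_j` by induction on the degree.
    have h2 : ∀ j, D (homog (1 + q) (wedge X 1 q (extD X 0 (g j)) (β j))) = 0 := fun j => by
      rw [← wedgeProd_homog, h.leibniz, ih (β j)]
      have h3 : D (homog 1 (extD X 0 (g j))) = 0 := by
        have := hd (homog 0 (g j))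
        rwa [dR_homog, h0, map_zero, smul_zero] at this
      rw [h3]
      simp
    simpa only [map_sub, map_smul, map_sum, h2, Finset.sum_const_zero, smul_zero, sub_zero,
      homog_castForm] using h1

theorem IsDerivation.eq_zero_of_neg {l : ℤ} (hl : l < 0) {D : Forms X →ₗ[ℝ] Forms X}
    (h : IsDerivation l D) (hd : CommutesD l D) : D = 0 :=
  h.eq_zero hd fun f => (h.isHomog (isHomog_homog 0 f)).eq_zero (by simpa using hl)

theorem comp_lieD_function {k : ℕ} (K : VForm X k) (f : Form X 0) (x : X) (v : Fin k → X.T x) :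
    (comp k (lieD K (homog 0 f))).1 x v = sgn k * dAt f x (K.1 x v) := by
  rw [lieD_function, map_smul, comp_homog, dAt_apply, ← ins_extD_apply]
  rfl

theorem lieD_injective {k : ℕ} : Function.Injective (lieD : VForm X k → _) := by
  intro K L h
  refine VForm.ext fun x v => eq_of_dAt fun f => ?_
  have h1 := comp_lieD_function K f x v
  rw [h, comp_lieD_function] at h1
  have : sgn k ≠ 0 := fun h0 => by simpa [h0] using sgn_mul_self k
  exact (mul_left_cancel₀ this h1).symm

/-- A derivation of degree `k ≥ 0` which commutes with `d` is a Lie derivative. -/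
theorem IsDerivation.exists_eq_lieD {k : ℕ} {D : Forms X →ₗ[ℝ] Forms X}
    (h : IsDerivation (k : ℤ) D) (hd : CommutesD (k : ℤ) D) : ∃ K : VForm X k, D = lieD K := by
  let b := Module.finBasis ℝ X.Model
  let χ : ∀ x : X, SmoothBumpFunction 𝓘(ℝ, X.Model) x := fun x => Classical.arbitrary _
  let g : ∀ (_ : X) (_ : Fin (Module.finrank ℝ X.Model)), Form X 0 := fun x j =>
    bumpFun (χ x) (fun y => b.equivFunL y j) (contDiff_pi.1 b.equivFunL.contDiff j)
  have hg : ∀ x j v, dAt (g x j) x v = b.equivFunL (X.dchart x x v) j := fun x j v => by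
    rw [dAt_apply, extD_bumpFun_apply]
    have : (fun y => b.equivFunL y j) =
        ((ContinuousLinearMap.proj j ∘L b.equivFunL.toContinuousLinearMap) :
          X.Model →L[ℝ] ℝ) := rfl
    rw [this, ContinuousLinearMap.fderiv]
    rfl
  choose e he using fun (x : X) j => dchart_surjective x (b j)
  have hge : ∀ x v, ∑ j, dAt (g x j) x v • e x j = v := fun x v => by
    refine dchart_injective x ?_
    rw [map_sum]
    simp only [hg, map_smul, he]
    exact b.sum_equivFun _
  -- The form is read off from the cut-off coordinates `g x j` and the dual frame `e x j` at the
  -- single point `x`; the sign is that of `lieD_function`. Smoothness in `x` is not visible here.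
  let K : RawVForm X k := fun x => sgn k • ∑ j,
    (ContinuousLinearMap.toSpanSingleton ℝ (e x j)).compContinuousAlternatingMap
      ((comp k (D (homog 0 (g x j)))).1 x)
  have hK : ∀ (f : Form X 0) x v, (comp k (D (homog 0 f))).1 x v = sgn k * dAt f x (K x v) := by
    intro f x v
    -- Subtracting the linear part of `f` leaves a function with zero differential at `x`, to which
    -- `D` assigns a form vanishing at `x`; so `D f` at `x` is determined by the `D (g x j)`.
    have h1 : dAt (f - ∑ j, dAt f x (e x j) • g x j) x = 0 := by
      change dAtLinear x (f - ∑ j, dAt f x (e x j) • g x j) = 0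
      rw [map_sub, map_sum, sub_eq_zero]
      ext w
      change dAt f x w = _
      conv_lhs => rw [← hge x w]
      rw [map_sum]
      simp only [map_smul, _root_.sum_apply]
      refine Finset.sum_congr rfl fun j _ => ?_
      rw [smul_eq_mul, mul_comm]
      rfl
    have h2 := h.map_function_mem_vanishing h1 k
    simp only [map_sub, map_sum, map_smul] at h2
    have h3 : (comp k (D (homog 0 f))).1 x v =
        (∑ j, dAt f x (e x j) • comp k (D (homog 0 (g x j)))).1 x v :=
      sub_eq_zero.1 (DFunLike.congr_fun h2 v)
    have hl : ∀ g : Fin (Module.finrank ℝ X.Model) → Form X k,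
        (∑ j, g j).1 x v = ∑ j, (g j).1 x v := fun g =>
      map_sum (⟨⟨fun g : Form X k => g.1 x v, fun _ _ => rfl⟩, fun _ _ => rfl⟩ :
        Form X k →ₗ[ℝ] ℝ) g _
    rw [h3, hl]
    have h4 : K x v = sgn k • ∑ j, (comp k (D (homog 0 (g x j)))).1 x v • e x j := by
      simp only [K, ContinuousAlternatingMap.smul_apply, ContinuousAlternatingMap.sum_apply]
      rfl
    rw [h4, map_smul, smul_eq_mul, ← mul_assoc, sgn_mul_self, one_mul, map_sum]
    refine Finset.sum_congr rfl fun j _ => ?_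
    rw [map_smul, smul_eq_mul, mul_comm]
    rfl
  -- For every `f` the composite `df ∘ K` is, up to sign, the smooth form `D f`.
  have hKs : K ∈ smoothVForms X k := by
    refine smoothVForms_of_dAt fun x v hv => ?_
    obtain ⟨f, hf⟩ : ∃ f : Form X 0, dAt f x v ≠ 0 := by
      by_contra! hc
      exact hv (eq_of_dAt fun f => by rw [hc f, map_zero])
    refine ⟨f, hf, sgn k • comp k (D (homog 0 f)), fun y w => ?_⟩
    change sgn k * (comp k (D (homog 0 f))).1 y w = _
    rw [hK, ← mul_assoc, sgn_mul_self, one_mul]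
  refine ⟨⟨K, hKs⟩, ?_⟩
  rw [← sub_eq_zero]
  refine (h.sub (isDerivation_lieD _)).eq_zero (hd.sub (commutesD_lieD _)) fun f => ?_
  rw [LinearMap.sub_apply, sub_eq_zero]
  have h1 := h.isHomog (isHomog_homog 0 f)
  have h2 := (isDerivation_lieD ⟨K, hKs⟩).isHomog (isHomog_homog 0 f)
  rw [Nat.cast_zero, zero_add] at h1 h2
  rw [h1.exists_eq, h2.exists_eq]
  exact congrArg _ (Form.ext fun x v => (hK f x v).trans
    (comp_lieD_function ⟨K, hKs⟩ f x v).symm)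

end Classification

/-! ### Tangent maps and related forms -/

section Tangent

variable {X Y Z : Mfd.{u}}

/-- The tangent map, with all tangent spaces identified with the model spaces. -/
def tm (f : X → Y) (x : X) : X.Model →L[ℝ] Y.Model := tmap f x

/-- The value at `x` of a vector-valued form, as an alternating map on the model space. -/
def vat {k : ℕ} (K : VForm X k) (x : X) : X.Model [⋀^Fin k]→L[ℝ] X.Model := K.1 x

/-- The differential at `x` of a function, as a linear form on the model space. -/
def dm (f : Form X 0) (x : X) : X.Model →L[ℝ] ℝ := dAt f x

theorem related_iff {f : X → Y} {k : ℕ} {K : VForm X k} {L : VForm Y k} : Related f K L ↔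
    ∀ x v, vat L (f x) (fun i => tm f x (v i)) = tm f x (vat K x v) := Iff.rfl

theorem VForm.ext_vat {k : ℕ} {K L : VForm X k} (h : ∀ x v, vat K x v = vat L x v) : K = L :=
  VForm.ext h

theorem tm_comp {g : Y → Z} {f : X → Y} (hg : IsSmooth g) (hf : IsSmooth f) (x : X) (v : X.Model) :
    tm (fun y => g (f y)) x v = tm g (f x) (tm f x v) := by
  have h := mfderiv_comp x (hg.mdifferentiableAt (by simp) : MDifferentiableAt 𝓘(ℝ, Y.Model)
    𝓘(ℝ, Z.Model) g (f x)) (hf.mdifferentiableAt (by simp))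
  exact DFunLike.congr_fun h v

theorem tm_id (x : X) (v : X.Model) : tm (fun y : X => y) x v = v := by
  have h : tmap (fun y : X => y) x = ContinuousLinearMap.id ℝ _ := mfderiv_id
  exact DFunLike.congr_fun h v

theorem dm_pullback (f : SMap X Y) (φ : Form Y 0) (x : X) (v : X.Model) :
    dm (pullback f 0 φ) x v = dm φ (f x) (tm f x v) := dAt_pullback f φ x v

theorem eq_of_dm {x : X} {v w : X.Model} (h : ∀ f : Form X 0, dm f x v = dm f x w) : v = w :=
  eq_of_dAt (v := (v : X.T x)) (w := (w : X.T x)) h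

theorem Related.comp {g : Y → Z} {f : X → Y} {k : ℕ} {K : VForm X k} {L : VForm Y k}
    {N : VForm Z k} (hg : Related g L N) (hf : Related f K L) (sg : IsSmooth g) (sf : IsSmooth f) :
    Related (fun x => g (f x)) K N := by
  rw [related_iff] at hg hf ⊢
  intro x v
  simp only [tm_comp sg sf]
  rw [hg, hf]

/-- A linear left inverse of the injective map `v ↦ (A i v)_i` lifts all the `L i` at once, and
being linear it keeps the lift alternating. -/
theorem exists_alt_lift {ι : Type*} [Fintype ι] {V W : Type*} [NormedAddCommGroup V]
    [NormedSpace ℝ V] [FiniteDimensional ℝ V] [NormedAddCommGroup W] [NormedSpace ℝ W]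
    [FiniteDimensional ℝ W] {k : ℕ} (A : ι → V →L[ℝ] W) (hA : ∀ v, (∀ i, A i v = 0) → v = 0)
    (L : ι → V [⋀^Fin k]→L[ℝ] W) (h : ∀ v, ∃ w, ∀ i, A i w = L i v) :
    ∃ K : V [⋀^Fin k]→L[ℝ] V, ∀ i v, A i (K v) = L i v := by
  let A' : V →ₗ[ℝ] ι → W := LinearMap.pi fun i => (A i).toLinearMap
  have hA' : LinearMap.ker A' = ⊥ := LinearMap.ker_eq_bot'.2 fun v hv => hA v fun i => congrFun hv i
  obtain ⟨B, hB⟩ := LinearMap.exists_leftInverse_of_injective A' hA'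
  refine ⟨B.toContinuousLinearMap.compContinuousAlternatingMap (ContinuousAlternatingMap.pi L),
    fun i v => ?_⟩
  obtain ⟨w, hw⟩ := h v
  have e : (ContinuousAlternatingMap.pi L) v = A' w := funext fun i => (hw i).symm
  change A i (B ((ContinuousAlternatingMap.pi L) v)) = _
  rw [e, ← hw i]
  exact congrArg (A i) (LinearMap.congr_fun hB w)

/-- A vector-valued form on `X` which is related to given forms, for a family of maps whose tangent
maps are jointly injective. -/
theorem exists_related {ι : Type*} [Fintype ι] (a : ι → SMap X Y) {k : ℕ} (K : VForm Y k)
    (ha : ∀ x v, (∀ i, tm (a i) x v = 0) → v = 0)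
    (h : ∀ x (v : Fin k → X.Model), ∃ w, ∀ i,
      tm (a i) x w = vat K (a i x) fun j => tm (a i) x (v j)) :
    ∃ L : VForm X k, ∀ i, Related (a i) L K := by
  choose L hL using fun x => exists_alt_lift (fun i => tm (a i) x) (ha x)
    (fun i => (vat K (a i x)).compContinuousLinearMap (tm (a i) x)) (h x)
  have hLs : (L : RawVForm X k) ∈ smoothVForms X k := by
    refine smoothVForms_of_dAt fun x v hv => ?_
    obtain ⟨i, hi⟩ : ∃ i, tm (a i) x v ≠ 0 := by
      by_contra! hc
      exact hv (ha x v hc)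
    obtain ⟨f, hf⟩ : ∃ f : Form Y 0, dm f (a i x) (tm (a i) x v) ≠ 0 := by
      by_contra! hc
      exact hi (eq_of_dm fun f => by rw [hc f, map_zero])
    refine ⟨pullback (a i) 0 f, ?_, pullback (a i) k (ins K 0 (extD Y 0 f)), fun y w => ?_⟩
    · rwa [dAt_pullback]
    · rw [dAt_pullback]
      refine (ins_extD_apply K f (a i y) _).trans ?_
      exact congrArg (dm f (a i y)) (hL y i w).symm
  exact ⟨⟨L, hLs⟩, fun i => related_iff.2 fun x v => (hL x i v).symm⟩

/-- Relatedness for a map into a manifold with a family of maps with jointly injective tangent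
maps. -/
theorem related_of_comp {ι : Type*} {a : ι → X → Y} (sa : ∀ i, IsSmooth (a i)) {k : ℕ}
    {K : VForm Y k} {L : VForm X k} (ha : ∀ x v, (∀ i, tm (a i) x v = 0) → v = 0)
    (hL : ∀ i, Related (a i) L K) {f : Z → X} (sf : IsSmooth f) {N : VForm Z k}
    (h : ∀ i, Related (fun z => a i (f z)) N K) : Related f N L := by
  rw [related_iff]
  intro z v
  rw [← sub_eq_zero]
  refine ha (f z) _ fun i => ?_
  have h1 := related_iff.1 (hL i) (f z) fun j => tm f z (v j)
  have h2 := related_iff.1 (h i) z v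
  simp only [tm_comp (sa i) sf] at h2
  rw [map_sub, ← h1, ← h2, sub_self]

end Tangent

/-! ### Tangent spaces of fibre products -/

section FibreTangent

variable {P G M : Mfd.{u}} {f : P → M} {t : G → M} {S : Type u} [TopologicalSpace S]

/-- Elements of the maximal atlas are diffeomorphisms. -/
theorem mdifferentiable_of_mem {X : Mfd.{u}} {e : OpenPartialHomeomorph X X.Model}
    (he : e ∈ IsManifold.maximalAtlas 𝓘(ℝ, X.Model) ∞ X) :
    e.MDifferentiable 𝓘(ℝ, X.Model) 𝓘(ℝ, X.Model) :=
  ⟨(contMDiffOn_of_mem_maximalAtlas he).mdifferentiableOn (by simp),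
    (contMDiffOn_symm_of_mem_maximalAtlas he).mdifferentiableOn (by simp)⟩

/-- The derivative of the domain chart of a `SubChart`. -/
def SubChart.ddom (c : SubChart t) (g : G) : G.Model →L[ℝ] G.Model :=
  mfderiv 𝓘(ℝ, G.Model) 𝓘(ℝ, G.Model) c.dom g

/-- The derivative of the codomain chart of a `SubChart`. -/
def SubChart.dcod (c : SubChart t) (x : M) : M.Model →L[ℝ] M.Model :=
  mfderiv 𝓘(ℝ, M.Model) 𝓘(ℝ, M.Model) c.cod x

theorem SubChart.hasMFDerivAt_dom (c : SubChart t) {g : G} (hg : g ∈ c.dom.source) :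
    HasMFDerivAt 𝓘(ℝ, G.Model) 𝓘(ℝ, G.Model) c.dom g (c.ddom g) :=
  ((mdifferentiable_of_mem c.dom_mem).mdifferentiableAt hg).hasMFDerivAt

theorem SubChart.ddom_injective (c : SubChart t) {g : G} (hg : g ∈ c.dom.source) :
    Function.Injective (c.ddom g) := (mdifferentiable_of_mem c.dom_mem).mfderiv_injective hg

/-- The derivative of `c.spec`. -/
theorem SubChart.lin_ddom_fst (c : SubChart t) (ht : IsSmooth t) {g : G} (hg : g ∈ c.dom.source)
    (v : G.Model) : (c.lin (c.ddom g v)).1 = c.dcod (t g) (tm t g v) := by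
  have h1 : HasMFDerivAt 𝓘(ℝ, G.Model) 𝓘(ℝ, M.Model) (fun g' => (c.lin (c.dom g')).1) g
      ((ContinuousLinearMap.fst ℝ M.Model (Fib G M) ∘L c.lin.toContinuousLinearMap) ∘L c.ddom g) :=
    ((ContinuousLinearMap.fst ℝ M.Model (Fib G M) ∘L
      c.lin.toContinuousLinearMap).hasFDerivAt.hasMFDerivAt).comp g (c.hasMFDerivAt_dom hg)
  have h2 : HasMFDerivAt 𝓘(ℝ, G.Model) 𝓘(ℝ, M.Model) (fun g' => c.cod (t g')) g
      (c.dcod (t g) ∘L tm t g) :=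
    (((mdifferentiable_of_mem c.cod_mem).mdifferentiableAt (c.maps g hg)).hasMFDerivAt).comp g
      ((ht.mdifferentiableAt (by simp)).hasMFDerivAt)
  have h3 : (fun g' => c.cod (t g')) =ᶠ[𝓝 g] fun g' => (c.lin (c.dom g')).1 := by
    filter_upwards [c.dom.open_source.mem_nhds hg] with g' hg'
    exact c.spec g' hg'
  have h4 := hasMFDerivAt_unique h1 (h2.congr_of_eventuallyEq h3.symm)
  exact DFunLike.congr_fun h4 v

variable (Q : FibPres f t S) (hf : IsSmooth f) (ht : IsSubm t) [T2Space S]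

theorem FibPres.dchart_eq (z : Q.mfd hf ht) (v : (Q.mfd hf ht).Model) :
    (Q.mfd hf ht).dchart z z v =
      ((P.dchart (Q.fst z) (Q.fst z) (tm (X := Q.mfd hf ht) Q.fst z v),
        ((ht.exists_subChart (Q.snd z)).choose.lin
          ((ht.exists_subChart (Q.snd z)).choose.ddom (Q.snd z)
            (tm (X := Q.mfd hf ht) Q.snd z v))).2) : P.Model × Fib G M) := by
  set c := (ht.exists_subChart (Q.snd z)).choose with hc
  have hcs : Q.snd z ∈ c.dom.source := (ht.exists_subChart (Q.snd z)).choose_spec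
  have h1 : HasMFDerivAt 𝓘(ℝ, (Q.mfd hf ht).Model) 𝓘(ℝ, P.Model)
      (fun z' : Q.mfd hf ht => P.chart (Q.fst z) (Q.fst z')) z
      ((P.dchart (Q.fst z) (Q.fst z)) ∘L tm (X := Q.mfd hf ht) Q.fst z) :=
    (mdiff_chart (Q.fst z) (mem_chart_source _ _)).hasMFDerivAt.comp z
      (((Q.smooth_fst hf ht).mdifferentiableAt (by simp)).hasMFDerivAt)
  have h2 : HasMFDerivAt 𝓘(ℝ, (Q.mfd hf ht).Model) 𝓘(ℝ, G.Model)
      (fun z' : Q.mfd hf ht => c.dom (Q.snd z')) z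
      (c.ddom (Q.snd z) ∘L tm (X := Q.mfd hf ht) Q.snd z) :=
    (c.hasMFDerivAt_dom hcs).comp z
      (((Q.smooth_snd hf ht).mdifferentiableAt (by simp)).hasMFDerivAt)
  have h3 : HasMFDerivAt 𝓘(ℝ, (Q.mfd hf ht).Model) 𝓘(ℝ, Fib G M)
      (fun z' : Q.mfd hf ht => (c.lin (c.dom (Q.snd z'))).2) z
      ((ContinuousLinearMap.snd ℝ M.Model (Fib G M) ∘L c.lin.toContinuousLinearMap) ∘L
        (c.ddom (Q.snd z) ∘L tm (X := Q.mfd hf ht) Q.snd z)) :=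
    ((ContinuousLinearMap.snd ℝ M.Model (Fib G M) ∘L
      c.lin.toContinuousLinearMap).hasFDerivAt.hasMFDerivAt).comp z h2
  have h0 := (mdiff_chart (X := Q.mfd hf ht) z (mem_chart_source _ z)).hasMFDerivAt
  have k1 : HasMFDerivAt 𝓘(ℝ, (Q.mfd hf ht).Model) 𝓘(ℝ, P.Model)
      (fun z' : Q.mfd hf ht => P.chart (Q.fst z) (Q.fst z')) z
      (ContinuousLinearMap.fst ℝ P.Model (Fib G M) ∘L (Q.mfd hf ht).dchart z z) :=
    ((ContinuousLinearMap.fst ℝ P.Model (Fib G M)).hasFDerivAt.hasMFDerivAt).comp z h0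
  have k3 : HasMFDerivAt 𝓘(ℝ, (Q.mfd hf ht).Model) 𝓘(ℝ, Fib G M)
      (fun z' : Q.mfd hf ht => (c.lin (c.dom (Q.snd z'))).2) z
      (ContinuousLinearMap.snd ℝ P.Model (Fib G M) ∘L (Q.mfd hf ht).dchart z z) :=
    ((ContinuousLinearMap.snd ℝ P.Model (Fib G M)).hasFDerivAt.hasMFDerivAt).comp z h0
  exact Prod.ext (DFunLike.congr_fun (hasMFDerivAt_unique k1 h1) v)
    (DFunLike.congr_fun (hasMFDerivAt_unique k3 h3) v)

/-- By `FibPres.dchart_eq` the derivative of the chart depends only on the two projections of a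
tangent vector, and it is injective. -/
theorem FibPres.tm_injective (z : Q.mfd hf ht) {v : (Q.mfd hf ht).Model}
    (h1 : tm (X := Q.mfd hf ht) Q.fst z v = 0) (h2 : tm (X := Q.mfd hf ht) Q.snd z v = 0) :
    v = 0 := by
  refine dchart_injective (X := Q.mfd hf ht) z ?_
  refine (Q.dchart_eq hf ht z v).trans ?_
  rw [h1, h2]
  refine Eq.trans ?_ (map_zero ((Q.mfd hf ht).dchart z z)).symm
  rw [map_zero]
  erw [map_zero]
  simp
  rfl

/-- The tangent space of the fibre product is the fibre product of the tangent spaces. The chart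
sees all of `a` but only the fibre part of `b`; the part of `b` along `M` is forced by the condition
over `M`. -/
theorem FibPres.exists_tm (z : Q.mfd hf ht) (a : P.Model) (b : G.Model)
    (hab : tm f (Q.fst z) a = tm t (Q.snd z) b) : ∃ v : (Q.mfd hf ht).Model,
      tm (X := Q.mfd hf ht) Q.fst z v = a ∧ tm (X := Q.mfd hf ht) Q.snd z v = b := by
  set c := (ht.exists_subChart (Q.snd z)).choose with hc
  have hcs : Q.snd z ∈ c.dom.source := (ht.exists_subChart (Q.snd z)).choose_spec
  obtain ⟨v, hv⟩ := dchart_surjective (X := Q.mfd hf ht) z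
    ((P.dchart (Q.fst z) (Q.fst z) a, (c.lin (c.ddom (Q.snd z) b)).2) : P.Model × Fib G M)
  have h1 := (Q.dchart_eq hf ht z v).symm.trans hv
  have h2 : tm (X := Q.mfd hf ht) Q.fst z v = a :=
    dchart_injective (Q.fst z) (congrArg (Prod.fst : P.Model × Fib G M → _) h1)
  refine ⟨v, h2, c.ddom_injective hcs (c.lin.injective (Prod.ext ?_
    (congrArg (Prod.snd : P.Model × Fib G M → _) h1)))⟩
  rw [c.lin_ddom_fst ht.contMDiff hcs, c.lin_ddom_fst ht.contMDiff hcs, ← hab, ← h2]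
  have h3 := tm_comp (X := Q.mfd hf ht) ht.contMDiff (Q.smooth_snd hf ht) z v
  have h4 := tm_comp (X := Q.mfd hf ht) hf (Q.smooth_fst hf ht) z v
  have h5 : (fun y : Q.mfd hf ht => f (Q.fst y)) = fun y => t (Q.snd y) := funext Q.comm
  rw [h5] at h4
  exact congrArg _ (h3.symm.trans h4)

end FibreTangent

namespace SubmGraph

variable {Γ : SubmGraph.{u}}

/-- The string without its last arrow. -/
def initStr {p : ℕ} (x : Γ.nerve (p + 2)) : Γ.nerve (p + 1) := Str.init (Γ := Γ) x

theorem smooth_initStr {p : ℕ} : IsSmooth (initStr (Γ := Γ) (p := p)) :=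
  smooth_of_arrow fun i => smooth_arrow i.castSucc

theorem nerve_ext {p : ℕ} {x y : Γ.nerve (p + 1)} (h : ∀ i, arrow i x = arrow i y) : x = y :=
  Str.ext (Γ := Γ) (funext h)

theorem tm_arrow_castSucc {p : ℕ} (i : Fin (p + 1)) (x : Γ.nerve (p + 2)) (v) :
    tm (arrow i.castSucc) x v = tm (arrow i) (initStr x) (tm initStr x v) :=
  tm_comp (smooth_arrow i) smooth_initStr x v

/-- The tangent maps of the arrows of a string are jointly injective. -/
theorem eq_zero_of_tm_arrow : ∀ {p : ℕ} (x : Γ.nerve (p + 1)) (v : (Γ.nerve (p + 1)).Model),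
    (∀ i, tm (arrow i) x v = 0) → v = 0
  | 0, x, v, h => by
    refine FibPres.tm_injective Γ.basePres contMDiff_id Γ.subm_t x ?_ (h 0)
    have h1 := tm_comp Γ.smooth_t (smooth_arrow (Γ := Γ) (p := 0) 0) x v
    rw [h 0, map_zero] at h1
    exact h1
  | p + 1, x, v, h => by
    refine FibPres.tm_injective (Γ.strAtlas p).succPres (Γ.strAtlas p).smooth_lastSource Γ.subm_t x
      ?_ (h (Fin.last _))
    refine eq_zero_of_tm_arrow (p := p) (initStr x) (tm initStr x v) fun i => ?_
    rw [← tm_arrow_castSucc]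
    exact h _

theorem eq_of_tm_arrow {p : ℕ} {x y : Γ.nerve (p + 1)} (hxy : x = y)
    {v w : (Γ.nerve (p + 1)).Model} (h : ∀ i, tm (arrow i) x v = tm (arrow i) y w) : v = w := by
  subst hxy
  rw [← sub_eq_zero]
  exact eq_zero_of_tm_arrow x _ fun i => by rw [map_sub, h i, sub_self]

/-- Composable tangent vectors form a tangent vector of the manifold of strings. -/
theorem exists_tm_arrow : ∀ {p : ℕ} (x : Γ.nerve (p + 1)) (a : Fin (p + 1) → Γ.G.Model),
    (∀ i j : Fin (p + 1), (i : ℕ) + 1 = j →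
      tm Γ.s (arrow i x) (a i) = tm Γ.t (arrow j x) (a j)) → ∃ v, ∀ i, tm (arrow i) x v = a i
  | 0, x, a, _ => by
    obtain ⟨v, -, hv⟩ := FibPres.exists_tm Γ.basePres contMDiff_id Γ.subm_t x
      (tm Γ.t (arrow 0 x) (a 0)) (a 0) (tm_id _ _)
    exact ⟨v, fun i => by rw [Fin.fin_one_eq_zero i]; exact hv⟩
  | p + 1, x, a, h => by
    obtain ⟨w, hw⟩ := exists_tm_arrow (p := p) (initStr x) (fun i => a i.castSucc)
      fun i j hij => h i.castSucc j.castSucc hij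
    obtain ⟨v, h1, h2⟩ := FibPres.exists_tm (Γ.strAtlas p).succPres
      (Γ.strAtlas p).smooth_lastSource Γ.subm_t x w (a (Fin.last _)) (by
        have h3 := tm_comp Γ.smooth_s (smooth_arrow (Γ := Γ) (Fin.last p)) (initStr x) w
        rw [hw] at h3
        exact h3.trans (h (Fin.last p).castSucc (Fin.last (p + 1)) (by simp)))
    refine ⟨v, fun i => ?_⟩
    induction i using Fin.lastCases with
    | last => exact h2
    | cast i =>
      exact (tm_arrow_castSucc i x v).trans ((congrArg _ h1).trans (hw i))

end SubmGraph

/-! ### The induced forms on the nerve -/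

namespace LieGroupoid

open SubmGraph

variable {𝒢 : LieGroupoid.{u}} {k : ℕ}

theorem tm_s_unit (x : 𝒢.M) (v : 𝒢.M.Model) : tm 𝒢.s (𝒢.unit x) (tm 𝒢.unit x v) = v := by
  have h := tm_comp 𝒢.smooth_s 𝒢.smooth_unit x v
  simp only [𝒢.s_unit] at h
  rw [← h, tm_id]

/-- The units are a section of `s`, so every tangent vector of `M` is the image of one of `G` and
`K` determines the base form. -/
theorem eq_of_related_source {K : VForm 𝒢.G k} {L L' : VForm 𝒢.M k} (h : Related 𝒢.s K L)
    (h' : Related 𝒢.s K L') : L = L' := by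
  refine VForm.ext_vat fun x v => ?_
  have h1 := related_iff.1 h (𝒢.unit x) fun i => tm 𝒢.unit x (v i)
  have h2 := related_iff.1 h' (𝒢.unit x) fun i => tm 𝒢.unit x (v i)
  simp only [tm_s_unit] at h1 h2
  rw [𝒢.s_unit] at h1 h2
  rw [h1, h2]

/-- The `i`-th arrow as a smooth map. -/
def arrowMap {p : ℕ} (i : Fin (p + 1)) : SMap (𝒢.nerve (p + 1)) 𝒢.G := ⟨arrow i, smooth_arrow i⟩

theorem tm_s_arrow {p : ℕ} (x : 𝒢.nerve (p + 1)) (i j : Fin (p + 1)) (h : (i : ℕ) + 1 = j) (v) :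
    tm 𝒢.s (arrow i x) (tm (arrow i) x v) = tm 𝒢.t (arrow j x) (tm (arrow j) x v) := by
  rw [← tm_comp 𝒢.smooth_s (smooth_arrow i), ← tm_comp 𝒢.smooth_t (smooth_arrow j)]
  have : (fun y : 𝒢.nerve (p + 1) => 𝒢.s (arrow i y)) = fun y => 𝒢.t (arrow j y) :=
    funext fun y => arrow_comp y i j h
  rw [this]

/-- Compatibility with `s` and `t` alone makes the values of `K` on the arrows of a tangent string
composable again, so they form a tangent string. Multiplication plays no role yet. -/
theorem exists_related_arrow {K : VForm 𝒢.G k} {L : VForm 𝒢.M k} (hs : Related 𝒢.s K L)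
    (ht : Related 𝒢.t K L) (p : ℕ) :
    ∃ N : VForm (𝒢.nerve (p + 1)) k, ∀ i : Fin (p + 1), Related (arrow i) N K := by
  refine exists_related (fun i => arrowMap i) K eq_zero_of_tm_arrow fun x v => ?_
  refine exists_tm_arrow x _ fun i j hij => ?_
  refine (related_iff.1 hs _ _).symm.trans (Eq.trans ?_ (related_iff.1 ht _ _))
  rw [arrow_comp x i j hij]
  exact congrArg _ (funext fun r => tm_s_arrow x i j hij _)

theorem exists_isInduced {K : VForm 𝒢.G k} {L : VForm 𝒢.M k} (h : Covers K L) :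
    ∃ Kbar : ∀ p, VForm (𝒢.nerve p) k, IsInduced K Kbar := by
  choose N hN using exists_related_arrow h.source h.target
  exact ⟨fun | 0 => L | p + 1 => N p, h, hN⟩

theorem related_to_nerve {p : ℕ} {Z : Mfd.{u}} {f : Z → 𝒢.nerve (p + 1)} (sf : IsSmooth f)
    {K : VForm 𝒢.G k} {N : VForm (𝒢.nerve (p + 1)) k} {L : VForm Z k}
    (hN : ∀ i : Fin (p + 1), Related (arrow i) N K)
    (h : ∀ i : Fin (p + 1), Related (fun z => arrow i (f z)) L K) : Related f L N :=
  related_of_comp (a := fun i : Fin (p + 1) => arrow i) (fun i => smooth_arrow i)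
    eq_zero_of_tm_arrow hN sf h

theorem vform_ext_arrow {p : ℕ} {K : VForm 𝒢.G k} {N N' : VForm (𝒢.nerve (p + 1)) k}
    (hN : ∀ i : Fin (p + 1), Related (arrow i) N K)
    (hN' : ∀ i : Fin (p + 1), Related (arrow i) N' K) : N = N' := by
  have h := related_to_nerve (f := fun x => x) contMDiff_id hN hN'
  refine VForm.ext_vat fun x v => ?_
  have h1 := related_iff.1 h x v
  simpa only [tm_id] using h1

theorem IsInduced.unique {K : VForm 𝒢.G k} {Kbar Kbar' : ∀ p, VForm (𝒢.nerve p) k}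
    (h : IsInduced K Kbar) (h' : IsInduced K Kbar') : Kbar = Kbar' := by
  funext p
  cases p with
  | zero => exact eq_of_related_source h.1.source h'.1.source
  | succ p => exact vform_ext_arrow (h.2 p) (h'.2 p)

theorem smooth_mulMap : IsSmooth 𝒢.mulMap := 𝒢.smooth_mul

/-- The tangent vector to `G^(2)` witnessing multiplicativity has the same two arrow components as
the value of `N`, hence equals it. -/
theorem related_mulMap {K : VForm 𝒢.G k} {L : VForm 𝒢.M k} (h : Covers K L)
    {N : VForm (𝒢.nerve 2) k} (hN : ∀ i : Fin 2, Related (arrow i) N K) :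
    Related 𝒢.mulMap N K := by
  rw [related_iff]
  intro x v
  obtain ⟨w, h0, h1, h2⟩ := h.mul x (fun i => tm (arrow 0) x (v i)) (fun i => tm (arrow 1) x (v i))
    (fun i => tm 𝒢.mulMap x (v i)) fun i => ⟨v i, rfl, rfl, rfl⟩
  have e : w = vat N x v := by
    refine eq_of_tm_arrow (Γ := 𝒢.toSubmGraph) (p := 1) (x := x) rfl fun i => ?_
    rw [← related_iff.1 (hN i)]
    fin_cases i
    · exact h0
    · exact h1
  rw [← e]
  exact h2.symm

theorem mul_of_related {K : VForm 𝒢.G k} {N : VForm (𝒢.nerve 2) k}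
    (hN : ∀ i : Fin 2, Related (arrow i) N K) (hm : Related 𝒢.mulMap N K) (x : 𝒢.nerve 2)
    (X : Fin k → 𝒢.G.T (arrow 0 x)) (Y : Fin k → 𝒢.G.T (arrow 1 x))
    (Z : Fin k → 𝒢.G.T (𝒢.mulMap x)) (h : ∀ i, IsTangentMul x (X i) (Y i) (Z i)) :
    IsTangentMul x (K.1 _ X) (K.1 _ Y) (K.1 _ Z) := by
  choose w h0 h1 h2 using h
  obtain rfl : (fun i => tmap (arrow 0) x (w i)) = X := funext h0
  obtain rfl : (fun i => tmap (arrow 1) x (w i)) = Y := funext h1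
  obtain rfl : (fun i => tmap 𝒢.mulMap x (w i)) = Z := funext h2
  exact ⟨N.1 x w, (hN 0 x w).symm, (hN 1 x w).symm, (hm x w).symm⟩

/-- The pair of two composable maps. -/
def pairMap {Y : Mfd.{u}} (a b : Y → 𝒢.G) (h : ∀ y, 𝒢.s (a y) = 𝒢.t (b y)) (y : Y) : 𝒢.nerve 2 :=
  pairOf (a y) (b y) (h y)

theorem mulMap_pairMap {Y : Mfd.{u}} (a b : Y → 𝒢.G) (h : ∀ y, 𝒢.s (a y) = 𝒢.t (b y)) (y : Y) :
    𝒢.mulMap (pairMap a b h y) = 𝒢.mul (a y) (b y) := rfl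

theorem smooth_pairMap {Y : Mfd.{u}} {a b : Y → 𝒢.G} (ha : IsSmooth a) (hb : IsSmooth b)
    (h : ∀ y, 𝒢.s (a y) = 𝒢.t (b y)) : IsSmooth (pairMap a b h) :=
  smooth_of_arrow fun i => by
    fin_cases i
    · exact ha
    · exact hb

theorem tm_arrow_pairMap_zero {Y : Mfd.{u}} {a b : Y → 𝒢.G} (ha : IsSmooth a) (hb : IsSmooth b)
    (h : ∀ y, 𝒢.s (a y) = 𝒢.t (b y)) (y : Y) (v : Y.Model) :
    tm (arrow 0) (pairMap a b h y) (tm (pairMap a b h) y v) = tm a y v :=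
  (tm_comp (smooth_arrow (Γ := 𝒢.toSubmGraph) (p := 1) 0) (smooth_pairMap ha hb h) y v).symm

theorem tm_arrow_pairMap_one {Y : Mfd.{u}} {a b : Y → 𝒢.G} (ha : IsSmooth a) (hb : IsSmooth b)
    (h : ∀ y, 𝒢.s (a y) = 𝒢.t (b y)) (y : Y) (v : Y.Model) :
    tm (arrow 1) (pairMap a b h y) (tm (pairMap a b h) y v) = tm b y v :=
  (tm_comp (smooth_arrow (Γ := 𝒢.toSubmGraph) (p := 1) 1) (smooth_pairMap ha hb h) y v).symm

theorem tm_mulMap_pairMap {Y : Mfd.{u}} {a b : Y → 𝒢.G} (ha : IsSmooth a) (hb : IsSmooth b)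
    (h : ∀ y, 𝒢.s (a y) = 𝒢.t (b y)) (y : Y) (v : Y.Model) :
    tm 𝒢.mulMap (pairMap a b h y) (tm (pairMap a b h) y v) =
      tm (fun y => 𝒢.mul (a y) (b y)) y v :=
  (tm_comp smooth_mulMap (smooth_pairMap ha hb h) y v).symm

theorem related_mul_comp {K : VForm 𝒢.G k} {N : VForm (𝒢.nerve 2) k}
    (hN : ∀ i : Fin 2, Related (arrow i) N K) (hm : Related 𝒢.mulMap N K)
    {Y : Mfd.{u}} {L : VForm Y k} {a b : Y → 𝒢.G} (sa : IsSmooth a) (sb : IsSmooth b)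
    (hab : ∀ y, 𝒢.s (a y) = 𝒢.t (b y)) (ha : Related a L K) (hb : Related b L K) :
    Related (fun y => 𝒢.mul (a y) (b y)) L K := by
  have h := related_to_nerve (smooth_pairMap sa sb hab) hN (L := L) fun i => by
    fin_cases i
    · exact ha
    · exact hb
  exact hm.comp h smooth_mulMap (smooth_pairMap sa sb hab)

/-- In the tangent groupoid, a vector which is its own square is a unit. -/
theorem eq_tm_unit_of_idempotent {x : 𝒢.nerve 2} {w : (𝒢.nerve 2).Model} {g : 𝒢.G}
    {z : 𝒢.G.Model} (e0 : arrow 0 x = g) (em : 𝒢.mulMap x = g)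
    (h0 : tm (arrow 0) x w = z) (h1 : tm (arrow 1) x w = z) (hm : tm 𝒢.mulMap x w = z) :
    z = tm 𝒢.unit (𝒢.s g) (tm 𝒢.s g z) := by
  -- From `z · z = z` one gets `z = z⁻¹ · (z · z) = z⁻¹ · z`, a unit. On tangent vectors this
  -- compares the maps `y ↦ (y₀⁻¹, m(y))` and `g ↦ (g⁻¹, g)` into `G^(2)`: they send `w` and `z` to
  -- the same vector, and composition with `m` gives the second arrow and a unit respectively.
  have s0 : IsSmooth fun y : 𝒢.nerve 2 => 𝒢.inv (arrow 0 y) := 𝒢.smooth_inv.comp (smooth_arrow 0)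
  have c0 : ∀ y : 𝒢.nerve 2, 𝒢.s (𝒢.inv (arrow 0 y)) = 𝒢.t (𝒢.mulMap y) := fun y => by
    rw [𝒢.s_inv]
    exact (𝒢.t_mul _ _ (arrow_comp y 0 1 rfl)).symm
  have c1 : ∀ g : 𝒢.G, 𝒢.s (𝒢.inv g) = 𝒢.t g := 𝒢.s_inv
  have sid : IsSmooth fun g : 𝒢.G => g := contMDiff_id
  have key : tm (pairMap _ _ c0) x w = tm (pairMap _ _ c1) g z := by
    refine eq_of_tm_arrow (Γ := 𝒢.toSubmGraph) (p := 1) (x := pairMap _ _ c0 x)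
      (y := pairMap _ _ c1 g) ?_ fun i => ?_
    · refine nerve_ext fun i => ?_
      fin_cases i
      · exact congrArg 𝒢.inv e0
      · exact em
    · fin_cases i
      · refine (tm_arrow_pairMap_zero s0 smooth_mulMap c0 x w).trans
          (Eq.trans ?_ (tm_arrow_pairMap_zero 𝒢.smooth_inv sid c1 g z).symm)
        rw [tm_comp 𝒢.smooth_inv (smooth_arrow 0), h0, e0]
      · refine (tm_arrow_pairMap_one s0 smooth_mulMap c0 x w).trans
          (Eq.trans ?_ (tm_arrow_pairMap_one 𝒢.smooth_inv sid c1 g z).symm)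
        rw [tm_id]
        exact hm
  have k0 := tm_mulMap_pairMap s0 smooth_mulMap c0 x w
  have k1 := tm_mulMap_pairMap 𝒢.smooth_inv sid c1 g z
  have ep : pairMap _ _ c0 x = pairMap _ _ c1 g := by
    refine nerve_ext fun i => ?_
    fin_cases i
    · exact congrArg 𝒢.inv e0
    · exact em
  rw [key, ep, k1] at k0
  have e1 : (fun y : 𝒢.nerve 2 => 𝒢.mul (𝒢.inv (arrow 0 y)) (𝒢.mulMap y)) = arrow 1 := by
    funext y
    have hc := arrow_comp y 0 1 rfl
    change 𝒢.mul (𝒢.inv (arrow 0 y)) (𝒢.mul (arrow 0 y) (arrow 1 y)) = arrow 1 y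
    rw [← 𝒢.mul_assoc _ _ _ (𝒢.s_inv _) hc, 𝒢.inv_mul, hc, 𝒢.unit_mul]
  have e2 : (fun g : 𝒢.G => 𝒢.mul (𝒢.inv g) g) = fun g => 𝒢.unit (𝒢.s g) :=
    funext fun g => 𝒢.inv_mul g
  rw [e1, e2, h1, tm_comp 𝒢.smooth_unit 𝒢.smooth_s] at k0
  exact k0.symm

/-- A unit is its own square, so the value of `K` on vectors tangent to the units is its own square
in the tangent groupoid. It is thus a unit, over the value of the base form because `K` is
compatible with `s`. -/
theorem related_unit {K : VForm 𝒢.G k} {L : VForm 𝒢.M k} (h : Covers K L) :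
    Related 𝒢.unit L K := by
  obtain ⟨N, hN⟩ := exists_related_arrow h.source h.target 1
  have hm := related_mulMap h hN
  have c : ∀ x, 𝒢.s (𝒢.unit x) = 𝒢.t (𝒢.unit x) := fun x => by rw [𝒢.s_unit, 𝒢.t_unit]
  have hu : ∀ x, 𝒢.mul (𝒢.unit x) (𝒢.unit x) = 𝒢.unit x := fun x => by
    have := 𝒢.mul_unit (𝒢.unit x)
    rwa [𝒢.s_unit] at this
  have su := 𝒢.smooth_unit
  rw [related_iff]
  intro x v
  have key := eq_tm_unit_of_idempotent (x := pairMap _ _ c x) (g := 𝒢.unit x)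
    (w := vat N (pairMap _ _ c x) fun i => tm (pairMap _ _ c) x (v i))
    (z := vat K (𝒢.unit x) fun i => tm 𝒢.unit x (v i)) rfl (hu x)
    (by
      rw [← related_iff.1 (hN 0)]
      simp only [tm_arrow_pairMap_zero su su c]
      rfl)
    (by
      rw [← related_iff.1 (hN 1)]
      simp only [tm_arrow_pairMap_one su su c]
      rfl)
    (by
      rw [← related_iff.1 hm]
      simp only [tm_mulMap_pairMap su su c, hu]
      rw [mulMap_pairMap, hu])
  rw [key, ← related_iff.1 h.source]
  simp only [tm_s_unit]
  rw [𝒢.s_unit]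

theorem IsInduced.related_face {K : VForm 𝒢.G k} {Kbar : ∀ p, VForm (𝒢.nerve p) k}
    (h : IsInduced K Kbar) :
    ∀ (p : ℕ) (i : Fin (p + 2)), Related (face (𝒢 := 𝒢) p i) (Kbar (p + 1)) (Kbar p)
  | 0, i => by
    fin_cases i
    · exact h.1.source.comp (h.2 0 0) 𝒢.smooth_s (smooth_arrow 0)
    · exact h.1.target.comp (h.2 0 0) 𝒢.smooth_t (smooth_arrow 0)
  | p + 1, i => by
    refine related_to_nerve (face (p + 1) i).contMDiff (h.2 p) fun r => ?_
    change Related (fun x => faceArrow i x r) _ _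
    unfold faceArrow
    split_ifs
    · exact h.2 (p + 1) _
    · exact related_mul_comp (h.2 1) (related_mulMap h.1 (h.2 1)) (smooth_arrow _) (smooth_arrow _)
        (fun x => arrow_comp x r.castSucc r.succ (by simp)) (h.2 (p + 1) _) (h.2 (p + 1) _)
    · exact h.2 (p + 1) _

theorem IsInduced.related_degen {K : VForm 𝒢.G k} {Kbar : ∀ p, VForm (𝒢.nerve p) k}
    (h : IsInduced K Kbar) :
    ∀ (p : ℕ) (i : Fin (p + 1)), Related (degen (𝒢 := 𝒢) p i) (Kbar p) (Kbar (p + 1))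
  | 0, i => related_to_nerve (degen 0 i).contMDiff (h.2 0) fun _ => related_unit h.1
  | p + 1, i => by
    refine related_to_nerve (degen (p + 1) i).contMDiff (h.2 (p + 1)) fun r => ?_
    change Related (fun x => degArrow i x r) _ _
    unfold degArrow vertex
    split_ifs
    · exact h.2 p _
    · exact (related_unit h.1).comp (h.1.target.comp (h.2 p _) 𝒢.smooth_t (smooth_arrow _))
        𝒢.smooth_unit (𝒢.smooth_t.comp (smooth_arrow _))
    · exact (related_unit h.1).comp (h.1.source.comp (h.2 p _) 𝒢.smooth_s (smooth_arrow _))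
        𝒢.smooth_unit (𝒢.smooth_s.comp (smooth_arrow _))
    · exact h.2 p _

/-! ### Derivations which commute with the total differential -/

theorem degSign_of_isHomog {X : Mfd.{u}} {m : ℤ} {a : Forms X} (h : IsHomog m a) :
    degSign X a = sgn m • a := by
  rcases lt_or_ge m 0 with hm | hm
  · rw [h.eq_zero hm]
    simp
  · lift m to ℕ using hm
    rw [h.exists_eq, degSign_homog]

theorem total_inNerve (D : 𝒢.OpSeq) (p : ℕ) (a : Forms (𝒢.nerve p)) :
    𝒢.total D (𝒢.inNerve p a) = 𝒢.inNerve p (D p a) :=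
  DirectSum.lmap_lof _ _ _

theorem totalD_inNerve (p : ℕ) (a : Forms (𝒢.nerve p)) :
    𝒢.totalD (𝒢.inNerve p a) = 𝒢.inNerve p (dR (𝒢.nerve p) a) +
      𝒢.inNerve (p + 1) (𝒢.delta p (degSign (𝒢.nerve p) a)) := by
  rw [totalD, inNerve, DirectSum.toModule_lof]
  rfl

/-- Componentwise description of the sequences of derivations which commute with the total
differential. -/
theorem gradedComm_total_eq_zero_iff {l : ℤ} {D : 𝒢.OpSeq} (hD : ∀ p, IsDerivation l (D p)) :
    gradedComm l 1 (𝒢.total D) 𝒢.totalD = 0 ↔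
      (∀ p, CommutesD l (D p)) ∧ ∀ p, D (p + 1) ∘ₗ 𝒢.delta p = 𝒢.delta p ∘ₗ D p := by
  -- The two summands lie in different spaces `Ω^•(G^(p))` and `Ω^•(G^(p+1))`. In the second one the
  -- sign of the graded commutator is compensated by the change of `(-1)^q` to `(-1)^(q+l)`, so the
  -- commutator with `δ` is an ungraded one.
  have h0 : ∀ p q (α : Form (𝒢.nerve p) q),
      gradedComm l 1 (𝒢.total D) 𝒢.totalD (𝒢.inNerve p (homog q α)) =
        𝒢.inNerve p (D p (dR _ (homog q α)) - sgn l • dR _ (D p (homog q α))) +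
        𝒢.inNerve (p + 1) (sgn q • (D (p + 1) (𝒢.delta p (homog q α)) -
          𝒢.delta p (D p (homog q α)))) := by
    intro p q α
    simp only [gradedComm, LinearMap.sub_apply, LinearMap.smul_apply, LinearMap.comp_apply,
      totalD_inNerve, total_inNerve, map_add, map_sub, map_smul, degSign_homog, mul_one,
      degSign_of_isHomog ((hD p).isHomog (isHomog_homog q α)), smul_add, smul_sub, smul_smul]
    rw [add_comm (q : ℤ) l, sgn_add, ← _root_.mul_assoc, sgn_mul_self, one_mul]
    abel
  have hq : ∀ q : ℕ, sgn q ≠ 0 := fun q hq => by simpa [hq] using sgn_mul_self q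
  constructor
  · intro h
    have h1 : ∀ p q (α : Form (𝒢.nerve p) q),
        D p (dR _ (homog q α)) - sgn l • dR _ (D p (homog q α)) = 0 ∧
        sgn q • (D (p + 1) (𝒢.delta p (homog q α)) - 𝒢.delta p (D p (homog q α))) = 0 := by
      intro p q α
      have h2 := h0 p q α
      rw [h, LinearMap.zero_apply] at h2
      have h3 := congrArg (DirectSum.component ℝ ℕ (fun p => Forms (𝒢.nerve p)) p) h2
      have h4 := congrArg (DirectSum.component ℝ ℕ (fun p => Forms (𝒢.nerve p)) (p + 1)) h2
      rw [map_zero, map_add, DirectSum.component.lof_self, DirectSum.component.of,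
        dif_neg (by omega), add_zero] at h3
      rw [map_zero, map_add, DirectSum.component.lof_self, DirectSum.component.of,
        dif_neg (by omega), zero_add] at h4
      exact ⟨h3.symm, h4.symm⟩
    refine ⟨fun p a => ?_, fun p => Forms.hom_ext fun q α => ?_⟩
    · have : D p ∘ₗ dR _ = sgn l • (dR _ ∘ₗ D p) :=
        Forms.hom_ext fun q α => sub_eq_zero.1 (h1 p q α).1
      exact LinearMap.congr_fun this a
    · exact sub_eq_zero.1 ((smul_eq_zero.1 (h1 p q α).2).resolve_left (hq q))
  · rintro ⟨h1, h2⟩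
    refine DirectSum.linearMap_ext ℝ fun p => Forms.hom_ext fun q α => ?_
    refine (h0 p q α).trans ?_
    have h3 := LinearMap.congr_fun (h2 p) (homog q α)
    simp only [LinearMap.comp_apply] at h3
    rw [h1 p, h3]
    simp

/-- The Lie derivatives of the induced forms commute with the total differential. -/
theorem IsInduced.mem_totalDerivations {K : VForm 𝒢.G k} {Kbar : ∀ p, VForm (𝒢.nerve p) k}
    (h : IsInduced K Kbar) : (fun p => lieD (Kbar p)) ∈ 𝒢.totalDerivations (k : ℤ) := by
  refine ⟨⟨fun p => isDerivation_lieD _, fun p i => pull_lieD _ (h.related_degen p i)⟩, ?_⟩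
  rw [gradedComm_total_eq_zero_iff fun p => isDerivation_lieD _]
  refine ⟨fun p => commutesD_lieD _, fun p => ?_⟩
  refine LinearMap.ext fun a => ?_
  simp only [delta, LinearMap.comp_apply, LinearMap.sum_apply, LinearMap.smul_apply, map_sum,
    map_smul]
  refine Finset.sum_congr rfl fun i _ => ?_
  exact congrArg _ (LinearMap.congr_fun (pull_lieD _ (h.related_face p i)) a).symm

end LieGroupoid

/-! ### The failure of two vector-valued forms to be related -/

section Defect

variable {X Y Z : Mfd.{u}} {k : ℕ}

/-- The failure of `K` and `L` to be `f`-related, at `x`. -/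
def defect (f : X → Y) (K : VForm X k) (L : VForm Y k) (x : X) (v : Fin k → X.Model) : Y.Model :=
  vat L (f x) (fun i => tm f x (v i)) - tm f x (vat K x v)

theorem related_iff_defect {f : X → Y} {K : VForm X k} {L : VForm Y k} :
    Related f K L ↔ ∀ x v, defect f K L x v = 0 := by
  simp only [related_iff, defect, sub_eq_zero]

/-- The zero set of a form is closed. -/
theorem isClosed_form_eq_zero {q : ℕ} (α : Form X q) : IsClosed {x | α.1 x = 0} := by
  rw [← isOpen_compl_iff, isOpen_iff_mem_nhds]
  intro x hx
  have h1 : localForm α.1 x (X.chart x x) ≠ 0 := fun h => hx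
    (eq_of_localForm_eq_self (θ := α.1) (η := 0) x (h.trans rfl))
  have h2 := (α.contDiffAt_localForm x (mem_chart_target _ x)).continuousAt.eventually_ne h1
  have h3 := (X.chart x).continuousAt (mem_chart_source _ x)
  filter_upwards [h3.eventually h2, (X.chart x).open_source.mem_nhds (mem_chart_source _ x)]
    with z hz hz' h0
  refine hz ?_
  have h0' : α.1 z = 0 := h0
  rw [← (X.chart x).left_inv hz'] at h0'
  unfold localForm
  rw [h0']
  rfl

/-- Paired with the differential of a function `φ` on `Y`, the defect becomes the smooth form
`f^*(dφ ∘ L) - d(f^*φ) ∘ K`. The set in question is the intersection of the zero sets of these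
forms, which are closed. -/
theorem isClosed_defect (f : SMap X Y) (K : VForm X k) (L : VForm Y k) :
    IsClosed {x | ∀ v, defect f K L x v = 0} := by
  have h : {x | ∀ v, defect f K L x v = 0} = ⋂ φ : Form Y 0,
      {x | (pullback f k (ins L 0 (extD Y 0 φ)) -
        (ins K 0 (extD X 0 (pullback f 0 φ)) : Form X k)).1 x = 0} := by
    have e : ∀ (φ : Form Y 0) (x : X) (v : Fin k → X.Model), (pullback f k (ins L 0 (extD Y 0 φ)) -
        (ins K 0 (extD X 0 (pullback f 0 φ)) : Form X k)).1 x v =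
          dm φ (f x) (defect f K L x v) := fun φ x v => by
      have h1 : (pullback f k (ins L 0 (extD Y 0 φ))).1 x v =
          dm φ (f x) (vat L (f x) fun i => tm f x (v i)) := ins_extD_apply L φ (f x) _
      have h2 : (ins K 0 (extD X 0 (pullback f 0 φ))).1 x v =
          dm (pullback f 0 φ) x (vat K x v) := ins_extD_apply K _ x v
      rw [dm_pullback] at h2
      have h3 : dm φ (f x) (defect f K L x v) = dm φ (f x) (vat L (f x) fun i => tm f x (v i)) -
          dm φ (f x) (tm f x (vat K x v)) := map_sub _ _ _
      rw [h3, ← h1, ← h2]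
      rfl
    ext x
    simp only [Set.mem_ofPred_eq, Set.mem_iInter]
    constructor
    · intro h φ
      ext v
      refine (e φ x v).trans ?_
      rw [h v, map_zero]
      rfl
    · intro h v
      refine eq_of_dm (x := f x) fun φ => ?_
      rw [map_zero]
      exact (e φ x v).symm.trans (DFunLike.congr_fun (h φ) v)
  rw [h]
  exact isClosed_iInter fun φ => isClosed_form_eq_zero _

/-- Operators intertwined by the pullback come from related forms. -/
theorem related_of_pull_lieD {f : SMap X Y} {K : VForm X k} {L : VForm Y k}
    (h : pull f ∘ₗ lieD L = lieD K ∘ₗ pull f) : Related f K L := by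
  refine related_iff.2 fun x v => eq_of_dm (x := f x) fun φ => ?_
  have h1 := LinearMap.congr_fun h (homog 0 φ)
  simp only [LinearMap.comp_apply, pull_homog, lieD_function, map_smul] at h1
  have hq : sgn k ≠ 0 := fun hq => by simpa [hq] using sgn_mul_self k
  have h2 := homog_injective k ((smul_right_injective _ hq) h1)
  have h3 : (pullback f k (ins L 0 (extD Y 0 φ))).1 x v =
      (ins K 0 (extD X 0 (pullback f 0 φ))).1 x v := by rw [h2]
  have h4 : (pullback f k (ins L 0 (extD Y 0 φ))).1 x v =
      dm φ (f x) (vat L (f x) fun i => tm f x (v i)) := ins_extD_apply L φ (f x) _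
  rw [← h4, h3, ← dm_pullback]
  exact ins_extD_apply K _ x v

end Defect

/-! ### Fibres of submersions -/

section Fibres

variable {G M : Mfd.{u}} {t : G → M}

/-- The fibres of a submersion with fibres of positive dimension have no isolated points. -/
theorem exists_mem_fibre (ht : IsSubm t) [Nontrivial (Fib G M)] (g : G) {U : Set G} (hU : U ∈ 𝓝 g)
    {S : Set G} (hS : S.Finite) : ∃ g' ∈ U, t g' = t g ∧ g' ∉ S := by
  obtain ⟨c, hc⟩ := ht.exists_subChart g
  -- The slice through `g` along its fibre, in a chart in which `t` is a projection. A neighbourhood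
  -- in a space of positive dimension is infinite, so finitely many points can be avoided.
  let ρ : Fib G M → G.Model := fun w => c.lin.symm ((c.lin (c.dom g)).1, w)
  have hρ : Continuous ρ := c.lin.symm.continuous.comp (by fun_prop)
  have hρ0 : ρ (c.lin (c.dom g)).2 = c.dom g := by simp [ρ]
  have h1 : ∀ᶠ w in 𝓝 (c.lin (c.dom g)).2, ρ w ∈ c.dom.target := by
    refine hρ.continuousAt.eventually (c.dom.open_target.mem_nhds ?_)
    rw [hρ0]
    exact c.dom.map_source hc
  have h2 : ∀ᶠ w in 𝓝 (c.lin (c.dom g)).2, c.dom.symm (ρ w) ∈ U := by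
    have h3 : ContinuousAt (fun w => c.dom.symm (ρ w)) (c.lin (c.dom g)).2 := by
      refine ContinuousAt.comp (g := c.dom.symm) ?_ hρ.continuousAt
      rw [hρ0]
      exact c.dom.continuousAt_symm (c.dom.map_source hc)
    refine h3.eventually ?_
    simp only [hρ0]
    rw [c.dom.left_inv hc]
    exact hU
  have : (𝓝[≠] (c.lin (c.dom g)).2).NeBot := Module.punctured_nhds_neBot ℝ _ _
  have hinf := infinite_of_mem_nhds _ (h1.and h2)
  have hinj : Set.InjOn (fun w => c.dom.symm (ρ w))
      {w | ρ w ∈ c.dom.target ∧ c.dom.symm (ρ w) ∈ U} := by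
    intro w hw w' hw' h
    have h3 := c.dom.symm.injOn hw.1 hw'.1 h
    have h4 := c.lin.symm.injective h3
    exact (Prod.mk.inj h4).2
  obtain ⟨-, ⟨w, hw, rfl⟩, hwS⟩ := ((hinf.image hinj).sdiff hS).nonempty
  refine ⟨_, hw.2, ?_, hwS⟩
  have h3 := c.dom.map_target hw.1
  refine c.cod.injOn (c.maps _ h3) (c.maps _ hc) ?_
  rw [c.spec _ h3, c.spec _ hc, c.dom.right_inv hw.1]
  simp [ρ]

/-- A submersion with fibres of dimension zero is an immersion. -/
theorem tm_injective_of_subsingleton (ht : IsSubm t) [Subsingleton (Fib G M)] (g : G) :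
    Function.Injective (tm t g) := by
  obtain ⟨c, hc⟩ := ht.exists_subChart g
  intro v w h
  refine c.ddom_injective hc (c.lin.injective (Prod.ext ?_ (Subsingleton.elim _ _)))
  rw [c.lin_ddom_fst ht.contMDiff hc, c.lin_ddom_fst ht.contMDiff hc, h]

end Fibres

/-! ### Derivations come from multiplicative forms -/

namespace LieGroupoid

open SubmGraph

variable {𝒢 : LieGroupoid.{u}} {k : ℕ}

theorem eq_unit_of_mul_eq_right {g h : 𝒢.G} (hgh : 𝒢.s g = 𝒢.t h) (e : 𝒢.mul g h = h) :
    g = 𝒢.unit (𝒢.t h) := by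
  rw [← 𝒢.mul_inv h]
  conv_rhs => rw [← e]
  have h1 : 𝒢.inv (𝒢.mul g h) = 𝒢.inv h := by rw [e]
  rw [h1, 𝒢.mul_assoc _ _ _ hgh (𝒢.t_inv h).symm, 𝒢.mul_inv, ← hgh, 𝒢.mul_unit]

theorem eq_unit_of_mul_eq_left {g h : 𝒢.G} (hgh : 𝒢.s g = 𝒢.t h) (e : 𝒢.mul g h = g) :
    h = 𝒢.unit (𝒢.s g) := by
  have h1 := 𝒢.mul_assoc _ _ _ (𝒢.s_inv g) hgh
  rw [e, 𝒢.inv_mul, hgh, 𝒢.unit_mul] at h1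
  rwa [hgh]

/-- The relation between the defects of the face maps. -/
theorem sum_defect {N : ∀ p, VForm (𝒢.nerve p) k} {p : ℕ}
    (hδ : lieD (N (p + 1)) ∘ₗ 𝒢.delta p = 𝒢.delta p ∘ₗ lieD (N p)) (x : 𝒢.nerve (p + 1))
    (v : Fin k → (𝒢.nerve (p + 1)).Model) (φ : Form (𝒢.nerve p) 0) :
    ∑ i : Fin (p + 2), sgn i * dm φ (face p i x) (defect (face p i) (N (p + 1)) (N p) x v) = 0 := by
  -- On functions, commutation with `δ` is a statement about the vector-valued forms themselves,
  -- through `lieD_function`; the common sign is then cancelled and the result evaluated at `x` on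
  -- `v`.
  have h1 := LinearMap.congr_fun hδ (homog 0 φ)
  simp only [delta, LinearMap.comp_apply, LinearMap.sum_apply, LinearMap.smul_apply, map_sum,
    map_smul, pull_homog, lieD_function] at h1
  have hq : sgn k ≠ 0 := fun hq => by simpa [hq] using sgn_mul_self k
  simp only [smul_comm _ (sgn (k : ℤ))] at h1
  simp only [← Finset.smul_sum] at h1
  have h2 := congrArg (comp k) (smul_right_injective _ hq h1)
  simp only [map_sum, map_smul] at h2
  have h2' : ∑ i : Fin (p + 2), sgn i • (ins (N (p + 1)) 0 (extD _ 0 (pullback (face p i) 0 φ)) :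
      Form (𝒢.nerve (p + 1)) k) =
      ∑ i : Fin (p + 2), sgn i • pullback (face p i) k (ins (N p) 0 (extD _ 0 φ)) := by
    refine Eq.trans (Finset.sum_congr rfl fun i _ => ?_)
      (h2.trans (Finset.sum_congr rfl fun i _ => ?_))
    · exact congrArg _ (comp_homog k _).symm
    · exact congrArg _ (comp_homog k _)
  let ev : Form (𝒢.nerve (p + 1)) k →ₗ[ℝ] ℝ := ⟨⟨fun g => g.1 x v, fun _ _ => rfl⟩, fun _ _ => rfl⟩
  have h3 := congrArg ev h2'
  simp only [map_sum, map_smul, smul_eq_mul] at h3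
  have h4 : ∀ i : Fin (p + 2), ev (ins (N (p + 1)) 0 (extD _ 0 (pullback (face p i) 0 φ))) =
      dm φ (face p i x) (tm (face p i) x (vat (N (p + 1)) x v)) := fun i => by
    rw [← dm_pullback]
    exact ins_extD_apply _ _ x v
  have h5 : ∀ i : Fin (p + 2), ev (pullback (face p i) k (ins (N p) 0 (extD _ 0 φ))) =
      dm φ (face p i x) (vat (N p) (face p i x) fun j => tm (face p i) x (v j)) := fun i =>
    ins_extD_apply (N p) φ (face p i x) _
  simp only [h4, h5] at h3
  simp only [defect, map_sub, mul_sub, Finset.sum_sub_distrib, h3, sub_self]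

open Classical in
/-- The defects of the faces of `x` which coincide with `y` cancel. -/
theorem sum_defect_filter {N : ∀ p, VForm (𝒢.nerve p) k} {p : ℕ}
    (hδ : lieD (N (p + 1)) ∘ₗ 𝒢.delta p = 𝒢.delta p ∘ₗ lieD (N p)) (x : 𝒢.nerve (p + 1))
    (v : Fin k → (𝒢.nerve (p + 1)).Model) (y : 𝒢.nerve p) :
    ∑ i : Fin (p + 2) with face p i x = y,
      sgn i • defect (face p i) (N (p + 1)) (N p) x v = 0 := by
  -- There are finitely many faces, so functions with zero differential at the faces other than `y`
  -- still detect tangent vectors at `y`.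
  refine eq_zero_of_dAt (X := 𝒢.nerve p) y (S := {z | (∃ i, face p i x = z) ∧ z ≠ y})
    ((Set.finite_range fun i => face p i x).subset fun z hz => hz.1) (fun h => h.2 rfl)
    fun φ hφ => ?_
  change dm φ y (∑ i : Fin (p + 2) with face p i x = y,
      sgn i • defect (face p i) (N (p + 1)) (N p) x v) = 0
  rw [map_sum, ← sum_defect hδ x v φ, Finset.sum_filter]
  refine Finset.sum_congr rfl fun i _ => ?_
  split_ifs with h
  · rw [map_smul, smul_eq_mul, h]
  · have h1 : dm φ (face p i x) = 0 := hφ _ ⟨⟨i, rfl⟩, h⟩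
    rw [h1]
    simp

theorem sgn_ne_zero (n : ℤ) : sgn n ≠ 0 := fun h => by simpa [h] using sgn_mul_self n

/-- The defect of a face vanishes if those of all other coinciding faces do. -/
theorem defect_eq_zero {N : ∀ p, VForm (𝒢.nerve p) k} {p : ℕ}
    (hδ : lieD (N (p + 1)) ∘ₗ 𝒢.delta p = 𝒢.delta p ∘ₗ lieD (N p)) (x : 𝒢.nerve (p + 1))
    (v : Fin k → (𝒢.nerve (p + 1)).Model) (i : Fin (p + 2))
    (h : ∀ j ≠ i, face p j x = face p i x → defect (face p j) (N (p + 1)) (N p) x v = 0) :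
    defect (face p i) (N (p + 1)) (N p) x v = 0 := by
  classical
  have h1 := sum_defect_filter hδ x v (face p i x)
  rw [Finset.sum_eq_single i] at h1
  · exact (smul_eq_zero.1 h1).resolve_left (sgn_ne_zero _)
  · intro j hj hji
    rw [h j hji (Finset.mem_filter.1 hj).2, smul_zero]
  · intro hi
    exact absurd (by simp) hi

theorem arrow_face {p : ℕ} (i : Fin (p + 3)) (x : 𝒢.nerve (p + 2)) (r : Fin (p + 1)) :
    arrow r (face (p + 1) i x) = faceArrow i x r := rfl

end LieGroupoid

namespace LieGroupoid

open SubmGraph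

variable {𝒢 : LieGroupoid.{u}} {k : ℕ}

/-! #### Groupoids with fibres of positive dimension -/

theorem exists_replace {p : ℕ} (x : 𝒢.nerve (p + 1)) (r : Fin (p + 1)) (g : 𝒢.G)
    (hs : ∀ j : Fin (p + 1), (r : ℕ) + 1 = j → 𝒢.s g = 𝒢.t (arrow j x))
    (ht : ∀ i : Fin (p + 1), (i : ℕ) + 1 = r → 𝒢.s (arrow i x) = 𝒢.t g) :
    ∃ y : 𝒢.nerve (p + 1), ∀ i, arrow i y = Function.update (fun i => arrow i x) r g i := by
  refine ⟨ofArrows (Function.update (fun i => arrow i x) r g) fun i j hij => ?_, fun i => rfl⟩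
  by_cases hi : i = r
  · subst hi
    rw [Function.update_self, Function.update_of_ne (by rintro rfl; omega)]
    exact hs j hij
  · by_cases hj : j = r
    · subst hj
      rw [Function.update_self, Function.update_of_ne hi]
      exact ht i hij
    · rw [Function.update_of_ne hi, Function.update_of_ne hj]
      exact arrow_comp x i j hij

/-- The topology of strings is induced from the product, so a small change of one arrow gives a
nearby string. -/
theorem eventually_replace_mem {p : ℕ} (x : 𝒢.nerve (p + 1)) (r : Fin (p + 1))
    {U : Set (𝒢.nerve (p + 1))} (hU : U ∈ 𝓝 x) : ∀ᶠ g in 𝓝 (arrow r x), ∀ y : 𝒢.nerve (p + 1),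
      (∀ i, arrow i y = Function.update (fun i => arrow i x) r g i) → y ∈ U := by
  have h1 : 𝓝 x = Filter.comap (fun (z : 𝒢.nerve (p + 1)) i => arrow i z) (𝓝 fun i => arrow i x) :=
    (Str.inducing (Γ := 𝒢.toSubmGraph) p).nhds_eq_comap x
  rw [h1] at hU
  obtain ⟨W, hW, hWU⟩ := hU
  have h2 : Continuous fun g : 𝒢.G => Function.update (fun i => arrow i x) r g :=
    continuous_const.update r continuous_id
  have h3 : W ∈ 𝓝 (Function.update (fun i => arrow i x) r (arrow r x)) := by
    rwa [Function.update_eq_self]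
  filter_upwards [h2.continuousAt.eventually h3] with g hg y hy
  refine hWU ?_
  have : (fun i => arrow i y) = Function.update (fun i => arrow i x) r g := funext hy
  rw [Set.mem_preimage, this]
  exact hg

section Positive

variable [Nontrivial (Fib 𝒢.G 𝒢.M)] {N : ∀ p, VForm (𝒢.nerve p) k}

/-- The first arrow of `∂_0 y` is the second arrow of `y`, while any other face begins with the
first arrow or with the product of the first two. If the first arrow is neither equal to the second
nor a unit, `∂_0 y` differs from all other faces and has no defect. Such strings are dense, and
vanishing of the defect is a closed condition. -/
theorem related_face_first {p : ℕ}
    (hδ : lieD (N (p + 2)) ∘ₗ 𝒢.delta (p + 1) = 𝒢.delta (p + 1) ∘ₗ lieD (N (p + 1))) :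
    Related (face (𝒢 := 𝒢) (p + 1) 0) (N (p + 2)) (N (p + 1)) := by
  rw [related_iff_defect]
  intro x
  have hcl := isClosed_defect (face (𝒢 := 𝒢) (p + 1) 0) (N (p + 2)) (N (p + 1))
  change x ∈ {x | ∀ v, defect (face (𝒢 := 𝒢) (p + 1) 0) (N (p + 2)) (N (p + 1)) x v = 0}
  rw [← hcl.closure_eq, mem_closure_iff_nhds]
  intro U hU
  -- The first arrow is varied within its source fibre, so that it stays composable with the second.
  obtain ⟨g, hgU, hgs, hgS⟩ := exists_mem_fibre 𝒢.subm_s (arrow 0 x) (eventually_replace_mem x 0 hU)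
    (S := {𝒢.unit (𝒢.t (arrow 1 x)), arrow 1 x}) (by simp)
  obtain ⟨y, hy⟩ := exists_replace x 0 g
    (fun j hj => hgs.trans (arrow_comp x 0 j hj)) (fun i hi => by simp at hi)
  have hy0 : arrow 0 y = g := by rw [hy, Function.update_self]
  have hy1 : arrow 1 y = arrow 1 x := by
    rw [hy, Function.update_of_ne (by simp)]
  refine ⟨y, hgU y hy, fun v => defect_eq_zero hδ y v 0 fun j hj h => ?_⟩
  exfalso
  have h1 := congrArg (arrow 0) h
  rw [arrow_face, arrow_face] at h1
  have h2 : faceArrow 0 y 0 = arrow 1 x := by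
    rw [← hy1]
    simp [faceArrow]
  have hj0 : 0 < (j : ℕ) := Nat.pos_of_ne_zero fun h => hj (Fin.ext h)
  rw [h2] at h1
  unfold faceArrow at h1
  split_ifs at h1 with c1 c2
  · exact hgS (Or.inr (hy0.symm.trans h1))
  · refine hgS (Or.inl ?_)
    have h3 : 𝒢.mul g (arrow 1 x) = arrow 1 x := by
      rw [← hy0, ← hy1]
      exact h1.trans hy1.symm
    exact eq_unit_of_mul_eq_right (hgs.trans (arrow_comp x 0 1 (by simp))) h3
  · simp at c1 c2
    omega

/-- The mirror image of `related_face_first`: the last arrow is varied within its target fibre and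
the last arrows of the faces are compared. -/
theorem related_face_last {p : ℕ}
    (hδ : lieD (N (p + 2)) ∘ₗ 𝒢.delta (p + 1) = 𝒢.delta (p + 1) ∘ₗ lieD (N (p + 1))) :
    Related (face (𝒢 := 𝒢) (p + 1) (Fin.last _)) (N (p + 2)) (N (p + 1)) := by
  rw [related_iff_defect]
  intro x
  have hcl := isClosed_defect (face (𝒢 := 𝒢) (p + 1) (Fin.last _)) (N (p + 2)) (N (p + 1))
  change x ∈ {x | ∀ v, defect (face (𝒢 := 𝒢) (p + 1) (Fin.last _)) (N (p + 2)) (N (p + 1)) x v = 0}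
  rw [← hcl.closure_eq, mem_closure_iff_nhds]
  intro U hU
  let a : Fin (p + 2) := (Fin.last p).castSucc
  let b : Fin (p + 2) := (Fin.last p).succ
  have hab : (a : ℕ) + 1 = b := by simp [a, b]
  have hne : a ≠ b := fun h => by rw [h] at hab; omega
  obtain ⟨g, hgU, hgt, hgS⟩ := exists_mem_fibre 𝒢.subm_t (arrow b x)
    (eventually_replace_mem x b hU) (S := {𝒢.unit (𝒢.s (arrow a x)), arrow a x}) (by simp)
  obtain ⟨y, hy⟩ := exists_replace x b g
    (fun j hj => by have := j.2; simp [b] at hj; omega)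
    (fun i hi => (arrow_comp x i b hi).trans hgt.symm)
  have hyb : arrow b y = g := by rw [hy, Function.update_self]
  have hya : arrow a y = arrow a x := by
    rw [hy, Function.update_of_ne hne]
  refine ⟨y, hgU y hy, fun v => defect_eq_zero hδ y v _ fun j hj h => ?_⟩
  exfalso
  have h1 := congrArg (arrow (Fin.last p)) h
  rw [arrow_face, arrow_face] at h1
  have h2 : faceArrow (Fin.last (p + 2)) y (Fin.last p) = arrow a x := by
    rw [← hya]
    simp [faceArrow, a]
  have hj0 : (j : ℕ) < p + 2 := Fin.val_lt_last hj
  rw [h2] at h1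
  unfold faceArrow at h1
  split_ifs at h1 with c1 c2
  · simp at c1
    omega
  · refine hgS (Or.inl ?_)
    have h3 : 𝒢.mul (arrow a x) g = arrow a x := by
      rw [← hyb, ← hya]
      exact h1.trans hya.symm
    exact eq_unit_of_mul_eq_left ((arrow_comp x a b hab).trans hgt.symm) h3
  · exact hgS (Or.inr (hyb.symm.trans h1))

end Positive

/-! #### Source and target -/

/-- The map `g ↦ (g, g⁻¹)`. -/
def invPair : 𝒢.nerve 1 → 𝒢.nerve 2 :=
  pairMap (fun x => arrow 0 x) (fun x => 𝒢.inv (arrow 0 x)) fun x => (𝒢.t_inv (arrow 0 x)).symm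

theorem smooth_invPair : IsSmooth (invPair (𝒢 := 𝒢)) :=
  smooth_pairMap (smooth_arrow 0) (𝒢.smooth_inv.comp (smooth_arrow 0)) _

theorem nerve_one_ext {x y : 𝒢.nerve 1} (h : arrow 0 x = arrow 0 y) : x = y :=
  nerve_ext fun i => by rw [Fin.fin_one_eq_zero i]; exact h

theorem face_one_two_invPair (x : 𝒢.nerve 1) : face 1 2 (invPair x) = x := nerve_one_ext rfl

theorem face_one_one_invPair (x : 𝒢.nerve 1) :
    face 1 1 (invPair x) = degen 0 0 (face 0 1 x) := nerve_one_ext (𝒢.mul_inv (arrow 0 x))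

theorem face_zero_one_face_one_one (y : 𝒢.nerve 2) :
    face (𝒢 := 𝒢) 0 1 (face 1 1 y) = face 0 1 (face 1 2 y) :=
  𝒢.t_mul _ _ (arrow_comp y 0 1 rfl)

theorem face_zero_one_face_one_zero (y : 𝒢.nerve 2) :
    face (𝒢 := 𝒢) 0 1 (face 1 0 y) = face 0 0 (face 1 2 y) :=
  (arrow_comp y 0 1 rfl).symm

theorem face_zero_one_degen (y : 𝒢.nerve 0) : face (𝒢 := 𝒢) 0 1 (degen 0 0 y) = y := 𝒢.t_unit y

theorem tm_face_face (i : Fin 2) (j : Fin 3) (x : 𝒢.nerve 2) (v : (𝒢.nerve 2).Model) :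
    tm (face (𝒢 := 𝒢) 0 i) (face 1 j x) (tm (face (𝒢 := 𝒢) 1 j) x v) =
      tm (fun x : 𝒢.nerve 2 => face (𝒢 := 𝒢) 0 i (face 1 j x)) x v :=
  (tm_comp (face 0 i).contMDiff (face 1 j).contMDiff x v).symm

theorem tm_face_degen (y : 𝒢.nerve 0) (v) :
    tm (face (𝒢 := 𝒢) 0 1) (degen 0 0 y) (tm (degen (𝒢 := 𝒢) 0 0) y v) = v := by
  rw [← tm_comp (face (𝒢 := 𝒢) 0 1).contMDiff (degen (𝒢 := 𝒢) 0 0).contMDiff]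
  simp only [face_zero_one_degen, tm_id]

section SourceTarget

variable {N : ∀ p, VForm (𝒢.nerve p) k}

/-- At `(g, g⁻¹)` the product is a unit, where `N 1` is known from `N 0`. Since `t (g h) = t g`, the
target of the product can be replaced by the target of the first arrow. -/
theorem tm_target_of_defect (hd : Related (degen (𝒢 := 𝒢) 0 0) (N 0) (N 1)) (x : 𝒢.nerve 1)
    (v : Fin k → (𝒢.nerve 1).Model)
    (h : defect (face 1 1) (N 2) (N 1) (invPair x) (fun i => tm invPair x (v i)) = 0) :
    tm (face (𝒢 := 𝒢) 0 1) x (tm (face (𝒢 := 𝒢) 1 2) (invPair x)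
      (vat (N 2) (invPair x) fun i => tm invPair x (v i))) =
        vat (N 0) (face 0 1 x) fun i => tm (face (𝒢 := 𝒢) 0 1) x (v i) := by
  have h1 : ∀ w, tm (face (𝒢 := 𝒢) 0 1) x (tm (face (𝒢 := 𝒢) 1 2) (invPair x) w) =
      tm (face (𝒢 := 𝒢) 0 1) (face 1 1 (invPair x)) (tm (face (𝒢 := 𝒢) 1 1) (invPair x) w) := by
    intro w
    have h2 := tm_face_face (𝒢 := 𝒢) 1 2 (invPair x) w
    have h3 := tm_face_face (𝒢 := 𝒢) 1 1 (invPair x) w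
    simp only [face_zero_one_face_one_one] at h3
    rw [h3, ← h2, face_one_two_invPair]
  have h4 : ∀ w, tm (face (𝒢 := 𝒢) 1 1) (invPair x) (tm invPair x w) =
      tm (degen (𝒢 := 𝒢) 0 0) (face 0 1 x) (tm (face (𝒢 := 𝒢) 0 1) x w) := by
    intro w
    rw [← tm_comp (face (𝒢 := 𝒢) 1 1).contMDiff smooth_invPair,
      ← tm_comp (degen (𝒢 := 𝒢) 0 0).contMDiff (face (𝒢 := 𝒢) 0 1).contMDiff]
    simp only [face_one_one_invPair]
  rw [h1, ← sub_eq_zero.1 h]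
  simp only [h4]
  rw [face_one_one_invPair, related_iff.1 hd, tm_face_degen]

theorem tm_face_one_two_invPair (x : 𝒢.nerve 1) (v) :
    tm (face (𝒢 := 𝒢) 1 2) (invPair x) (tm invPair x v) = v := by
  rw [← tm_comp (face (𝒢 := 𝒢) 1 2).contMDiff smooth_invPair]
  simp only [face_one_two_invPair, tm_id]

/-- When the face keeping the first arrow of `(g, g⁻¹)` has no defect either, it turns `N 2` into `N
1` at `g` in `tm_target_of_defect`. -/
theorem defect_target (hd : Related (degen (𝒢 := 𝒢) 0 0) (N 0) (N 1)) (x : 𝒢.nerve 1)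
    (v : Fin k → (𝒢.nerve 1).Model)
    (h : defect (face 1 1) (N 2) (N 1) (invPair x) (fun i => tm invPair x (v i)) = 0)
    (h' : defect (face 1 2) (N 2) (N 1) (invPair x) (fun i => tm invPair x (v i)) = 0) :
    defect (face 0 1) (N 1) (N 0) x v = 0 := by
  have h1 := tm_target_of_defect hd x v h
  rw [← sub_eq_zero.1 h'] at h1
  simp only [tm_face_one_two_invPair] at h1
  rw [face_one_two_invPair] at h1
  exact sub_eq_zero.2 h1.symm

/-- In degree zero `δ` has just two terms; once the defect of `t` is zero, so is that of `s`. -/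
theorem defect_source (hδ : lieD (N 1) ∘ₗ 𝒢.delta 0 = 𝒢.delta 0 ∘ₗ lieD (N 0))
    (h : Related (face (𝒢 := 𝒢) 0 1) (N 1) (N 0)) : Related (face (𝒢 := 𝒢) 0 0) (N 1) (N 0) := by
  rw [related_iff_defect] at h ⊢
  refine fun x v => defect_eq_zero hδ x v 0 fun j hj _ => ?_
  obtain rfl : j = 1 := (by decide : ∀ j : Fin 2, j ≠ 0 → j = 1) j hj
  exact h x v

end SourceTarget

/-! #### Groupoids with discrete fibres -/

/-- The target of a string. -/
def strTarget (p : ℕ) (x : 𝒢.nerve (p + 1)) : 𝒢.nerve 0 := 𝒢.t (arrow 0 x)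

theorem smooth_strTarget (p : ℕ) : IsSmooth (strTarget (𝒢 := 𝒢) p) :=
  𝒢.smooth_t.comp (smooth_arrow 0)

theorem strTarget_face {p : ℕ} {i : Fin (p + 3)} (hi : i ≠ 0) (x : 𝒢.nerve (p + 2)) :
    strTarget p (face (p + 1) i x) = strTarget (p + 1) x := by
  have hi0 : 0 < (i : ℕ) := Nat.pos_of_ne_zero fun h => hi (Fin.ext h)
  unfold strTarget
  rw [arrow_face]
  unfold faceArrow
  split_ifs with c1 c2
  · rfl
  · exact 𝒢.t_mul _ _ (arrow_comp x _ _ rfl)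
  · simp at c1 c2
    omega

theorem eq_unit_of_inv_eq_unit {g : 𝒢.G} {y : 𝒢.M} (h : 𝒢.inv g = 𝒢.unit y) :
    g = 𝒢.unit y := by
  have h1 := 𝒢.mul_inv g
  have hs : 𝒢.s g = y := by rw [← 𝒢.t_inv, h, 𝒢.t_unit]
  have ht : 𝒢.t g = y := by rw [← 𝒢.s_inv, h, 𝒢.s_unit]
  rw [h, ← hs, 𝒢.mul_unit, ht] at h1
  rw [h1]

section Discrete

variable [Subsingleton (Fib 𝒢.G 𝒢.M)] {N : ∀ p, VForm (𝒢.nerve p) k}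

/-- With discrete fibres `t` is injective on tangent vectors, so the target determines the first
tangent arrow, its source determines the second one, and so on. -/
theorem tm_strTarget_injective {p : ℕ} (x : 𝒢.nerve (p + 1)) :
    Function.Injective (tm (strTarget p) x) := by
  refine (injective_iff_map_eq_zero _).2 fun v hv => eq_zero_of_tm_arrow x v fun i => ?_
  obtain ⟨i, hi⟩ := i
  induction i with
  | zero =>
    refine tm_injective_of_subsingleton 𝒢.subm_t (arrow 0 x) ?_
    exact ((tm_comp 𝒢.smooth_t (smooth_arrow (Γ := 𝒢.toSubmGraph) (p := p) 0) x v).symm.trans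
      hv).trans (map_zero (tm 𝒢.t (arrow 0 x))).symm
  | succ i ih =>
    have h1 := tm_s_arrow x ⟨i, by omega⟩ ⟨i + 1, hi⟩ rfl v
    rw [ih (by omega), map_zero] at h1
    refine tm_injective_of_subsingleton 𝒢.subm_t (arrow ⟨i + 1, hi⟩ x) ?_
    rw [map_zero, ← h1]

theorem face_zero_one_injective (x : 𝒢.nerve 1) :
    Function.Injective (tm (face (𝒢 := 𝒢) 0 1) x) := tm_strTarget_injective (p := 0) x

/-- With discrete fibres every tangent vector at a unit is tangent to the units, where the
degeneracy determines `N 1`. -/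
theorem defect_target_unit (hd : Related (degen (𝒢 := 𝒢) 0 0) (N 0) (N 1)) (y : 𝒢.nerve 0)
    (v : Fin k → (𝒢.nerve 1).Model) :
    defect (face 0 1) (N 1) (N 0) (degen 0 0 y) v = 0 := by
  have h1 : ∀ i, v i = tm (degen (𝒢 := 𝒢) 0 0) y (tm (face (𝒢 := 𝒢) 0 1) (degen 0 0 y) (v i)) :=
    fun i => face_zero_one_injective (degen 0 0 y) (tm_face_degen y _).symm
  refine sub_eq_zero.2 ?_
  have h2 : vat (N 1) (degen 0 0 y) v = tm (degen (𝒢 := 𝒢) 0 0) y (vat (N 0) y fun i =>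
      tm (face (𝒢 := 𝒢) 0 1) (degen 0 0 y) (v i)) := by
    rw [← related_iff.1 hd]
    exact congrArg _ (funext h1)
  rw [h2, tm_face_degen, face_zero_one_degen]

/-- Where `s ≠ t` the two faces are distinct, so there is no defect, and the same holds on the
closure. Elsewhere `s = t` near the arrow `g`. Units are covered by the degeneracy. For other `g`,
the string `(g, g⁻¹)` has the faces `g⁻¹`, a unit and `g`, and the unit is distinct from both
others. If `g⁻¹ ≠ g`, the face `g` is isolated too and `defect_target` applies; the case `g⁻¹ = g`
needs the equality of the tangent maps of `s` and `t`. -/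
theorem defect_target_discrete
    (hδ : ∀ p, lieD (N (p + 1)) ∘ₗ 𝒢.delta p = 𝒢.delta p ∘ₗ lieD (N p))
    (hd : Related (degen (𝒢 := 𝒢) 0 0) (N 0) (N 1)) :
    Related (face (𝒢 := 𝒢) 0 1) (N 1) (N 0) := by
  rw [related_iff_defect]
  intro x
  by_cases hx : x ∈ closure {z : 𝒢.nerve 1 | face 0 0 z ≠ face 0 1 z}
  · have hcl := isClosed_defect (face (𝒢 := 𝒢) 0 1) (N 1) (N 0)
    refine (hcl.closure_subset_iff.2 fun z hz v => ?_) hx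
    refine defect_eq_zero (hδ 0) z v 1 fun j hj h => absurd h ?_
    obtain rfl : j = 0 := (by decide : ∀ j : Fin 2, j ≠ 1 → j = 0) j hj
    exact hz
  have hst : (face (𝒢 := 𝒢) 0 0 : 𝒢.nerve 1 → _) =ᶠ[𝓝 x] face (𝒢 := 𝒢) 0 1 := by
    rw [mem_closure_iff_nhds] at hx
    push Not at hx
    obtain ⟨U, hU, hU'⟩ := hx
    filter_upwards [hU] with z hz
    by_contra hne
    exact (Set.eq_empty_iff_forall_notMem.1 hU' z) ⟨hz, hne⟩
  have hst' : tm (face (𝒢 := 𝒢) 0 0) x = tm (face (𝒢 := 𝒢) 0 1) x := hst.mfderiv_eq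
  intro v
  by_cases hu : ∃ y, x = degen 0 0 y
  · obtain ⟨y, rfl⟩ := hu
    exact defect_target_unit hd y v
  have e10 : ∀ y, face (𝒢 := 𝒢) 1 0 (invPair x) ≠ degen 0 0 y := fun y h => hu ⟨y,
    nerve_one_ext (eq_unit_of_inv_eq_unit (congrArg (arrow 0) h))⟩
  have d1 : defect (face 1 1) (N 2) (N 1) (invPair x) (fun i => tm invPair x (v i)) = 0 := by
    refine defect_eq_zero (hδ 1) _ _ 1 fun j hj h => absurd h ?_
    rw [face_one_one_invPair]
    have : j = 0 ∨ j = 2 := (by decide : ∀ j : Fin 3, j ≠ 1 → j = 0 ∨ j = 2) j hj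
    rcases this with rfl | rfl
    · exact e10 _
    · rw [face_one_two_invPair]
      exact fun h => hu ⟨_, h⟩
  -- For `g⁻¹ = g` the outer faces coincide and enter `δ` with the same sign, so their defects add
  -- up to zero. Their images under the tangent map of `t` are equal, because that of `s` agrees
  -- with it at `g`; each image is therefore zero, and it is the defect of `t` at `g`.
  by_cases h02 : face (𝒢 := 𝒢) 1 0 (invPair x) = x
  · have key := tm_target_of_defect hd x v d1
    have hs := fun φ => (Fin.sum_univ_three _).symm.trans
      (sum_defect (hδ 1) (invPair x) (fun i => tm invPair x (v i)) φ)
    rw [d1, h02, face_one_two_invPair] at hs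
    have h3 : defect (face 1 0) (N 2) (N 1) (invPair x) (fun i => tm invPair x (v i)) +
        defect (face 1 2) (N 2) (N 1) (invPair x) (fun i => tm invPair x (v i)) = 0 := by
      refine eq_of_dm (x := x) fun φ => ?_
      have := hs φ
      rw [map_add, map_zero]
      simpa [sgn] using this
    have h4 : ∀ w, tm (face (𝒢 := 𝒢) 0 1) x (tm (face (𝒢 := 𝒢) 1 0) (invPair x) w) =
        tm (face (𝒢 := 𝒢) 0 1) x (tm (face (𝒢 := 𝒢) 1 2) (invPair x) w) := by
      intro w
      have h5 := tm_face_face (𝒢 := 𝒢) 1 0 (invPair x) w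
      have h6 := tm_face_face (𝒢 := 𝒢) 0 2 (invPair x) w
      simp only [face_zero_one_face_one_zero] at h5
      rw [h02, ← h6, face_one_two_invPair, hst'] at h5
      exact h5
    have h7 : ∀ w, tm (face (𝒢 := 𝒢) 1 0) (invPair x) (tm invPair x w) = w := fun w =>
      face_zero_one_injective x (by rw [h4, tm_face_one_two_invPair])
    have h8 := congrArg (tm (face (𝒢 := 𝒢) 0 1) x) h3
    simp only [defect, map_add, map_sub, h4, key, h7, tm_face_one_two_invPair, map_zero] at h8
    rw [h02, face_one_two_invPair] at h8
    refine sub_eq_zero.2 ?_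
    have h9 : (2 : ℝ) • (tm (face (𝒢 := 𝒢) 0 1) x (vat (N 1) x v) -
        vat (N 0) (face 0 1 x) fun i => tm (face (𝒢 := 𝒢) 0 1) x (v i)) = 0 := by
      rw [two_smul]
      exact h8
    exact (sub_eq_zero.1 ((smul_eq_zero.1 h9).resolve_left two_ne_zero)).symm
  · refine defect_target hd x v d1 (defect_eq_zero (hδ 1) _ _ 2 fun j hj h => absurd h ?_)
    have : j = 0 ∨ j = 1 := (by decide : ∀ j : Fin 3, j ≠ 2 → j = 0 ∨ j = 1) j hj
    rw [face_one_two_invPair]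
    rcases this with rfl | rfl
    · exact h02
    · rw [face_one_one_invPair]
      exact fun h => hu ⟨_, h.symm⟩

end Discrete

end LieGroupoid

/-! ### Degenerate strings, longer strings with discrete fibres, and the recovery of the
multiplicative form. -/

namespace LieGroupoid

open SubmGraph

variable {𝒢 : LieGroupoid.{u}} {k : ℕ}

theorem arrow_degen {p : ℕ} (j : Fin (p + 2)) (x : 𝒢.nerve (p + 1)) (r : Fin (p + 2)) :
    arrow r (degen (p + 1) j x) = degArrow j x r := rfl

theorem arrow_face_one_zero {p : ℕ} (x : 𝒢.nerve (p + 2)) :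
    arrow 0 (face (p + 1) 1 x) = 𝒢.mul (arrow 0 x) (arrow 1 x) := by
  rw [arrow_face]
  simp [faceArrow]

theorem arrow_face_one_of_pos {p : ℕ} (x : 𝒢.nerve (p + 2)) {r : Fin (p + 1)} (hr : 0 < (r : ℕ)) :
    arrow r (face (p + 1) 1 x) = arrow r.succ x := by
  rw [arrow_face]
  unfold faceArrow
  have h1 : ((1 : Fin (p + 3)) : ℕ) = 1 := Fin.val_one _
  rw [if_neg (by omega), if_neg (by omega)]

/-- A string which starts with a unit is degenerate. -/
theorem degen_zero_face_one {p : ℕ} (x : 𝒢.nerve (p + 2))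
    (h : arrow 0 x = 𝒢.unit (𝒢.t (arrow 1 x))) : degen (p + 1) 0 (face (p + 1) 1 x) = x := by
  have hm : 𝒢.mul (arrow 0 x) (arrow 1 x) = arrow 1 x := by rw [h, 𝒢.unit_mul]
  refine nerve_ext fun r => ?_
  rw [arrow_degen]
  unfold degArrow vertex
  obtain ⟨r, hr⟩ := r
  match r with
  | 0 =>
    rw [dif_neg (by simp), dif_pos (by simp), dif_pos (by simp), arrow_face_one_zero, hm]
    exact h.symm
  | 1 =>
    rw [dif_neg (by simp), dif_neg (by simp)]
    exact (arrow_face_one_zero x).trans hm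
  | r + 2 =>
    rw [dif_neg (by simp), dif_neg (by simp)]
    exact arrow_face_one_of_pos x (r := ⟨r + 1, by omega⟩) (by simp)

/-- A string whose second arrow is a unit is degenerate. -/
theorem degen_one_face_one {p : ℕ} (x : 𝒢.nerve (p + 2))
    (h : arrow 1 x = 𝒢.unit (𝒢.s (arrow 0 x))) : degen (p + 1) 1 (face (p + 1) 1 x) = x := by
  have hm : 𝒢.mul (arrow 0 x) (arrow 1 x) = arrow 0 x := by rw [h, 𝒢.mul_unit]
  refine nerve_ext fun r => ?_
  rw [arrow_degen]
  unfold degArrow vertex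
  obtain ⟨r, hr⟩ := r
  match r with
  | 0 =>
    rw [dif_pos (by simp)]
    exact (arrow_face_one_zero x).trans hm
  | 1 =>
    rw [dif_neg (by simp), dif_pos (by simp), dif_neg (by simp)]
    refine Eq.trans ?_ h.symm
    have e : (⟨((1 : Fin (p + 2)) : ℕ) - 1, by omega⟩ : Fin (p + 1)) = 0 := by ext; simp
    rw [e, arrow_face_one_zero, hm]
  | r + 2 =>
    rw [dif_neg (by simp), dif_neg (by simp)]
    exact arrow_face_one_of_pos x (r := ⟨r + 1, by omega⟩) (by simp)

theorem strTarget_degen {p : ℕ} (j : Fin (p + 2)) (x : 𝒢.nerve (p + 1)) :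
    strTarget (p + 1) (degen (p + 1) j x) = strTarget p x := by
  unfold strTarget
  rw [arrow_degen]
  unfold degArrow vertex
  split_ifs with h1 h2 h3
  · rfl
  · exact 𝒢.t_unit _
  · exact absurd h2.symm h3
  · rw [Fin.val_zero] at h1 h2
    omega

section Discrete

variable [Subsingleton (Fib 𝒢.G 𝒢.M)] {N : ∀ p, VForm (𝒢.nerve p) k}

/-- Induction through `∂_1`, which preserves the target. If `∂_1 x` coincides with another face,
comparison of first arrows shows that one of the first two arrows of `x` is a unit. Then `x` is a
degeneracy of `∂_1 x`, and the degeneracy carries the relation instead. Otherwise `∂_1` is isolated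
at `x` and has no defect. -/
theorem related_strTarget (hδ : ∀ p, lieD (N (p + 1)) ∘ₗ 𝒢.delta p = 𝒢.delta p ∘ₗ lieD (N p))
    (hd : ∀ (p : ℕ) (i : Fin (p + 1)), Related (degen (𝒢 := 𝒢) p i) (N p) (N (p + 1))) :
    ∀ p, Related (strTarget (𝒢 := 𝒢) p) (N (p + 1)) (N 0)
  | 0 => defect_target_discrete hδ (hd 0 0)
  | p + 1 => by
    have ih := related_strTarget hδ hd p
    have sf := (face (𝒢 := 𝒢) (p + 1) 1).contMDiff
    have hτ : ∀ x w, tm (strTarget (𝒢 := 𝒢) p) (face (p + 1) 1 x)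
        (tm (face (𝒢 := 𝒢) (p + 1) 1) x w) = tm (strTarget (p + 1)) x w := fun x w => by
      rw [← tm_comp (smooth_strTarget p) sf]
      have : (fun y : 𝒢.nerve (p + 2) => strTarget p (face (p + 1) 1 y)) = strTarget (p + 1) :=
        funext fun y => strTarget_face (by simp) y
      rw [this]
    rw [related_iff]
    intro x v
    have key : vat (N 0) (strTarget (p + 1) x) (fun i => tm (strTarget (p + 1)) x (v i)) =
        tm (strTarget (𝒢 := 𝒢) p) (face (p + 1) 1 x) (vat (N (p + 1)) (face (p + 1) 1 x)
          fun i => tm (face (𝒢 := 𝒢) (p + 1) 1) x (v i)) := by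
      rw [← related_iff.1 ih, strTarget_face (by simp)]
      simp only [hτ]
    rw [key]
    have hdeg : ∀ j : Fin (p + 2), degen (p + 1) j (face (p + 1) 1 x) = x →
        tm (strTarget (𝒢 := 𝒢) p) (face (p + 1) 1 x) (vat (N (p + 1)) (face (p + 1) 1 x)
          fun i => tm (face (𝒢 := 𝒢) (p + 1) 1) x (v i)) =
            tm (strTarget (p + 1)) x (vat (N (p + 2)) x v) := by
      intro j hj
      have sd := (degen (𝒢 := 𝒢) (p + 1) j).contMDiff
      have hσ : ∀ w, tm (strTarget (𝒢 := 𝒢) (p + 1)) x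
          (tm (degen (𝒢 := 𝒢) (p + 1) j) (face (p + 1) 1 x) w) =
            tm (strTarget p) (face (p + 1) 1 x) w := fun w => by
        have h1 := tm_comp (smooth_strTarget (𝒢 := 𝒢) (p + 1)) sd (face (p + 1) 1 x) w
        have h2 : (fun y : 𝒢.nerve (p + 1) => strTarget (p + 1) (degen (p + 1) j y)) =
          strTarget p := funext fun y => strTarget_degen j y
        rw [h2, hj] at h1
        exact h1.symm
      have hv : ∀ i, tm (degen (𝒢 := 𝒢) (p + 1) j) (face (p + 1) 1 x)
          (tm (face (𝒢 := 𝒢) (p + 1) 1) x (v i)) = v i := fun i =>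
        tm_strTarget_injective x (by rw [hσ, hτ])
      have h3 := related_iff.1 (hd (p + 1) j) (face (p + 1) 1 x)
        fun i => tm (face (𝒢 := 𝒢) (p + 1) 1) x (v i)
      simp only [hv] at h3
      rw [hj] at h3
      rw [h3, hσ]
    have hc := arrow_comp x 0 1 (by simp)
    by_cases h0 : arrow 0 x = 𝒢.unit (𝒢.t (arrow 1 x))
    · exact hdeg 0 (degen_zero_face_one x h0)
    by_cases h1 : arrow 1 x = 𝒢.unit (𝒢.s (arrow 0 x))
    · exact hdeg 1 (degen_one_face_one x h1)
    have hz : defect (face (p + 1) 1) (N (p + 2)) (N (p + 1)) x v = 0 := by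
      refine defect_eq_zero (hδ (p + 1)) x v 1 fun j hj h => ?_
      exfalso
      have h2 := congrArg (arrow 0) h
      rw [arrow_face_one_zero, arrow_face] at h2
      unfold faceArrow at h2
      split_ifs at h2 with c1 c2
      · exact h1 (eq_unit_of_mul_eq_left hc h2.symm)
      · refine hj (Fin.ext ?_)
        rw [← c2]
        simp
      · exact h0 (eq_unit_of_mul_eq_right hc h2.symm)
    rw [sub_eq_zero.1 hz, hτ]

/-- All faces but `∂_0` preserve the target, whose tangent map is injective, so `related_strTarget`
on both sides suffices for them. The face `∂_0` is then the only one left in the alternating sum. -/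
theorem related_face_discrete
    (hδ : ∀ p, lieD (N (p + 1)) ∘ₗ 𝒢.delta p = 𝒢.delta p ∘ₗ lieD (N p))
    (hd : ∀ (p : ℕ) (i : Fin (p + 1)), Related (degen (𝒢 := 𝒢) p i) (N p) (N (p + 1)))
    (p : ℕ) (i : Fin (p + 3)) : Related (face (𝒢 := 𝒢) (p + 1) i) (N (p + 2)) (N (p + 1)) := by
  have h1 : ∀ i : Fin (p + 3), i ≠ 0 →
      Related (face (𝒢 := 𝒢) (p + 1) i) (N (p + 2)) (N (p + 1)) := fun i hi => by
    refine related_of_comp (ι := Unit) (a := fun _ => strTarget p)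
      (fun _ => smooth_strTarget p) (fun x v hv => tm_strTarget_injective x ?_)
      (fun _ => related_strTarget hδ hd p) (face (p + 1) i).contMDiff fun _ => ?_
    · rw [hv (), map_zero]
    · have : (fun z : 𝒢.nerve (p + 2) => strTarget p (face (p + 1) i z)) = strTarget (p + 1) :=
        funext fun z => strTarget_face hi z
      rw [this]
      exact related_strTarget hδ hd (p + 1)
  by_cases hi : i = 0
  · subst hi
    rw [related_iff_defect]
    exact fun x v => defect_eq_zero (hδ (p + 1)) x v 0 fun j hj _ =>
      related_iff_defect.1 (h1 j hj) x v
  · exact h1 i hi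

end Discrete

/-- What is needed to rebuild a multiplicative form: source and target, the multiplication, and the
first and last faces, which together reach every arrow of a string. With fibres of positive
dimension, the multiplication follows from the two outer faces of a pair, and the target map then
follows from the strings `(g, g⁻¹)`. -/
theorem related_faces {N : ∀ p, VForm (𝒢.nerve p) k}
    (hδ : ∀ p, lieD (N (p + 1)) ∘ₗ 𝒢.delta p = 𝒢.delta p ∘ₗ lieD (N p))
    (hd : ∀ (p : ℕ) (i : Fin (p + 1)), Related (degen (𝒢 := 𝒢) p i) (N p) (N (p + 1))) :
    (∀ i, Related (face (𝒢 := 𝒢) 0 i) (N 1) (N 0)) ∧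
      Related (face (𝒢 := 𝒢) 1 1) (N 2) (N 1) ∧
      ∀ p, Related (face (𝒢 := 𝒢) (p + 1) 0) (N (p + 2)) (N (p + 1)) ∧
        Related (face (𝒢 := 𝒢) (p + 1) (Fin.last _)) (N (p + 2)) (N (p + 1)) := by
  have hst : Related (face (𝒢 := 𝒢) 0 1) (N 1) (N 0) →
      ∀ i, Related (face (𝒢 := 𝒢) 0 i) (N 1) (N 0) := fun h i => by
    rcases (by decide : ∀ i : Fin 2, i = 0 ∨ i = 1) i with rfl | rfl
    · exact defect_source (hδ 0) h
    · exact h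
  rcases subsingleton_or_nontrivial (Fib 𝒢.G 𝒢.M) with _ | _
  · exact ⟨hst (defect_target_discrete hδ (hd 0 0)), related_face_discrete hδ hd 0 1, fun p =>
      ⟨related_face_discrete hδ hd p _, related_face_discrete hδ hd p _⟩⟩
  · have h0 := fun p => related_face_first (hδ (p + 1))
    have h2 := fun p => related_face_last (hδ (p + 1))
    have h1 : Related (face (𝒢 := 𝒢) 1 1) (N 2) (N 1) := by
      rw [related_iff_defect]
      refine fun x v => defect_eq_zero (hδ 1) x v 1 fun j hj _ => ?_
      rcases (by decide : ∀ j : Fin 3, j ≠ 1 → j = 0 ∨ j = 2) j hj with rfl | rfl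
      · exact related_iff_defect.1 (h0 0) x v
      · exact related_iff_defect.1 (h2 0) x v
    refine ⟨hst (related_iff_defect.2 fun x v => ?_), h1, fun p => ⟨h0 p, h2 p⟩⟩
    exact defect_target (hd 0 0) x v (related_iff_defect.1 h1 _ _) (related_iff_defect.1 (h2 0) _ _)

theorem tm_arrow_single (g : 𝒢.G) (v : 𝒢.G.Model) :
    tm (arrow 0) (single g) (tm (single (𝒢 := 𝒢)) g v) = v := by
  have h := tm_comp (smooth_arrow (Γ := 𝒢.toSubmGraph) (p := 0) 0) (single (𝒢 := 𝒢)).contMDiff g v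
  exact h.symm.trans (tm_id g v)

theorem single_arrow (x : 𝒢.nerve 1) : single (arrow 0 x) = x := nerve_one_ext rfl

theorem tm_single_arrow (x : 𝒢.nerve 1) (v : (𝒢.nerve 1).Model) :
    tm (single (𝒢 := 𝒢)) (arrow 0 x) (tm (arrow 0) x v) = v := by
  have h := tm_comp (single (𝒢 := 𝒢)).contMDiff (smooth_arrow (Γ := 𝒢.toSubmGraph) (p := 0) 0) x v
  simp only [single_arrow, tm_id] at h
  exact h.symm

theorem tm_single_injective (g : 𝒢.G) (v : 𝒢.G.Model) (h : tm (single (𝒢 := 𝒢)) g v = 0) :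
    v = 0 := by
  rw [← tm_arrow_single g v, h, map_zero]

/-- A sequence of vector-valued forms on the nerve whose Lie derivatives commute with `δ` and which
is compatible with the degeneracy maps is induced by a multiplicative form. -/
theorem exists_isInduced_of_delta {N : ∀ p, VForm (𝒢.nerve p) k}
    (hδ : ∀ p, lieD (N (p + 1)) ∘ₗ 𝒢.delta p = 𝒢.delta p ∘ₗ lieD (N p))
    (hd : ∀ (p : ℕ) (i : Fin (p + 1)), Related (degen (𝒢 := 𝒢) p i) (N p) (N (p + 1))) :
    ∃ K : VForm 𝒢.G k, IsInduced K N := by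
  obtain ⟨hst, hm, hf⟩ := related_faces hδ hd
  -- `K` is `N 1` transported along the diffeomorphism of `G` with the strings of length one.
  obtain ⟨K, hK⟩ := exists_related (fun _ : Unit => single (𝒢 := 𝒢)) (N 1)
    (fun g v hv => tm_single_injective g v (hv ())) fun g v =>
      ⟨tm (arrow 0) (single g) (vat (N 1) (single g) fun j => tm (single (𝒢 := 𝒢)) g (v j)),
        fun _ => tm_single_arrow (single g) _⟩
  have ss := (single (𝒢 := 𝒢)).contMDiff
  have h1 : Related (arrow (Γ := 𝒢.toSubmGraph) (p := 0) 0) (N 1) K := by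
    refine related_of_comp (ι := Unit) (a := fun _ => single (𝒢 := 𝒢)) (fun _ => ss)
      (fun g v hv => tm_single_injective g v (hv ())) hK (smooth_arrow 0) fun _ => ?_
    have : (fun z : 𝒢.nerve 1 => single (arrow 0 z)) = fun z => z := funext single_arrow
    rw [this, related_iff]
    intro x v
    simp only [tm_id]
  have harr : ∀ (p : ℕ) (i : Fin (p + 1)), Related (arrow i) (N (p + 1)) K := by
    intro p
    induction p with
    | zero =>
      intro i
      rw [Fin.fin_one_eq_zero i]
      exact h1
    | succ p ih =>
      intro i
      induction i using Fin.lastCases with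
      | last =>
        -- The last arrow of a string is also the last arrow of its first face; all other arrows
        -- survive in its last face.
        have := (ih (Fin.last p)).comp (hf p).1 (smooth_arrow _) (face (p + 1) 0).contMDiff
        have e : (fun x : 𝒢.nerve (p + 2) => arrow (Fin.last p) (face (p + 1) 0 x)) =
            arrow (Fin.last (p + 1)) := by
          funext x
          rw [arrow_face]
          simp [faceArrow]
        rwa [e] at this
      | cast i =>
        have := (ih i).comp (hf p).2 (smooth_arrow _) (face (p + 1) (Fin.last _)).contMDiff
        have e : (fun x : 𝒢.nerve (p + 2) => arrow i (face (p + 1) (Fin.last _) x)) =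
            arrow i.castSucc := by
          funext x
          rw [arrow_face]
          unfold faceArrow
          rw [if_pos (by simp only [Fin.val_last]; omega)]
        rwa [e] at this
  refine ⟨K, ⟨(hst 0).comp (hK ()) (face 0 0).contMDiff ss,
    (hst 1).comp (hK ()) (face 0 1).contMDiff ss, mul_of_related (harr 1) ?_⟩, harr⟩
  exact h1.comp hm (smooth_arrow 0) (face 1 1).contMDiff

theorem exists_isInduced_of_mem_totalDerivations {D : 𝒢.OpSeq}
    (hD : D ∈ 𝒢.totalDerivations (k : ℤ)) :
    ∃ (K : VForm 𝒢.G k) (N : ∀ p, VForm (𝒢.nerve p) k), IsInduced K N ∧ ∀ p, D p = lieD (N p) := by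
  obtain ⟨⟨h1, h2⟩, h3⟩ := hD
  obtain ⟨h4, h5⟩ := (gradedComm_total_eq_zero_iff h1).1 h3
  choose N hN using fun p => (h1 p).exists_eq_lieD (h4 p)
  obtain ⟨K, hK⟩ := exists_isInduced_of_delta (N := N)
    (fun p => by rw [← hN, ← hN]; exact h5 p)
    fun p i => related_of_pull_lieD (by rw [← hN, ← hN]; exact h2 p i)
  exact ⟨K, N, hK, hN⟩

end LieGroupoid

/-! ### The isomorphism -/

theorem insertion_add {X : Mfd.{u}} {k : ℕ} (K L : VForm X k) :
    insertion (K + L) = insertion K + insertion L := by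
  refine Forms.hom_ext fun q α => ?_
  cases q with
  | zero => simp
  | succ p =>
    rw [LinearMap.add_apply, insertion_homog_succ, insertion_homog_succ, insertion_homog_succ,
      ← map_add]
    refine congrArg _ (Form.ext fun x v => ?_)
    change insAt (K.1 x + L.1 x) (α.1 x) v = insAt (K.1 x) (α.1 x) v + insAt (L.1 x) (α.1 x) v
    simp only [insAt_apply, ← mul_add, ← Finset.sum_add_distrib]
    congr 1
    refine Finset.sum_congr rfl fun σ _ => ?_
    congr 1
    exact (α.1 x).cons_add _ _ _

theorem insertion_smul {X : Mfd.{u}} {k : ℕ} (c : ℝ) (K : VForm X k) :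
    insertion (c • K) = c • insertion K := by
  refine Forms.hom_ext fun q α => ?_
  cases q with
  | zero => simp
  | succ p =>
    rw [LinearMap.smul_apply, insertion_homog_succ, insertion_homog_succ, ← map_smul]
    refine congrArg _ (Form.ext fun x v => ?_)
    change insAt (c • K.1 x) (α.1 x) v = c * insAt (K.1 x) (α.1 x) v
    simp only [insAt_apply, Finset.mul_sum]
    refine Finset.sum_congr rfl fun σ _ => ?_
    have : α.1 x (Fin.cons ((c • K.1 x) fun i => v (σ (Fin.castAdd p i)))
        fun j => v (σ (Fin.natAdd k j))) = c * α.1 x (Fin.cons (K.1 x fun i =>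
          v (σ (Fin.castAdd p i))) fun j => v (σ (Fin.natAdd k j))) :=
      (α.1 x).cons_smul _ _ _
    rw [this]
    ring

theorem lieD_add {X : Mfd.{u}} {k : ℕ} (K L : VForm X k) : lieD (K + L) = lieD K + lieD L := by
  simp only [lieD, gradedComm, insertion_add, LinearMap.comp_add, LinearMap.add_comp, smul_add]
  abel

theorem lieD_smul {X : Mfd.{u}} {k : ℕ} (c : ℝ) (K : VForm X k) : lieD (c • K) = c • lieD K := by
  simp only [lieD, gradedComm, insertion_smul, LinearMap.comp_smul, LinearMap.smul_comp, smul_sub,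
    smul_comm c]

namespace LieGroupoid

open SubmGraph

variable {𝒢 : LieGroupoid.{u}} {k : ℕ}

theorem IsInduced.mem_multForms {K : VForm 𝒢.G k} {N : ∀ p, VForm (𝒢.nerve p) k}
    (h : IsInduced K N) : K ∈ 𝒢.multForms k := ⟨N 0, h.1⟩

theorem IsInduced.add {K K' : VForm 𝒢.G k} {N N' : ∀ p, VForm (𝒢.nerve p) k}
    (h : IsInduced K N) (h' : IsInduced K' N') : IsInduced (K + K') (fun p => N p + N' p) := by
  refine ⟨?_, fun p i => (h.2 p i).add (h'.2 p i)⟩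
  -- Some form is covered by the sum; uniqueness of the base form identifies it as `N 0 + N' 0`.
  obtain ⟨L, hL⟩ := (𝒢.multForms k).add_mem h.mem_multForms h'.mem_multForms
  have e : L = N 0 + N' 0 := eq_of_related_source hL.source (h.1.source.add h'.1.source)
  rw [e] at hL
  exact hL

theorem IsInduced.smul (c : ℝ) {K : VForm 𝒢.G k} {N : ∀ p, VForm (𝒢.nerve p) k}
    (h : IsInduced K N) : IsInduced (c • K) (fun p => c • N p) := by
  refine ⟨?_, fun p i => (h.2 p i).smul c⟩
  obtain ⟨L, hL⟩ := (𝒢.multForms k).smul_mem c h.mem_multForms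
  have e : L = c • N 0 := eq_of_related_source hL.source (h.1.source.smul c)
  rw [e] at hL
  exact hL

theorem exists_isInduced_of_mem {K : VForm 𝒢.G k} (h : K ∈ 𝒢.multForms k) :
    ∃ N : ∀ p, VForm (𝒢.nerve p) k, IsInduced K N := by
  obtain ⟨L, hL⟩ := h
  exact exists_isInduced hL

/-- The sequence of forms on the nerve induced by a multiplicative form. -/
def induced (K : 𝒢.multForms k) : ∀ p, VForm (𝒢.nerve p) k :=
  (exists_isInduced_of_mem K.2).choose

theorem isInduced_induced (K : 𝒢.multForms k) : IsInduced K.1 (induced K) :=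
  (exists_isInduced_of_mem K.2).choose_spec

theorem IsInduced.related_single {K : VForm 𝒢.G k} {N : ∀ p, VForm (𝒢.nerve p) k}
    (h : IsInduced K N) : Related (single (𝒢 := 𝒢)) K (N 1) := by
  refine related_to_nerve single.contMDiff (h.2 0) fun i => ?_
  change Related (fun g : 𝒢.G => g) K K
  rw [related_iff]
  intro x v
  simp only [tm_id]

/-- The map `K ↦ (L_{K_M}, L_K, L_{K^{(2)}}, …)`. -/
def lieSeq (𝒢 : LieGroupoid.{u}) (k : ℕ) : 𝒢.multForms k →ₗ[ℝ] 𝒢.totalDerivations (k : ℤ) where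
  toFun K := ⟨fun p => lieD (induced K p), (isInduced_induced K).mem_totalDerivations⟩
  map_add' K L := by
    apply Subtype.ext
    funext p
    have h := (isInduced_induced (K + L)).unique ((isInduced_induced K).add (isInduced_induced L))
    change lieD (induced (K + L) p) = lieD (induced K p) + lieD (induced L p)
    rw [h, lieD_add]
  map_smul' c K := by
    apply Subtype.ext
    funext p
    have h := (isInduced_induced (c • K)).unique ((isInduced_induced K).smul c)
    change lieD (induced (c • K) p) = c • lieD (induced K p)
    rw [h, lieD_smul]

/-- A right inverse of `pull single`, which makes this pullback cancellable on the right; operators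
on `Ω^•(G^(1))` can then be compared on `Ω^•(G)`. -/
theorem pull_single_pull_arrow (a : Forms 𝒢.G) :
    pull (single (𝒢 := 𝒢)) (pull (arrowMap 0) a) = a := by
  have : pull (single (𝒢 := 𝒢)) ∘ₗ pull (arrowMap 0) = LinearMap.id := by
    refine Forms.hom_ext fun q α => ?_
    simp only [LinearMap.comp_apply, pull_homog, LinearMap.id_apply]
    refine congrArg _ (Form.ext fun g v => ?_)
    exact congrArg (α.1 g) (funext fun i => tm_arrow_single g (v i))
  exact LinearMap.congr_fun this a

theorem eq_of_comp_pull_single {A B : Forms 𝒢.G →ₗ[ℝ] Forms 𝒢.G}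
    (h : A ∘ₗ pull (single (𝒢 := 𝒢)) = B ∘ₗ pull single) : A = B := by
  refine LinearMap.ext fun a => ?_
  have := LinearMap.congr_fun h (pull (arrowMap 0) a)
  simpa only [LinearMap.comp_apply, pull_single_pull_arrow] using this

/-- The component on strings of length one already determines `L_K`, hence `K`. Surjectivity is the
reconstruction of `K`, and uniqueness of the induced sequence identifies the chosen sequence with
the one found. -/
theorem lieSeq_bijective (k : ℕ) : Function.Bijective (𝒢.lieSeq k) := by
  constructor
  · intro K L h
    have h1 : lieD (induced K 1) = lieD (induced L 1) := congrFun (congrArg Subtype.val h) 1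
    have h2 := pull_lieD single (isInduced_induced K).related_single
    have h3 := pull_lieD single (isInduced_induced L).related_single
    rw [h1, h3] at h2
    exact Subtype.ext (lieD_injective (eq_of_comp_pull_single h2.symm))
  · rintro ⟨D, hD⟩
    obtain ⟨K, N, hK, hN⟩ := exists_isInduced_of_mem_totalDerivations hD
    refine ⟨⟨K, hK.mem_multForms⟩, Subtype.ext (funext fun p => ?_)⟩
    change lieD (induced ⟨K, hK.mem_multForms⟩ p) = D p
    rw [(isInduced_induced ⟨K, hK.mem_multForms⟩).unique hK, hN]

/-! ### Graded commutators of sequences, and the main theorem. -/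

theorem gradedComm_comp_eq {C C' : Type*} [AddCommGroup C] [Module ℝ C] [AddCommGroup C']
    [Module ℝ C'] {a b : ℤ} {A B : C →ₗ[ℝ] C} {A' B' : C' →ₗ[ℝ] C'} {f : C →ₗ[ℝ] C'}
    (hA : f ∘ₗ A = A' ∘ₗ f) (hB : f ∘ₗ B = B' ∘ₗ f) :
    f ∘ₗ gradedComm a b A B = gradedComm a b A' B' ∘ₗ f := by
  refine LinearMap.ext fun c => ?_
  have hA' := fun c => LinearMap.congr_fun hA c
  have hB' := fun c => LinearMap.congr_fun hB c
  simp only [LinearMap.comp_apply] at hA' hB'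
  simp only [gradedComm, LinearMap.comp_apply, LinearMap.sub_apply, LinearMap.smul_apply, map_sub,
    map_smul, hA', hB']

/-- Checked componentwise: graded commutators preserve derivations, commutation with `d`, and
intertwining by a linear map, be it the pullback along a degeneracy or `δ`. -/
theorem gradedComm_mem_totalDerivations {a b : ℤ} {A B : 𝒢.OpSeq} (hA : A ∈ 𝒢.totalDerivations a)
    (hB : B ∈ 𝒢.totalDerivations b) :
    (fun p => gradedComm a b (A p) (B p)) ∈ 𝒢.totalDerivations (a + b) := by
  obtain ⟨⟨a1, a2⟩, a3⟩ := hA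
  obtain ⟨⟨b1, b2⟩, b3⟩ := hB
  obtain ⟨a4, a5⟩ := (gradedComm_total_eq_zero_iff a1).1 a3
  obtain ⟨b4, b5⟩ := (gradedComm_total_eq_zero_iff b1).1 b3
  refine ⟨⟨fun p => (a1 p).gradedComm (b1 p), fun p i => gradedComm_comp_eq (a2 p i) (b2 p i)⟩, ?_⟩
  rw [gradedComm_total_eq_zero_iff fun p => (a1 p).gradedComm (b1 p)]
  exact ⟨fun p => (a4 p).gradedComm (b4 p), fun p =>
    (gradedComm_comp_eq (a5 p).symm (b5 p).symm).symm⟩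

end LieGroupoid

end MultForms

open MultForms MultForms.LieGroupoid

/-- The clause with `pull single` expresses `K^(1) = K`, the strings of length one being only
diffeomorphic to `G`. -/
theorem mainTheorem2 (𝒢 : MultForms.LieGroupoid.{u}) :
    ∃ Φ : ∀ k : ℕ, 𝒢.multForms k ≃ₗ[ℝ] 𝒢.totalDerivations (k : ℤ),
      (∀ (k : ℕ) (K : 𝒢.multForms k),
        (∃! Kbar : ∀ p : ℕ, MultForms.VForm (𝒢.nerve p) k,
          MultForms.LieGroupoid.IsInduced K.1 Kbar) ∧
        (∀ Kbar : ∀ p : ℕ, MultForms.VForm (𝒢.nerve p) k,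
          MultForms.LieGroupoid.IsInduced K.1 Kbar →
            ∀ p : ℕ, (Φ k K).1 p = MultForms.lieD (Kbar p)) ∧
        MultForms.pull MultForms.LieGroupoid.single ∘ₗ (Φ k K).1 1 =
          MultForms.lieD K.1 ∘ₗ MultForms.pull MultForms.LieGroupoid.single) ∧
      (∀ l : ℤ, l < 0 → ∀ D ∈ 𝒢.totalDerivations l, D = 0) ∧
      (∀ (k l : ℕ) (K : 𝒢.multForms k) (L : 𝒢.multForms l),
        ∃ B : 𝒢.multForms (k + l), MultForms.IsFNBracket K.1 L.1 B.1 ∧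
          (∀ B' : MultForms.VForm 𝒢.G (k + l), MultForms.IsFNBracket K.1 L.1 B' → B' = B.1) ∧
          ∀ p : ℕ, (Φ (k + l) B).1 p =
            MultForms.gradedComm k l ((Φ k K).1 p) ((Φ l L).1 p)) := by
  refine ⟨fun k => LinearEquiv.ofBijective (𝒢.lieSeq k) (lieSeq_bijective k), fun k K => ?_,
    fun l hl D hD => ?_, fun k l K L => ?_⟩
  · refine ⟨⟨induced K, isInduced_induced K, fun N hN => hN.unique (isInduced_induced K)⟩,
      fun N hN p => ?_, pull_lieD single (isInduced_induced K).related_single⟩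
    rw [hN.unique (isInduced_induced K)]
    rfl
  · obtain ⟨⟨h1, -⟩, h3⟩ := hD
    funext p
    exact (h1 p).eq_zero_of_neg hl (((gradedComm_total_eq_zero_iff h1).1 h3).1 p)
  -- The bracket is not constructed by hand: the graded commutators form an admissible sequence, so
  -- by surjectivity they come from a multiplicative `B`, and the component on strings of length
  -- one, transported to `G`, shows that `B` is the Frölicher–Nijenhuis bracket.
  · have hmem : (fun p => gradedComm k l ((𝒢.lieSeq k K).1 p) ((𝒢.lieSeq l L).1 p)) ∈
        𝒢.totalDerivations ((k + l : ℕ) : ℤ) := by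
      rw [Nat.cast_add]
      exact gradedComm_mem_totalDerivations (𝒢.lieSeq k K).2 (𝒢.lieSeq l L).2
    obtain ⟨B, hB⟩ := (lieSeq_bijective (𝒢 := 𝒢) (k + l)).2 ⟨_, hmem⟩
    have hp : ∀ p, (𝒢.lieSeq (k + l) B).1 p =
        gradedComm k l ((𝒢.lieSeq k K).1 p) ((𝒢.lieSeq l L).1 p) := fun p =>
      congrFun (congrArg Subtype.val hB) p
    have hFN : IsFNBracket K.1 L.1 B.1 := by
      have hK := pull_lieD single (isInduced_induced K).related_single
      have hL := pull_lieD single (isInduced_induced L).related_single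
      have hB' := pull_lieD single (isInduced_induced B).related_single
      have h1 : lieD (induced B 1) = gradedComm k l (lieD (induced K 1)) (lieD (induced L 1)) :=
        hp 1
      rw [h1, gradedComm_comp_eq hK hL] at hB'
      exact eq_of_comp_pull_single hB'.symm
    exact ⟨B, hFN, fun B' hB' => lieD_injective (hB'.trans hFN.symm), hp⟩

end
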